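/- Let $\Bbbk$ be a field with $\operatorname{char}\Bbbk\neq 2$. A super commutative Hopf algebra is a $\mathbb{Z}/2$-graded algebra $A=A_0\oplus A_1$ over $\Bbbk$ such that $ab=ba$ if $a$ or $b$ is even and $ab=-ba$ if both are odd, with a coassociative coproduct $\Delta:A\to A\otimes A$ and counit $\varepsilon:A\to\Bbbk$ which are $\mathbb{Z}/2$-graded algebra maps, where $A\otimes A$ has the product $(a\otimes b)(c\otimes d)=(-1)^{|b||c|}ac\otimes bd$, and with a graded linear antipode $S:A\to A$. A super affine group $G$ over $\Bbbk$ is the representable group-valued functor on super commutative algebras given by a super commutative Hopf algebra $\mathcal{O}(G)$; an affine group over $\Bbbk$ is in the same way given by an ordinary commutative Hopf algebra. The affine group $G_{ev}$ associated with $G$ is the restriction of the functor $G$ to ordinary commutative algebras; it is represented by the commutative Hopf algebra $\mathcal{O}(G_{ev})=\mathcal{O}(G)/(\mathcal{O}(G)_1)$, the quotient by the ideal generated by the odd elements. A super affine group (or an affine group) $G$ is unipotent if $\mathcal{O}(G)$ is irreducible as a coalgebra, that is, if every simple right $\mathcal{O}(G)$-comodule is isomorphic to the trivial comodule $\Bbbk$,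 with coaction $c\mapsto c\otimes 1$. Theorem. A super affine group $G$ over $\Bbbk$ is unipotent if and only if the associated affine group $G_{ev}$ is unipotent. -/

import Mathlib

open scoped TensorProduct

universe u v

noncomputable section

/-! ### Comodules and irreducible coalgebras -/

/-- A right comodule structure on the vector space `V` over the coalgebra `C`. -/
structure RightComodule (k : Type*) [Field k] (C : Type*) [AddCommGroup C] [Module k C]
    [Coalgebra k C] (V : Type*) [AddCommGroup V] [Module k V] where
  /-- The coaction `V → V ⊗ C`. -/
  coact : V →ₗ[k] V ⊗[k] C
  /-- `(ρ ⊗ id) ∘ ρ = (id ⊗ Δ) ∘ ρ`. -/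
  coassoc : ∀ x : V, TensorProduct.assoc k V C C (coact.rTensor C (coact x)) =
    (Coalgebra.comul (R := k) (A := C)).lTensor V (coact x)
  /-- `(id ⊗ ε) ∘ ρ = id`. -/
  counit : ∀ x : V, TensorProduct.rid k V
    ((Coalgebra.counit (R := k) (A := C)).lTensor V (coact x)) = x

namespace RightComodule

variable {k : Type*} [Field k] {C : Type*} {V : Type*} [AddCommGroup V] [Module k V]

/-- `W ⊆ V` is a subcomodule: `ρ(W) ⊆ W ⊗ C`. -/
def IsSubcomodule [AddCommGroup C] [Module k C] [Coalgebra k C]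
    (ρ : RightComodule k C V) (W : Submodule k V) : Prop :=
  ∀ w ∈ W, ρ.coact w ∈ LinearMap.range (W.subtype.rTensor C)

/-- A comodule is simple if it is nonzero and has no subcomodules besides `0` and itself. -/
def IsSimple [AddCommGroup C] [Module k C] [Coalgebra k C] (ρ : RightComodule k C V) : Prop :=
  Nontrivial V ∧ ∀ W : Submodule k V, ρ.IsSubcomodule W → W = ⊥ ∨ W = ⊤

/-- The comodule `V` is isomorphic to the trivial comodule `k`, whose coaction is
`c ↦ c ⊗ 1`. -/
def IsTrivial [Ring C] [Algebra k C] [Coalgebra k C] (ρ : RightComodule k C V) : Prop :=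
  ∃ e : V ≃ₗ[k] k, ∀ x : V, e.toLinearMap.rTensor C (ρ.coact x) = e x ⊗ₜ[k] (1 : C)

end RightComodule

/-- `C` (an algebra with a coalgebra structure for which `1` is grouplike) is irreducible as
a coalgebra: the trivial comodule `k` is, up to isomorphism, the only simple right
`C`-comodule.  Every simple comodule embeds into `C`, so that it is enough to let `V` range
over the universe of `C`. -/
def IsIrreducibleCoalgebra (k : Type u) [Field k] (C : Type v) [Ring C] [Algebra k C]
    [Coalgebra k C] : Prop :=
  ∀ (V : Type v) [AddCommGroup V] [Module k V] (ρ : RightComodule k C V),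
    ρ.IsSimple → ρ.IsTrivial

/-! ### Super commutative Hopf algebras -/

/-- The component of degree `i` of the tensor square of a super vector space, for the total
degree: `⨁_{j + l = i} A_j ⊗ A_l`. -/
def superTensorSq {k A : Type*} [Field k] [AddCommGroup A] [Module k A]
    (𝒜 : ZMod 2 → Submodule k A) (i : ZMod 2) : Submodule k (A ⊗[k] A) :=
  ⨆ j : ZMod 2, LinearMap.range (TensorProduct.map (𝒜 j).subtype (𝒜 (i - j)).subtype)

/-- A super-commutative super Hopf algebra: a `ℤ/2`-graded algebra `A = A_0 ⊕ A_1` with a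
coalgebra structure, such that the product is super-commutative, the counit and the coproduct
`A → A ⊗ A` are graded algebra maps (the product on `A ⊗ A` being
`(a ⊗ b)(c ⊗ d) = (-1)^{|b||c|} ac ⊗ bd`), and there is an antipode, which is graded. -/
class SuperCommHopfAlgebra (k : Type*) [Field k] {A : Type*} [Ring A] [Algebra k A]
    [Coalgebra k A] (𝒜 : ZMod 2 → Submodule k A) [GradedAlgebra 𝒜] where
  even_mul_comm : ∀ a ∈ 𝒜 0, ∀ b : A, a * b = b * a
  odd_mul_odd : ∀ a ∈ 𝒜 1, ∀ b ∈ 𝒜 1, a * b = -(b * a)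
  counit_one : Coalgebra.counit (R := k) (1 : A) = 1
  counit_mul : ∀ a b : A, Coalgebra.counit (R := k) (a * b) =
    Coalgebra.counit (R := k) a * Coalgebra.counit (R := k) b
  counit_odd : ∀ a ∈ 𝒜 1, Coalgebra.counit (R := k) a = 0
  comul_one : Coalgebra.comul (R := k) (1 : A) = 1 ⊗ₜ[k] 1
  comul_mul : ∀ a b : A,
    GradedTensorProduct.of k 𝒜 𝒜 (Coalgebra.comul (R := k) (a * b)) =
      GradedTensorProduct.of k 𝒜 𝒜 (Coalgebra.comul (R := k) a) *
        GradedTensorProduct.of k 𝒜 𝒜 (Coalgebra.comul (R := k) b)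
  comul_graded : ∀ i, ∀ a ∈ 𝒜 i, Coalgebra.comul (R := k) a ∈ superTensorSq 𝒜 i
  /-- The antipode. -/
  antipode : A →ₗ[k] A
  antipode_graded : ∀ i, ∀ a ∈ 𝒜 i, antipode a ∈ 𝒜 i
  mul_antipode_rTensor_comul : ∀ a : A,
    LinearMap.mul' k A (antipode.rTensor A (Coalgebra.comul (R := k) a)) =
      algebraMap k A (Coalgebra.counit (R := k) a)
  mul_antipode_lTensor_comul : ∀ a : A,
    LinearMap.mul' k A (antipode.lTensor A (Coalgebra.comul (R := k) a)) =
      algebraMap k A (Coalgebra.counit (R := k) a)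

/-! ### The quotient `A / (A_1)` as an ordinary commutative Hopf algebra -/

namespace SuperCommHopfAlgebra

/-- The ideal `(A_1)` generated by the odd elements. (It is two-sided, see below, so that the
left ideal generated by `A_1` is the ideal generated by `A_1`.) -/
def oddIdeal {k A : Type*} [Field k] [Ring A] [Algebra k A] (𝒜 : ZMod 2 → Submodule k A) :
    Ideal A :=
  Ideal.span (𝒜 1 : Set A)

theorem exists_even_add_odd {k : Type u} [Field k] {A : Type v} [Ring A] [Algebra k A]
    (𝒜 : ZMod 2 → Submodule k A) [GradedAlgebra 𝒜] (a : A) :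
    ∃ x ∈ 𝒜 0, ∃ y ∈ 𝒜 1, a = x + y := by
  classical
  refine ⟨_, (DirectSum.decompose 𝒜 a 0).2, _, (DirectSum.decompose 𝒜 a 1).2, ?_⟩
  have h : ∑ i : ZMod 2, ((DirectSum.decompose 𝒜 a) i : A) = a := by
    conv_rhs => rw [← DirectSum.sum_support_decompose 𝒜 a]
    symm
    apply Finset.sum_subset (Finset.subset_univ _)
    intro i _ hi
    simpa using hi
  exact h.symm.trans (Fin.sum_univ_two (fun i : Fin 2 => ((DirectSum.decompose 𝒜 a) i : A)))

variable {k : Type u} [Field k] {A : Type v} [Ring A] [Algebra k A] [Coalgebra k A]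
  (𝒜 : ZMod 2 → Submodule k A) [GradedAlgebra 𝒜] [SuperCommHopfAlgebra k 𝒜]

instance isTwoSided : (oddIdeal 𝒜).IsTwoSided := by
  refine ⟨fun {a} b ha => ?_⟩
  refine Submodule.span_induction (p := fun x _ => x * b ∈ oddIdeal 𝒜) ?_ ?_ ?_ ?_ ha
  · intro x hx
    obtain ⟨c, hc, d, hd, rfl⟩ := exists_even_add_odd 𝒜 b
    have e : x * (c + d) = c * x + (-d) * x := by
      rw [mul_add, even_mul_comm (k := k) (𝒜 := 𝒜) c hc x,
        odd_mul_odd (k := k) (𝒜 := 𝒜) x hx d hd, neg_mul]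
    rw [e, ← add_mul]
    exact (oddIdeal 𝒜).mul_mem_left _ (Ideal.subset_span hx)
  · simp
  · intro x y _ _ hx hy
    rw [add_mul]
    exact (oddIdeal 𝒜).add_mem hx hy
  · intro c x _ hx
    rw [smul_eq_mul, mul_assoc]
    exact (oddIdeal 𝒜).mul_mem_left _ hx

/-- The largest purely even quotient `Ā = A / (A_1)`. -/
abbrev Bar : Type v := A ⧸ oddIdeal 𝒜

/-- The projection `A → Ā`. -/
abbrev proj : A →ₐ[k] Bar 𝒜 := Ideal.Quotient.mkₐ k (oddIdeal 𝒜)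

theorem proj_odd {a : A} (ha : a ∈ 𝒜 1) : proj 𝒜 a = 0 :=
  Ideal.Quotient.eq_zero_iff_mem.mpr (Ideal.subset_span ha)

theorem proj_surjective : Function.Surjective (proj 𝒜) := Ideal.Quotient.mk_surjective

instance barCommRing : CommRing (Bar 𝒜) where
  mul_comm x y := by
    obtain ⟨a, rfl⟩ := proj_surjective 𝒜 x
    obtain ⟨b, rfl⟩ := proj_surjective 𝒜 y
    obtain ⟨c, hc, d, hd, rfl⟩ := exists_even_add_odd 𝒜 a
    rw [map_add, proj_odd 𝒜 hd, add_zero, ← map_mul, ← map_mul,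
      even_mul_comm (k := k) (𝒜 := 𝒜) c hc b]

/-- The map `(id ⊗ π) ∘ Δ : A → A ⊗ Ā` as a linear map. -/
def coactLin : A →ₗ[k] A ⊗[k] Bar 𝒜 :=
  (proj 𝒜).toLinearMap.lTensor A ∘ₗ Coalgebra.comul

/-- The signs of the product on `A ⊗ A` disappear in `A ⊗ Ā`. -/
theorem lTensor_proj_mul (t s : A ⊗[k] A) :
    (proj 𝒜).toLinearMap.lTensor A ((GradedTensorProduct.of k 𝒜 𝒜).symm
      (GradedTensorProduct.of k 𝒜 𝒜 t * GradedTensorProduct.of k 𝒜 𝒜 s)) =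
    (proj 𝒜).toLinearMap.lTensor A t * (proj 𝒜).toLinearMap.lTensor A s := by
  induction t using TensorProduct.induction_on with
  | zero => simp
  | add x y hx hy => simp only [map_add, add_mul, hx, hy]
  | tmul a b =>
    induction s using TensorProduct.induction_on with
    | zero => simp
    | add x y hx hy => simp only [map_add, mul_add, hx, hy]
    | tmul c d =>
      obtain ⟨b0, hb0, b1, hb1, rfl⟩ := exists_even_add_odd 𝒜 b
      obtain ⟨c0, hc0, c1, hc1, rfl⟩ := exists_even_add_odd 𝒜 c
      have key : ∀ i j : ZMod 2, ∀ b ∈ 𝒜 i, ∀ c ∈ 𝒜 j,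
          (proj 𝒜).toLinearMap.lTensor A ((GradedTensorProduct.of k 𝒜 𝒜).symm
            (GradedTensorProduct.of k 𝒜 𝒜 (a ⊗ₜ b) * GradedTensorProduct.of k 𝒜 𝒜 (c ⊗ₜ d))) =
          (a * c) ⊗ₜ proj 𝒜 (b * d) := by
        intro i j b hb c hc
        have h := GradedTensorProduct.tmul_coe_mul_coe_tmul (R := k) 𝒜 𝒜 a ⟨b, hb⟩ ⟨c, hc⟩ d
        simp only [GradedTensorProduct.tmul] at h
        rw [h]
        obtain rfl | rfl : i = 0 ∨ i = 1 := by clear * -; revert i; decide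
        · simp
        · have hb' : proj 𝒜 b = 0 := proj_odd 𝒜 hb
          have h0 : (proj 𝒜).toLinearMap.lTensor A ((a * c) ⊗ₜ[k] (b * d)) = 0 := by
            rw [LinearMap.lTensor_tmul, AlgHom.toLinearMap_apply, map_mul, hb', zero_mul,
              TensorProduct.tmul_zero]
          rw [map_mul, hb', zero_mul, TensorProduct.tmul_zero]
          obtain h1 | h1 := Int.units_eq_one_or ((-1 : ℤˣ) ^ ((1 : ZMod 2) * j))
          · rw [h1, one_smul, GradedTensorProduct.of_symm_of, h0]
          · rw [h1, Units.neg_smul, one_smul, map_neg, map_neg,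
              GradedTensorProduct.of_symm_of, h0, neg_zero]
      simp only [TensorProduct.tmul_add, TensorProduct.add_tmul, map_add, mul_add, add_mul]
      rw [key 0 0 b0 hb0 c0 hc0, key 0 1 b0 hb0 c1 hc1, key 1 0 b1 hb1 c0 hc0,
        key 1 1 b1 hb1 c1 hc1]
      simp only [LinearMap.lTensor_tmul, AlgHom.toLinearMap_apply,
        Algebra.TensorProduct.tmul_mul_tmul, map_mul]

/-- `(id ⊗ π) ∘ Δ : A → A ⊗ Ā` as an algebra map (for the usual product on `A ⊗ Ā`). -/
def coactAlg : A →ₐ[k] A ⊗[k] Bar 𝒜 :=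
  AlgHom.ofLinearMap (coactLin 𝒜)
    (by
      simp [coactLin, comul_one (k := k) (𝒜 := 𝒜), Algebra.TensorProduct.one_def])
    (fun a b => by
      have h := congrArg (GradedTensorProduct.of k 𝒜 𝒜).symm
        (comul_mul (k := k) (𝒜 := 𝒜) a b)
      rw [GradedTensorProduct.of_symm_of] at h
      simp only [coactLin, LinearMap.comp_apply]
      rw [h, lTensor_proj_mul])

/-- `(π ⊗ π) ∘ Δ : A → Ā ⊗ Ā`. -/
def comulAux : A →ₐ[k] Bar 𝒜 ⊗[k] Bar 𝒜 :=
  (Algebra.TensorProduct.map (proj 𝒜) (AlgHom.id k (Bar 𝒜))).comp (coactAlg 𝒜)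

theorem comulAux_apply (a : A) : comulAux 𝒜 a =
    TensorProduct.map (proj 𝒜).toLinearMap (proj 𝒜).toLinearMap (Coalgebra.comul a) := by
  have h : TensorProduct.map (proj 𝒜).toLinearMap (proj 𝒜).toLinearMap =
    (TensorProduct.map (proj 𝒜).toLinearMap LinearMap.id) ∘ₗ
      (proj 𝒜).toLinearMap.lTensor A := by
    ext; simp
  rw [h]
  rfl

theorem comulAux_oddIdeal (a : A) (ha : a ∈ oddIdeal 𝒜) : comulAux 𝒜 a = 0 := by
  have : oddIdeal 𝒜 ≤ RingHom.ker (comulAux 𝒜) := by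
    refine Ideal.span_le.mpr fun x hx => ?_
    rw [SetLike.mem_coe, RingHom.mem_ker, comulAux_apply]
    have h2 : superTensorSq 𝒜 1 ≤ LinearMap.ker
        (TensorProduct.map (proj 𝒜).toLinearMap (proj 𝒜).toLinearMap) := by
      refine iSup_le fun j => ?_
      rw [LinearMap.range_le_ker_iff]
      ext ⟨p, hp⟩ ⟨q, hq⟩
      fin_cases j
      · have := proj_odd 𝒜 (a := q) hq
        simp only [AlgHom.toLinearMap_apply, TensorProduct.AlgebraTensorModule.curry_apply,
          TensorProduct.curry_apply, LinearMap.restrictScalars_self, LinearMap.comp_apply,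
          TensorProduct.map_tmul, Submodule.subtype_apply, this, TensorProduct.tmul_zero]
        rfl
      · have := proj_odd 𝒜 (a := p) hp
        simp only [AlgHom.toLinearMap_apply, TensorProduct.AlgebraTensorModule.curry_apply,
          TensorProduct.curry_apply, LinearMap.restrictScalars_self, LinearMap.comp_apply,
          TensorProduct.map_tmul, Submodule.subtype_apply, this, TensorProduct.zero_tmul]
        rfl
    exact h2 (comul_graded (k := k) 1 x hx)
  exact this ha

/-- The counit of `A` as an algebra map. -/
def counitAlg : A →ₐ[k] k :=
  AlgHom.ofLinearMap Coalgebra.counit (counit_one (𝒜 := 𝒜)) (counit_mul (𝒜 := 𝒜))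

theorem counitAlg_oddIdeal (a : A) (ha : a ∈ oddIdeal 𝒜) : counitAlg 𝒜 a = 0 := by
  have : oddIdeal 𝒜 ≤ RingHom.ker (counitAlg 𝒜) :=
    Ideal.span_le.mpr fun x hx => counit_odd (k := k) (𝒜 := 𝒜) x hx
  exact this ha

/-- The coproduct induced on `Ā`. -/
def barComul : Bar 𝒜 →ₐ[k] Bar 𝒜 ⊗[k] Bar 𝒜 :=
  Ideal.Quotient.liftₐ (oddIdeal 𝒜) (comulAux 𝒜) (comulAux_oddIdeal 𝒜)

/-- The counit induced on `Ā`. -/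
def barCounit : Bar 𝒜 →ₐ[k] k :=
  Ideal.Quotient.liftₐ (oddIdeal 𝒜) (counitAlg 𝒜) (counitAlg_oddIdeal 𝒜)

theorem barComul_proj (a : A) : barComul 𝒜 (proj 𝒜 a) =
    TensorProduct.map (proj 𝒜).toLinearMap (proj 𝒜).toLinearMap (Coalgebra.comul a) :=
  comulAux_apply 𝒜 a

theorem barCounit_proj (a : A) : barCounit 𝒜 (proj 𝒜 a) = Coalgebra.counit (R := k) a := rfl

theorem barComul_comp : (barComul 𝒜).toLinearMap ∘ₗ (proj 𝒜).toLinearMap =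
    TensorProduct.map (proj 𝒜).toLinearMap (proj 𝒜).toLinearMap ∘ₗ Coalgebra.comul :=
  LinearMap.ext (barComul_proj 𝒜)

theorem barCounit_comp : (barCounit 𝒜).toLinearMap ∘ₗ (proj 𝒜).toLinearMap =
    Coalgebra.counit := rfl

theorem proj_surjective' : Function.Surjective (proj 𝒜).toLinearMap := proj_surjective 𝒜

instance barCoalgebra : Coalgebra k (Bar 𝒜) where
  comul := (barComul 𝒜).toLinearMap
  counit := (barCounit 𝒜).toLinearMap
  coassoc := by
    rw [← LinearMap.cancel_right (proj_surjective' 𝒜)]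
    simp only [coassoc_simps, barComul_comp]
  rTensor_counit_comp_comul := by
    rw [← LinearMap.cancel_right (proj_surjective' 𝒜)]
    simp only [coassoc_simps, barComul_comp, barCounit_comp]
    rw [CoassocSimps.map_counit_comp_comul_left]; rfl
  lTensor_counit_comp_comul := by
    rw [← LinearMap.cancel_right (proj_surjective' 𝒜)]
    simp only [coassoc_simps, barComul_comp, barCounit_comp]
    rw [CoassocSimps.map_counit_comp_comul_right]; rfl

instance barBialgebra : Bialgebra k (Bar 𝒜) :=
  Bialgebra.mk' k (Bar 𝒜) (map_one (barCounit 𝒜)) (map_mul (barCounit 𝒜) _ _)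
    (map_one (barComul 𝒜)) (map_mul (barComul 𝒜) _ _)

/-- `π ∘ S : A → Ā`, where `S` is the antipode of `A`. -/
def antipodeAux : A →ₗ[k] Bar 𝒜 := (proj 𝒜).toLinearMap ∘ₗ antipode 𝒜

theorem mul'_map_antipodeAux_proj (a : A) :
    LinearMap.mul' k (Bar 𝒜) (TensorProduct.map (antipodeAux 𝒜) (proj 𝒜).toLinearMap
      (Coalgebra.comul a)) = algebraMap k (Bar 𝒜) (Coalgebra.counit (R := k) a) := by
  have h := congrArg (proj 𝒜) (mul_antipode_rTensor_comul (k := k) (𝒜 := 𝒜) a)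
  rw [AlgHom.commutes] at h
  rw [← h]
  generalize Coalgebra.comul (R := k) a = t
  induction t using TensorProduct.induction_on with
  | zero => simp
  | add x y hx hy => simp only [map_add, hx, hy]
  | tmul x y => simp [antipodeAux]

theorem mul'_map_proj_antipodeAux (a : A) :
    LinearMap.mul' k (Bar 𝒜) (TensorProduct.map (proj 𝒜).toLinearMap (antipodeAux 𝒜)
      (Coalgebra.comul a)) = algebraMap k (Bar 𝒜) (Coalgebra.counit (R := k) a) := by
  have h := congrArg (proj 𝒜) (mul_antipode_lTensor_comul (k := k) (𝒜 := 𝒜) a)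
  rw [AlgHom.commutes] at h
  rw [← h]
  generalize Coalgebra.comul (R := k) a = t
  induction t using TensorProduct.induction_on with
  | zero => simp
  | add x y hx hy => simp only [map_add, hx, hy]
  | tmul x y => simp [antipodeAux]

theorem antipodeAux_mul (a b : A) :
    antipodeAux 𝒜 (a * b) = antipodeAux 𝒜 a * antipodeAux 𝒜 b := by
  let F : WithConv (A ⊗[k] A →ₗ[k] Bar 𝒜) :=
    WithConv.toConv (antipodeAux 𝒜 ∘ₗ LinearMap.mul' k A)
  let M : WithConv (A ⊗[k] A →ₗ[k] Bar 𝒜) :=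
    WithConv.toConv ((proj 𝒜).toLinearMap ∘ₗ LinearMap.mul' k A)
  let G : WithConv (A ⊗[k] A →ₗ[k] Bar 𝒜) :=
    WithConv.toConv (LinearMap.mul' k (Bar 𝒜) ∘ₗ
      TensorProduct.map (antipodeAux 𝒜) (antipodeAux 𝒜))
  have hFM : F * M = 1 := by
    ext x y
    have key : ∀ t s : A ⊗[k] A,
        LinearMap.mul' k (Bar 𝒜) (TensorProduct.map (antipodeAux 𝒜 ∘ₗ LinearMap.mul' k A)
          ((proj 𝒜).toLinearMap ∘ₗ LinearMap.mul' k A)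
          (TensorProduct.tensorTensorTensorComm k A A A A (t ⊗ₜ s))) =
        LinearMap.mul' k (Bar 𝒜) ((antipodeAux 𝒜).rTensor (Bar 𝒜)
          ((proj 𝒜).toLinearMap.lTensor A t * (proj 𝒜).toLinearMap.lTensor A s)) := by
      intro t s
      induction t using TensorProduct.induction_on with
      | zero => simp
      | add x y hx hy => simp only [map_add, add_mul, TensorProduct.add_tmul, hx, hy]
      | tmul p q =>
        induction s using TensorProduct.induction_on with
        | zero => simp
        | add x y hx hy => simp only [map_add, mul_add, TensorProduct.tmul_add, hx, hy]
        | tmul r s => simp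
    have h1 := key (Coalgebra.comul x) (Coalgebra.comul y)
    have h2 : (proj 𝒜).toLinearMap.lTensor A (Coalgebra.comul x) *
        (proj 𝒜).toLinearMap.lTensor A (Coalgebra.comul y) =
        (proj 𝒜).toLinearMap.lTensor A (Coalgebra.comul (x * y)) :=
      (map_mul (coactAlg 𝒜) x y).symm
    have h3 : ∀ t : A ⊗[k] A, (antipodeAux 𝒜).rTensor (Bar 𝒜)
        ((proj 𝒜).toLinearMap.lTensor A t) =
        TensorProduct.map (antipodeAux 𝒜) (proj 𝒜).toLinearMap t := fun t => by
      rw [← LinearMap.comp_apply, LinearMap.rTensor_comp_lTensor]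
    rw [h2, h3, mul'_map_antipodeAux_proj, counit_mul (𝒜 := 𝒜)] at h1
    refine h1.trans ?_
    simp [LinearMap.convOne_def, mul_comm]
  have hMG : M * G = 1 := by
    have hM : M = WithConv.toConv ((Algebra.TensorProduct.lmul' k (S := Bar 𝒜)).toLinearMap ∘ₗ
        TensorProduct.map (proj 𝒜).toLinearMap (proj 𝒜).toLinearMap) := by
      ext x y; simp [M]
    have hG : G = WithConv.toConv ((Algebra.TensorProduct.lmul' k (S := Bar 𝒜)).toLinearMap ∘ₗ
        TensorProduct.map (antipodeAux 𝒜) (antipodeAux 𝒜)) := by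
      ext x y; simp [G]
    have h1 : WithConv.toConv (proj 𝒜).toLinearMap * WithConv.toConv (antipodeAux 𝒜) = 1 := by
      ext x
      exact mul'_map_proj_antipodeAux 𝒜 x
    have h2 := TensorProduct.map_convMul_map (R := k)
      (f := WithConv.toConv (proj 𝒜).toLinearMap) (h := WithConv.toConv (antipodeAux 𝒜))
      (g := WithConv.toConv (proj 𝒜).toLinearMap) (k := WithConv.toConv (antipodeAux 𝒜))
    have h3 := LinearMap.algHom_comp_convMul_distrib (Algebra.TensorProduct.lmul' k (S := Bar 𝒜))
      (WithConv.toConv (TensorProduct.map (proj 𝒜).toLinearMap (proj 𝒜).toLinearMap))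
      (WithConv.toConv (TensorProduct.map (antipodeAux 𝒜) (antipodeAux 𝒜)))
    rw [hM, hG]
    refine (congrArg WithConv.toConv h3).symm.trans ?_
    erw [h2, h1]
    ext x y
    simp [LinearMap.convOne_def, mul_comm]
  have hFG : F = G := left_inv_eq_right_inv hFM hMG
  have := LinearMap.congr_fun (congrArg WithConv.ofConv hFG) (a ⊗ₜ b)
  simpa [F, G] using this

theorem antipodeAux_oddIdeal (a : A) (ha : a ∈ oddIdeal 𝒜) : antipodeAux 𝒜 a = 0 := by
  refine Submodule.span_induction (p := fun x _ => antipodeAux 𝒜 x = 0) ?_ ?_ ?_ ?_ ha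
  · intro x hx
    exact proj_odd 𝒜 (antipode_graded (k := k) 1 x hx)
  · simp
  · intro x y _ _ hx hy
    rw [map_add, hx, hy, add_zero]
  · intro c x _ hx
    rw [smul_eq_mul, antipodeAux_mul, hx, mul_zero]

/-- The antipode induced on `Ā`. -/
def barAntipode : Bar 𝒜 →ₗ[k] Bar 𝒜 :=
  ((oddIdeal 𝒜).restrictScalars k).liftQ (antipodeAux 𝒜) (antipodeAux_oddIdeal 𝒜)

theorem barAntipode_comp : barAntipode 𝒜 ∘ₗ (proj 𝒜).toLinearMap = antipodeAux 𝒜 := rfl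

/-- `Ā = A / (A_1)` is a commutative Hopf algebra, with the structure maps induced from `A`. -/
instance barHopfAlgebra : HopfAlgebra k (Bar 𝒜) where
  antipode := barAntipode 𝒜
  mul_antipode_rTensor_comul := by
    rw [← LinearMap.cancel_right (proj_surjective' 𝒜)]
    ext a
    refine Eq.trans ?_ (mul'_map_antipodeAux_proj 𝒜 a)
    change LinearMap.mul' k (Bar 𝒜) ((barAntipode 𝒜).rTensor (Bar 𝒜) (barComul 𝒜 (proj 𝒜 a))) = _
    rw [barComul_proj, ← LinearMap.comp_apply (LinearMap.rTensor _ _), LinearMap.rTensor_comp_map,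
      barAntipode_comp]
  mul_antipode_lTensor_comul := by
    rw [← LinearMap.cancel_right (proj_surjective' 𝒜)]
    ext a
    refine Eq.trans ?_ (mul'_map_proj_antipodeAux 𝒜 a)
    change LinearMap.mul' k (Bar 𝒜) ((barAntipode 𝒜).lTensor (Bar 𝒜) (barComul 𝒜 (proj 𝒜 a))) = _
    rw [barComul_proj, ← LinearMap.comp_apply (LinearMap.lTensor _ _), LinearMap.lTensor_comp_map,
      barAntipode_comp]

end SuperCommHopfAlgebra

/-! ### Affine groups and super affine groups -/

/-- An affine group `G` over `k`, given by the commutative Hopf algebra `O(G)` which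
represents it. -/
structure AffineGroup (k : Type u) [Field k] where
  /-- The coordinate Hopf algebra `O(G)`. -/
  O : Type v
  [commRing : CommRing O]
  [hopfAlgebra : HopfAlgebra k O]

/-- A super affine group `G` over `k`, given by the super-commutative super Hopf algebra
`O(G) = O(G)_0 ⊕ O(G)_1` which represents it. -/
structure SuperAffineGroup (k : Type u) [Field k] where
  /-- The coordinate super Hopf algebra `O(G)`. -/
  O : Type v
  [ring : Ring O]
  [algebra : Algebra k O]
  [coalgebra : Coalgebra k O]
  /-- The even and the odd component of `O(G)`. -/
  gr : ZMod 2 → Submodule k O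
  [gradedAlgebra : GradedAlgebra gr]
  [superCommHopfAlgebra : SuperCommHopfAlgebra k gr]

attribute [instance] AffineGroup.commRing AffineGroup.hopfAlgebra SuperAffineGroup.ring
  SuperAffineGroup.algebra SuperAffineGroup.coalgebra SuperAffineGroup.gradedAlgebra
  SuperAffineGroup.superCommHopfAlgebra

/-- An affine group is unipotent if `O(G)` is irreducible as a coalgebra, i.e. if the trivial
`G`-module `k` is the only simple `G`-module (a `G`-module being a right `O(G)`-comodule). -/
def AffineGroup.IsUnipotent {k : Type u} [Field k] (G : AffineGroup.{u, v} k) : Prop :=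
  IsIrreducibleCoalgebra k G.O

/-- A super affine group is unipotent if `O(G)` is irreducible as a coalgebra. -/
def SuperAffineGroup.IsUnipotent {k : Type u} [Field k] (G : SuperAffineGroup.{u, v} k) : Prop :=
  IsIrreducibleCoalgebra k G.O

/-- The affine group `G_ev` associated with `G`, represented by `O(G) / (O(G)_1)`. It is the
restriction of the group functor `G` to purely even (i.e. ordinary) commutative algebras. -/
abbrev SuperAffineGroup.ev {k : Type u} [Field k] (G : SuperAffineGroup.{u, v} k) :
    AffineGroup.{u, v} k where
  O := SuperCommHopfAlgebra.Bar G.gr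

/-- For a commutative algebra `R`, regarded as purely even, the super algebra maps `O(G) → R`
are the same as the algebra maps `O(G_ev) → R`: this is `G(R) = G_ev(R)`. -/
def SuperAffineGroup.evPoints {k : Type u} [Field k] (G : SuperAffineGroup.{u, v} k)
    (R : Type*) [CommRing R] [Algebra k R] :
    (G.ev.O →ₐ[k] R) ≃ {f : G.O →ₐ[k] R // ∀ a ∈ G.gr 1, f a = 0} where
  toFun g := ⟨g.comp (SuperCommHopfAlgebra.proj G.gr), fun a ha => by
    exact (congrArg g (SuperCommHopfAlgebra.proj_odd G.gr ha)).trans (map_zero g)⟩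
  invFun f := Ideal.Quotient.liftₐ (SuperCommHopfAlgebra.oddIdeal G.gr) f.1 fun a ha => by
    have h : SuperCommHopfAlgebra.oddIdeal G.gr ≤ RingHom.ker f.1 := Ideal.span_le.mpr f.2
    exact h ha
  left_inv g := by
    refine AlgHom.ext fun x => ?_
    obtain ⟨a, rfl⟩ := SuperCommHopfAlgebra.proj_surjective G.gr x
    rfl
  right_inv f := rfl

end

/-!
Let `A = O(G)` with odd ideal `I = (A_1)`, and let `Ā = A / I` be the coordinate ring of `G_ev`.

A Hopf algebra is irreducible as a coalgebra if and only if the augmentation ideal `{f | f(1) = 0}`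
of its dual algebra acts nilpotently on every finite-dimensional comodule (`IsConilpotent`). This
property passes to quotient coalgebras, which settles the step from `G` to `G_ev`
(`isIrreducibleCoalgebra_bar`).

Conversely, let `G_ev` be unipotent and let `V` be a simple `A`-comodule. It is finite-dimensional,
and it suffices to find a nonzero invariant vector. The antipode being an involutive algebra map,
the matrix coefficients of `V` lie in a finitely generated Hopf subalgebra `B`
(`exists_hopfSubalgebra`), and `B` can be chosen so that `V` is still unipotent over `B̄`
(`isIrreducibleCoalgebra_of_bar`). In place of `A` one can thus work with `B`, whose odd ideal is
nilpotent (`exists_oddIdeal_pow_eq_bot`) and whose odd cotangent space is finite-dimensional.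

In this situation consider the odd tangent vectors at the unit element, that is, the odd derivations
`δ : B → k` at the counit (`IsOddDerivation`). They act on `V`, the group of `B̄` acts on them by
the adjoint action, and the bracket `δ δ' + δ' δ` comes from `B̄`
(`bracket_mem_evenAugmentation`). As in Engel's theorem, there is a nonzero vector `v` which is
invariant under `B̄` and annihilated by all `δ` (`exists_forall_act_eq_zero`): among the spaces of
`B̄`-invariants annihilated by a set of odd tangent vectors take a nonzero one, `U`, of minimal
dimension. If some `δ` did not vanish on `U`, then one could choose it such that `δ U` consists of
`B̄`-invariants; as the brackets with `δ` kill `U`, including `2 δ²`, the space of vectors of `U`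
annihilated by `δ` would contain `δ U ≠ 0` and be smaller than `U`.

Such a vector `v` is invariant under `B`. Its matrix coefficients are constant modulo the odd ideal
`I` of `B`, and are killed by all left-invariant superderivations `D_δ`. But an element of `I` which
is killed by all the `D_δ` lies in every power of `I`
(`mem_oddIdeal_pow_of_invariantField_eq_zero`), so that it vanishes, `I` being nilpotent. To see
this, note that `I / I²` is generated by left coinvariants, so that there are odd elements
`x_1, …, x_m` generating `I` modulo `I²` with superderivations `D_i` dual to them modulo `I`
(`exists_frame`). If `e ∈ Iⁿ` with `n ≥ 1`, then `x_1 ⋯ x_m e ∈ I^(m + n + 1)`, as `x_1 ⋯ x_m`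
annihilates all the `x_i`; applying `D_1, …, D_m` in turn gives `e ∈ I^(n + 1)`
(`mem_oddIdeal_pow_of_superderivation_eq_zero`).
-/

noncomputable section

/-! ### Even and odd parts -/

namespace SuperCommHopfAlgebra

section Grading

variable {k : Type u} [Field k] {A : Type v} [Ring A] [Algebra k A]
  (𝒜 : ZMod 2 → Submodule k A) [GradedAlgebra 𝒜]

/-- The projection of a super algebra onto its even part. -/
def evenPart : A →ₗ[k] A := GradedAlgebra.proj 𝒜 0

/-- The projection of a super algebra onto its odd part. -/
def oddPart : A →ₗ[k] A := GradedAlgebra.proj 𝒜 1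

theorem evenPart_mem (a : A) : evenPart 𝒜 a ∈ 𝒜 0 := (DirectSum.decompose 𝒜 a 0).2

theorem oddPart_mem (a : A) : oddPart 𝒜 a ∈ 𝒜 1 := (DirectSum.decompose 𝒜 a 1).2

variable {𝒜}

theorem evenPart_of_even {a : A} (ha : a ∈ 𝒜 0) : evenPart 𝒜 a = a :=
  DirectSum.decompose_of_mem_same 𝒜 ha

theorem oddPart_of_odd {a : A} (ha : a ∈ 𝒜 1) : oddPart 𝒜 a = a :=
  DirectSum.decompose_of_mem_same 𝒜 ha

theorem oddPart_of_even {a : A} (ha : a ∈ 𝒜 0) : oddPart 𝒜 a = 0 :=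
  DirectSum.decompose_of_mem_ne 𝒜 ha (by decide)

theorem evenPart_of_odd {a : A} (ha : a ∈ 𝒜 1) : evenPart 𝒜 a = 0 :=
  DirectSum.decompose_of_mem_ne 𝒜 ha (by decide)

variable (𝒜)

theorem evenPart_add_oddPart (a : A) : evenPart 𝒜 a + oddPart 𝒜 a = a := by
  obtain ⟨x, hx, y, hy, rfl⟩ := exists_even_add_odd 𝒜 a
  simp [evenPart_of_even hx, oddPart_of_odd hy, evenPart_of_odd hy, oddPart_of_even hx]

theorem even_mul_even {a b : A} (ha : a ∈ 𝒜 0) (hb : b ∈ 𝒜 0) : a * b ∈ 𝒜 0 := by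
  simpa using SetLike.mul_mem_graded ha hb

theorem even_mul_odd {a b : A} (ha : a ∈ 𝒜 0) (hb : b ∈ 𝒜 1) : a * b ∈ 𝒜 1 := by
  simpa using SetLike.mul_mem_graded ha hb

theorem odd_mul_even {a b : A} (ha : a ∈ 𝒜 1) (hb : b ∈ 𝒜 0) : a * b ∈ 𝒜 1 := by
  simpa using SetLike.mul_mem_graded ha hb

theorem odd_mul_odd_mem {a b : A} (ha : a ∈ 𝒜 1) (hb : b ∈ 𝒜 1) : a * b ∈ 𝒜 0 := by
  have h : (1 : ZMod 2) + 1 = 0 := by decide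
  simpa [h] using SetLike.mul_mem_graded ha hb

theorem evenPart_mul (a b : A) : evenPart 𝒜 (a * b) =
    evenPart 𝒜 a * evenPart 𝒜 b + oddPart 𝒜 a * oddPart 𝒜 b := by
  obtain ⟨x, hx, y, hy, rfl⟩ := exists_even_add_odd 𝒜 a
  obtain ⟨z, hz, w, hw, rfl⟩ := exists_even_add_odd 𝒜 b
  simp only [map_add, evenPart_of_even hx, oddPart_of_odd hy, evenPart_of_odd hy,
    oddPart_of_even hx, evenPart_of_even hz, oddPart_of_odd hw, evenPart_of_odd hw,
    oddPart_of_even hz, mul_add, add_mul, evenPart_of_even (even_mul_even 𝒜 hx hz),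
    evenPart_of_even (odd_mul_odd_mem 𝒜 hy hw), evenPart_of_odd (even_mul_odd 𝒜 hx hw),
    evenPart_of_odd (odd_mul_even 𝒜 hy hz)]
  simp

theorem oddPart_mul (a b : A) : oddPart 𝒜 (a * b) =
    evenPart 𝒜 a * oddPart 𝒜 b + oddPart 𝒜 a * evenPart 𝒜 b := by
  obtain ⟨x, hx, y, hy, rfl⟩ := exists_even_add_odd 𝒜 a
  obtain ⟨z, hz, w, hw, rfl⟩ := exists_even_add_odd 𝒜 b
  simp only [map_add, evenPart_of_even hx, oddPart_of_odd hy, evenPart_of_odd hy,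
    oddPart_of_even hx, evenPart_of_even hz, oddPart_of_odd hw, evenPart_of_odd hw,
    oddPart_of_even hz, mul_add, add_mul, oddPart_of_even (even_mul_even 𝒜 hx hz),
    oddPart_of_even (odd_mul_odd_mem 𝒜 hy hw), oddPart_of_odd (even_mul_odd 𝒜 hx hw),
    oddPart_of_odd (odd_mul_even 𝒜 hy hz)]
  simp [add_comm]

theorem one_mem_even : (1 : A) ∈ 𝒜 0 := SetLike.GradedOne.one_mem

/-- The parity automorphism `a ↦ (-1)^{|a|} a`. -/
def parity : A →ₐ[k] A :=
  AlgHom.ofLinearMap (evenPart 𝒜 - oddPart 𝒜)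
    (by simp [evenPart_of_even (one_mem_even 𝒜), oddPart_of_even (one_mem_even 𝒜)])
    (fun a b => by
      simp only [LinearMap.sub_apply, evenPart_mul, oddPart_mul, mul_sub, sub_mul]
      abel)

theorem parity_apply (a : A) : parity 𝒜 a = evenPart 𝒜 a - oddPart 𝒜 a := rfl

variable {𝒜}

theorem parity_of_even {a : A} (ha : a ∈ 𝒜 0) : parity 𝒜 a = a := by
  simp [parity_apply, evenPart_of_even ha, oddPart_of_even ha]

theorem parity_of_odd {a : A} (ha : a ∈ 𝒜 1) : parity 𝒜 a = -a := by
  simp [parity_apply, evenPart_of_odd ha, oddPart_of_odd ha]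

variable (𝒜)

theorem parity_parity (a : A) : parity 𝒜 (parity 𝒜 a) = a := by
  obtain ⟨x, hx, y, hy, rfl⟩ := exists_even_add_odd 𝒜 a
  simp [parity_of_even hx, parity_of_odd hy]

theorem oddPart_parity (a : A) : oddPart 𝒜 (parity 𝒜 a) = -oddPart 𝒜 a := by
  obtain ⟨x, hx, y, hy, rfl⟩ := exists_even_add_odd 𝒜 a
  simp [parity_of_even hx, parity_of_odd hy, oddPart_of_even hx]

/-- Two linear maps agree if they agree on even and on odd elements. -/
theorem ext_parity {M : Type*} [AddCommGroup M] [Module k M] {f g : A →ₗ[k] M}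
    (h0 : ∀ a ∈ 𝒜 0, f a = g a) (h1 : ∀ a ∈ 𝒜 1, f a = g a) : f = g := by
  ext a
  obtain ⟨x, hx, y, hy, rfl⟩ := exists_even_add_odd 𝒜 a
  rw [map_add, map_add, h0 x hx, h1 y hy]

/-- The product of `A ⊗ A`, with its signs expressed by the parity automorphism. -/
theorem of_tmul_mul_of_tmul (a b c d : A) :
    GradedTensorProduct.of k 𝒜 𝒜 (a ⊗ₜ b) * GradedTensorProduct.of k 𝒜 𝒜 (c ⊗ₜ d) =
      GradedTensorProduct.of k 𝒜 𝒜 ((a * evenPart 𝒜 c) ⊗ₜ (b * d) +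
        (a * oddPart 𝒜 c) ⊗ₜ (parity 𝒜 b * d)) := by
  have key : ∀ i j : ZMod 2, ∀ b ∈ 𝒜 i, ∀ c ∈ 𝒜 j,
      GradedTensorProduct.of k 𝒜 𝒜 (a ⊗ₜ b) * GradedTensorProduct.of k 𝒜 𝒜 (c ⊗ₜ d) =
      (-1 : ℤˣ) ^ (i * j) • GradedTensorProduct.of k 𝒜 𝒜 ((a * c) ⊗ₜ (b * d)) :=
    fun i j b hb c hc =>
      GradedTensorProduct.tmul_coe_mul_coe_tmul (R := k) 𝒜 𝒜 a ⟨b, hb⟩ ⟨c, hc⟩ d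
  obtain ⟨x, hx, y, hy, rfl⟩ := exists_even_add_odd 𝒜 b
  obtain ⟨z, hz, w, hw, rfl⟩ := exists_even_add_odd 𝒜 c
  have h00 := key 0 0 x hx z hz
  have h01 := key 0 1 x hx w hw
  have h10 := key 1 0 y hy z hz
  have h11 := key 1 1 y hy w hw
  simp only [mul_zero, uzpow_zero, one_smul, mul_one, uzpow_one, Units.neg_smul]
    at h00 h01 h10 h11
  simp only [TensorProduct.tmul_add, TensorProduct.add_tmul, map_add, mul_add, add_mul, h00, h01,
    h10, h11, parity_of_even hx, parity_of_odd hy, evenPart_of_even hz, oddPart_of_odd hw,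
    evenPart_of_odd hw, oddPart_of_even hz, neg_mul, TensorProduct.tmul_neg, map_neg, mul_zero,
    TensorProduct.zero_tmul, map_zero]
  abel

theorem map_parity_of_mem_superTensorSq_zero {t : A ⊗[k] A} (ht : t ∈ superTensorSq 𝒜 0) :
    TensorProduct.map (parity 𝒜).toLinearMap (parity 𝒜).toLinearMap t = t := by
  have h : superTensorSq 𝒜 0 ≤ LinearMap.ker
      (TensorProduct.map (parity 𝒜).toLinearMap (parity 𝒜).toLinearMap - LinearMap.id) := by
    refine iSup_le fun j => ?_
    rw [LinearMap.range_le_ker_iff]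
    ext ⟨p, hp⟩ ⟨q, hq⟩
    fin_cases j
    · simp [parity_of_even (𝒜 := 𝒜) (a := p) hp, parity_of_even (𝒜 := 𝒜) (a := q) hq]
    · simp [parity_of_odd (𝒜 := 𝒜) (a := p) hp, parity_of_odd (𝒜 := 𝒜) (a := q) hq,
        TensorProduct.neg_tmul, TensorProduct.tmul_neg]
  simpa [sub_eq_zero] using h ht

theorem map_parity_of_mem_superTensorSq_one {t : A ⊗[k] A} (ht : t ∈ superTensorSq 𝒜 1) :
    TensorProduct.map (parity 𝒜).toLinearMap (parity 𝒜).toLinearMap t = -t := by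
  have h : superTensorSq 𝒜 1 ≤ LinearMap.ker
      (TensorProduct.map (parity 𝒜).toLinearMap (parity 𝒜).toLinearMap + LinearMap.id) := by
    refine iSup_le fun j => ?_
    rw [LinearMap.range_le_ker_iff]
    ext ⟨p, hp⟩ ⟨q, hq⟩
    fin_cases j
    · simp [parity_of_even (𝒜 := 𝒜) (a := p) hp, parity_of_odd (𝒜 := 𝒜) (a := q) hq,
        TensorProduct.tmul_neg]
    · simp [parity_of_odd (𝒜 := 𝒜) (a := p) hp, parity_of_even (𝒜 := 𝒜) (a := q) hq,
        TensorProduct.neg_tmul]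
  simpa [add_eq_zero_iff_eq_neg] using h ht

end Grading

section Parity

variable {k : Type u} [Field k] {A : Type v} [Ring A] [Algebra k A] [Coalgebra k A]
  (𝒜 : ZMod 2 → Submodule k A) [GradedAlgebra 𝒜] [SuperCommHopfAlgebra k 𝒜]

theorem comul_parity (a : A) : Coalgebra.comul (R := k) (parity 𝒜 a) =
    TensorProduct.map (parity 𝒜).toLinearMap (parity 𝒜).toLinearMap (Coalgebra.comul a) := by
  refine LinearMap.congr_fun (f := Coalgebra.comul (R := k) ∘ₗ (parity 𝒜).toLinearMap)
    (g := TensorProduct.map (parity 𝒜).toLinearMap (parity 𝒜).toLinearMap ∘ₗ Coalgebra.comul)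
    (ext_parity 𝒜 (fun a ha => ?_) (fun a ha => ?_)) a
  · simp [parity_of_even ha,
      map_parity_of_mem_superTensorSq_zero 𝒜 (comul_graded (k := k) 0 a ha)]
  · simp [parity_of_odd ha,
      map_parity_of_mem_superTensorSq_one 𝒜 (comul_graded (k := k) 1 a ha)]

theorem counit_parity (a : A) : Coalgebra.counit (R := k) (parity 𝒜 a) =
    Coalgebra.counit (R := k) a := by
  obtain ⟨x, hx, y, hy, rfl⟩ := exists_even_add_odd 𝒜 a
  simp [parity_of_even hx, parity_of_odd hy, counit_odd (k := k) (𝒜 := 𝒜) y hy]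

theorem counit_evenPart (a : A) : Coalgebra.counit (R := k) (evenPart 𝒜 a) =
    Coalgebra.counit (R := k) a := by
  conv_rhs => rw [← evenPart_add_oddPart 𝒜 a]
  rw [map_add, counit_odd (k := k) (𝒜 := 𝒜) _ (oddPart_mem 𝒜 a), add_zero]

theorem antipode_evenPart (a : A) : antipode 𝒜 (evenPart 𝒜 a) =
    evenPart 𝒜 (antipode (k := k) 𝒜 a) := by
  obtain ⟨x, hx, y, hy, rfl⟩ := exists_even_add_odd 𝒜 a
  simp [evenPart_of_even hx, evenPart_of_odd hy,
    evenPart_of_even (antipode_graded (k := k) (𝒜 := 𝒜) 0 x hx),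
    evenPart_of_odd (antipode_graded (k := k) (𝒜 := 𝒜) 1 y hy)]

theorem antipode_oddPart (a : A) : antipode 𝒜 (oddPart 𝒜 a) =
    oddPart 𝒜 (antipode (k := k) 𝒜 a) := by
  obtain ⟨x, hx, y, hy, rfl⟩ := exists_even_add_odd 𝒜 a
  simp [oddPart_of_even hx, oddPart_of_odd hy,
    oddPart_of_even (antipode_graded (k := k) (𝒜 := 𝒜) 0 x hx),
    oddPart_of_odd (antipode_graded (k := k) (𝒜 := 𝒜) 1 y hy)]

theorem antipode_parity (a : A) : antipode 𝒜 (parity 𝒜 a) =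
    parity 𝒜 (antipode (k := k) 𝒜 a) := by
  simp only [parity_apply, map_sub, antipode_evenPart, antipode_oddPart]

theorem proj_evenPart (a : A) : proj 𝒜 (evenPart 𝒜 a) = proj 𝒜 a := by
  conv_rhs => rw [← evenPart_add_oddPart 𝒜 a]
  rw [map_add, proj_odd 𝒜 (oddPart_mem 𝒜 a), add_zero]

theorem proj_parity (a : A) : proj 𝒜 (parity 𝒜 a) = proj 𝒜 a := by
  rw [parity_apply, map_sub, proj_odd 𝒜 (oddPart_mem 𝒜 a), sub_zero, proj_evenPart]

end Parity

end SuperCommHopfAlgebra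

/-! ### The antipode -/

namespace SuperCommHopfAlgebra

section Antipode

variable {k : Type u} [Field k] {A : Type v} [Ring A] [Algebra k A] [Coalgebra k A]
  (𝒜 : ZMod 2 → Submodule k A) [GradedAlgebra 𝒜] [SuperCommHopfAlgebra k 𝒜]

theorem odd_mul_parity {y : A} (hy : y ∈ 𝒜 1) (x : A) : y * parity 𝒜 x = x * y := by
  obtain ⟨a, ha, b, hb, rfl⟩ := exists_even_add_odd 𝒜 x
  rw [map_add, parity_of_even ha, parity_of_odd hb, mul_add, mul_neg, add_mul,
    even_mul_comm (k := k) (𝒜 := 𝒜) a ha, odd_mul_odd (k := k) (𝒜 := 𝒜) y hy b hb, neg_neg]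

open WithConv LinearMap in
theorem antipode_convMul_id :
    toConv (antipode (k := k) 𝒜) * toConv (LinearMap.id : A →ₗ[k] A) = 1 := by
  ext a
  simpa using! mul_antipode_rTensor_comul (k := k) (𝒜 := 𝒜) a

open WithConv LinearMap in
theorem id_convMul_antipode :
    toConv (LinearMap.id : A →ₗ[k] A) * toConv (antipode (k := k) 𝒜) = 1 := by
  ext a
  simpa using! mul_antipode_lTensor_comul (k := k) (𝒜 := 𝒜) a

/-- The bilinear map `(a ⊗ a', b) ↦ (-1)^{|a'||b|} S(a b) a'`. -/
def antipodeTwist : A ⊗[k] A →ₗ[k] A →ₗ[k] A :=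
  TensorProduct.lift <| LinearMap.mk₂ k
    (fun a a' => LinearMap.mulRight k a' ∘ₗ antipode 𝒜 ∘ₗ LinearMap.mulLeft k a ∘ₗ evenPart 𝒜 +
      LinearMap.mulRight k (parity 𝒜 a') ∘ₗ antipode 𝒜 ∘ₗ LinearMap.mulLeft k a ∘ₗ oddPart 𝒜)
    (fun a b c => by ext x; simp [add_mul]; abel)
    (fun r a b => by ext x; simp)
    (fun a b c => by ext x; simp [mul_add]; abel)
    (fun r a b => by ext x; simp)

theorem antipodeTwist_tmul (a a' b : A) : antipodeTwist (k := k) 𝒜 (a ⊗ₜ a') b =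
    antipode (k := k) 𝒜 (a * evenPart 𝒜 b) * a' +
      antipode (k := k) 𝒜 (a * oddPart 𝒜 b) * parity 𝒜 a' := by
  simp [antipodeTwist]

/-- The map `b ↦ Σ (-1)^{|a₂||b|} S(a₁ b) a₂` is a left convolution inverse of the identity up to
the factor `ε(a)`, hence equal to `ε(a) S`. -/
theorem antipodeTwist_comul (a b : A) : antipodeTwist 𝒜 (Coalgebra.comul (R := k) a) b =
    Coalgebra.counit (R := k) a • antipode (k := k) 𝒜 b := by
  have key : ∀ t s : A ⊗[k] A, LinearMap.mul' k A
      (TensorProduct.map (antipodeTwist 𝒜 t) LinearMap.id s) =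
      LinearMap.mul' k A ((antipode 𝒜).rTensor A ((GradedTensorProduct.of k 𝒜 𝒜).symm
        (GradedTensorProduct.of k 𝒜 𝒜 t * GradedTensorProduct.of k 𝒜 𝒜 s))) := by
    intro t s
    induction t using TensorProduct.induction_on with
    | zero => simp
    | add x y hx hy =>
      simp only [map_add, add_mul, ← hx, ← hy, TensorProduct.map_add_left, LinearMap.add_apply]
    | tmul a a' =>
      induction s using TensorProduct.induction_on with
      | zero => simp
      | add x y hx hy => simp only [map_add, mul_add, ← hx, ← hy]
      | tmul b b' =>
        rw [of_tmul_mul_of_tmul]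
        simp [antipodeTwist_tmul, add_mul, mul_assoc]
  have h : WithConv.toConv (antipodeTwist 𝒜 (Coalgebra.comul (R := k) a)) *
      WithConv.toConv (LinearMap.id : A →ₗ[k] A) = Coalgebra.counit (R := k) a • 1 := by
    ext b
    refine (key _ _).trans ?_
    rw [← comul_mul, GradedTensorProduct.of_symm_of, mul_antipode_rTensor_comul,
      counit_mul (𝒜 := 𝒜)]
    simp [Algebra.smul_def]
  have h2 := congrArg (· * WithConv.toConv (antipode (k := k) 𝒜)) h
  simp only [mul_assoc, id_convMul_antipode, mul_one, smul_mul_assoc, one_mul] at h2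
  exact LinearMap.congr_fun (congrArg WithConv.ofConv h2) b

/-- The antipode is multiplicative: by `antipodeTwist_comul`, the convolution product of
`a ↦ S(a b)` with the identity (for even `b`) or with the parity automorphism (for odd `b`) is
`a ↦ ε(a) S(b)`, and both of these algebra maps are invertible for the convolution product. -/
theorem antipode_mul (a b : A) : antipode (k := k) 𝒜 (a * b) =
    antipode (k := k) 𝒜 a * antipode (k := k) 𝒜 b := by
  -- `a ↦ ε(a) S(b)`, the common value of the two convolution products below
  let c (b : A) : WithConv (A →ₗ[k] A) := WithConv.toConv
    (LinearMap.toSpanSingleton k A (antipode (k := k) 𝒜 b) ∘ₗ Coalgebra.counit)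
  let X (b : A) : WithConv (A →ₗ[k] A) := WithConv.toConv
    (antipode 𝒜 ∘ₗ LinearMap.mulRight k b)
  have hc (b : A) (g : A →ₗ[k] A) (a : A) :
      (c b * WithConv.toConv g) a = antipode (k := k) 𝒜 b * g a := by
    have h1 : c b = WithConv.toConv (LinearMap.mulLeft k (antipode (k := k) 𝒜 b) ∘ₗ
        (1 : WithConv (A →ₗ[k] A)).ofConv) := by
      ext x; simp [c, Algebra.smul_def, Algebra.commutes]
    have h2 : ∀ t : A ⊗[k] A, LinearMap.mul' k A (TensorProduct.map
        (LinearMap.mulLeft k (antipode (k := k) 𝒜 b) ∘ₗ (1 : WithConv (A →ₗ[k] A)).ofConv) g t) =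
        antipode (k := k) 𝒜 b *
          LinearMap.mul' k A (TensorProduct.map (1 : WithConv (A →ₗ[k] A)).ofConv g t) := by
      intro t
      induction t using TensorProduct.induction_on with
      | zero => simp
      | add x y hx hy => simp only [map_add, hx, hy, mul_add]
      | tmul x y => simp [mul_assoc]
    rw [h1]
    refine (h2 _).trans ?_
    have h3 := LinearMap.congr_fun
      (congrArg WithConv.ofConv (one_mul (WithConv.toConv g : WithConv (A →ₗ[k] A)))) a
    exact congrArg _ h3
  obtain ⟨x, hx, y, hy, rfl⟩ := exists_even_add_odd 𝒜 b
  have heven : X x * WithConv.toConv LinearMap.id = c x := by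
    ext a
    have h := antipodeTwist_comul (k := k) 𝒜 a x
    have h2 : ∀ t : A ⊗[k] A, LinearMap.mul' k A (TensorProduct.map
        (antipode (k := k) 𝒜 ∘ₗ LinearMap.mulRight k x) LinearMap.id t) =
        antipodeTwist 𝒜 t x := by
      intro t
      induction t using TensorProduct.induction_on with
      | zero => simp
      | add x y hx hy => simp only [map_add, hx, hy, LinearMap.add_apply]
      | tmul p q => simp [antipodeTwist_tmul, evenPart_of_even hx, oddPart_of_even hx]
    exact (h2 _).trans h
  have hodd : X y * WithConv.toConv (parity 𝒜).toLinearMap = c y := by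
    ext a
    have h := antipodeTwist_comul (k := k) 𝒜 a y
    have h2 : ∀ t : A ⊗[k] A, LinearMap.mul' k A (TensorProduct.map
        (antipode (k := k) 𝒜 ∘ₗ LinearMap.mulRight k y) (parity 𝒜).toLinearMap t) =
        antipodeTwist 𝒜 t y := by
      intro t
      induction t using TensorProduct.induction_on with
      | zero => simp
      | add x y hx hy => simp only [map_add, hx, hy, LinearMap.add_apply]
      | tmul p q => simp [antipodeTwist_tmul, evenPart_of_odd hy, oddPart_of_odd hy]
    exact (h2 _).trans h
  have hpar : WithConv.toConv (parity 𝒜).toLinearMap *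
      WithConv.toConv ((parity 𝒜).toLinearMap ∘ₗ antipode (k := k) 𝒜) = 1 := by
    have h := LinearMap.algHom_comp_convMul_distrib (parity 𝒜)
      (WithConv.toConv (LinearMap.id : A →ₗ[k] A)) (WithConv.toConv (antipode (k := k) 𝒜))
    rw [id_convMul_antipode] at h
    ext x
    have h' := LinearMap.congr_fun h x
    simp only [LinearMap.comp_id] at h'
    refine h'.symm.trans ?_
    simp
  have h0 := congrArg (· * WithConv.toConv (antipode (k := k) 𝒜)) heven
  simp only [mul_assoc, id_convMul_antipode, mul_one] at h0
  have h1 := congrArg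
    (· * WithConv.toConv ((parity 𝒜).toLinearMap ∘ₗ antipode (k := k) 𝒜)) hodd
  simp only [mul_assoc, hpar, mul_one] at h1
  have e0 : antipode (k := k) 𝒜 (a * x) = antipode (k := k) 𝒜 a * antipode (k := k) 𝒜 x := by
    refine (LinearMap.congr_fun (congrArg WithConv.ofConv h0) a).trans ((hc _ _ _).trans ?_)
    exact even_mul_comm (k := k) (𝒜 := 𝒜) _ (antipode_graded (k := k) (𝒜 := 𝒜) 0 x hx) _
  have e1 : antipode (k := k) 𝒜 (a * y) = antipode (k := k) 𝒜 a * antipode (k := k) 𝒜 y := by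
    refine (LinearMap.congr_fun (congrArg WithConv.ofConv h1) a).trans ((hc _ _ _).trans ?_)
    exact odd_mul_parity (k := k) 𝒜 (antipode_graded (k := k) (𝒜 := 𝒜) 1 y hy) _
  rw [mul_add, map_add, map_add, mul_add, e0, e1]

theorem antipode_one : antipode (k := k) 𝒜 (1 : A) = 1 := by
  have h := mul_antipode_rTensor_comul (k := k) (𝒜 := 𝒜) (1 : A)
  simpa [comul_one (k := k) (𝒜 := 𝒜), counit_one (k := k) (𝒜 := 𝒜)] using h

/-- The antipode of a super-commutative Hopf algebra, as an algebra map. -/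
def antipodeAlg : A →ₐ[k] A :=
  AlgHom.ofLinearMap (antipode 𝒜) (antipode_one 𝒜) (antipode_mul 𝒜)

/-- The antipode is an involution, since `S ∘ S` and the identity are both convolution inverses of
`S`. -/
theorem antipode_antipode (a : A) : antipode (k := k) 𝒜 (antipode (k := k) 𝒜 a) = a := by
  have h := LinearMap.algHom_comp_convMul_distrib (antipodeAlg (k := k) 𝒜)
      (WithConv.toConv (LinearMap.id : A →ₗ[k] A)) (WithConv.toConv (antipode (k := k) 𝒜))
  rw [id_convMul_antipode] at h
  have h2 : WithConv.toConv (antipode (k := k) 𝒜) *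
      WithConv.toConv (antipode (k := k) 𝒜 ∘ₗ antipode (k := k) 𝒜) = 1 := by
    ext x
    have h' := LinearMap.congr_fun h x
    simp only [LinearMap.comp_id] at h'
    refine h'.symm.trans ?_
    simp
  have h3 := left_inv_eq_right_inv (id_convMul_antipode (k := k) 𝒜) h2
  exact (LinearMap.congr_fun (congrArg WithConv.ofConv h3) a).symm

/-- The coproduct, as an algebra map to the super tensor square. -/
def comulAlg : A →ₐ[k] GradedTensorProduct k 𝒜 𝒜 :=
  AlgHom.ofLinearMap ((GradedTensorProduct.of k 𝒜 𝒜).toLinearMap ∘ₗ Coalgebra.comul)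
    (by simp [comul_one (k := k) (𝒜 := 𝒜), ← Algebra.TensorProduct.one_def])
    (fun a b => comul_mul (k := k) (𝒜 := 𝒜) a b)

/-- The linear map `a ⊗ b ↦ (-1)^{|a||b|} S(b) ⊗ S(a)`. -/
def antipodeSwap : A ⊗[k] A →ₗ[k] A ⊗[k] A :=
  TensorProduct.map (evenPart 𝒜 ∘ₗ antipode 𝒜) (antipode 𝒜) ∘ₗ
      (TensorProduct.comm k A A).toLinearMap +
    TensorProduct.map (oddPart 𝒜 ∘ₗ antipode 𝒜) ((parity 𝒜).toLinearMap ∘ₗ antipode 𝒜) ∘ₗ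
      (TensorProduct.comm k A A).toLinearMap

/-- The antipode reverses the coproduct: both sides are convolution inverse to the coproduct,
which is the convolution product of the two inclusions of `A` into the super tensor square. -/
theorem comul_antipode (a : A) : Coalgebra.comul (R := k) (antipode (k := k) 𝒜 a) =
    antipodeSwap 𝒜 (Coalgebra.comul (R := k) a) := by
  let i₁ := GradedTensorProduct.includeLeft (R := k) 𝒜 𝒜
  let i₂ := GradedTensorProduct.includeRight (R := k) 𝒜 𝒜
  let Δ := comulAlg (k := k) 𝒜
  have hinv (f : A →ₐ[k] GradedTensorProduct k 𝒜 𝒜) :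
      WithConv.toConv f.toLinearMap *
        WithConv.toConv (f.toLinearMap ∘ₗ antipode (k := k) 𝒜) = 1 := by
    have h := LinearMap.algHom_comp_convMul_distrib f
      (WithConv.toConv (LinearMap.id : A →ₗ[k] A)) (WithConv.toConv (antipode (k := k) 𝒜))
    rw [id_convMul_antipode] at h
    ext x
    have h' := LinearMap.congr_fun h x
    simp only [LinearMap.comp_id] at h'
    refine h'.symm.trans ?_
    simp
  have hinv' (f : A →ₐ[k] GradedTensorProduct k 𝒜 𝒜) :
      WithConv.toConv (f.toLinearMap ∘ₗ antipode (k := k) 𝒜) *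
        WithConv.toConv f.toLinearMap = 1 := by
    have h := LinearMap.algHom_comp_convMul_distrib f
      (WithConv.toConv (antipode (k := k) 𝒜)) (WithConv.toConv (LinearMap.id : A →ₗ[k] A))
    rw [antipode_convMul_id] at h
    ext x
    have h' := LinearMap.congr_fun h x
    simp only [LinearMap.comp_id] at h'
    refine h'.symm.trans ?_
    simp
  have hΔ : WithConv.toConv Δ.toLinearMap =
      WithConv.toConv i₁.toLinearMap * WithConv.toConv i₂.toLinearMap := by
    have h2 : ∀ t : A ⊗[k] A, GradedTensorProduct.of k 𝒜 𝒜 t =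
        LinearMap.mul' k _ (TensorProduct.map i₁.toLinearMap i₂.toLinearMap t) := by
      intro t
      induction t using TensorProduct.induction_on with
      | zero => simp
      | add x y hx hy => simp only [map_add, ← hx, ← hy]
      | tmul p q =>
        simp only [TensorProduct.map_tmul, LinearMap.mul'_apply]
        exact (GradedTensorProduct.tmul_one_mul_one_tmul (R := k) 𝒜 𝒜 p q).symm
    ext x
    exact h2 _
  have hr : WithConv.toConv Δ.toLinearMap *
      (WithConv.toConv (i₂.toLinearMap ∘ₗ antipode (k := k) 𝒜) *
        WithConv.toConv (i₁.toLinearMap ∘ₗ antipode (k := k) 𝒜)) = 1 := by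
    rw [hΔ, mul_assoc, ← mul_assoc (WithConv.toConv i₂.toLinearMap), hinv, one_mul, hinv]
  have h := LinearMap.congr_fun (congrArg WithConv.ofConv
    (left_inv_eq_right_inv (hinv' Δ) hr)) a
  have h2 : ∀ t : A ⊗[k] A, LinearMap.mul' k _ (TensorProduct.map
        (i₂.toLinearMap ∘ₗ antipode (k := k) 𝒜) (i₁.toLinearMap ∘ₗ antipode (k := k) 𝒜) t) =
      GradedTensorProduct.of k 𝒜 𝒜 (antipodeSwap 𝒜 t) := by
    intro t
    induction t using TensorProduct.induction_on with
    | zero => simp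
    | add x y hx hy => simp only [map_add, hx, hy]
    | tmul p q =>
      simp only [TensorProduct.map_tmul, LinearMap.mul'_apply]
      refine (of_tmul_mul_of_tmul (k := k) 𝒜 1 (antipode (k := k) 𝒜 p)
        (antipode (k := k) 𝒜 q) 1).trans ?_
      simp [antipodeSwap]
  exact (GradedTensorProduct.of k 𝒜 𝒜).injective (h.trans (h2 _))

end Antipode

end SuperCommHopfAlgebra

/-! ### Comodules and the action of the dual algebra -/

section Slice

variable {k : Type*} [Field k] {C : Type*} [AddCommGroup C] [Module k C]
  {V : Type*} [AddCommGroup V] [Module k V]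

/-- The slice `V ⊗ C → V`, `v ⊗ c ↦ f(c) v`, given by a linear form `f` on `C`. -/
def slice (V : Type*) [AddCommGroup V] [Module k V] (f : C →ₗ[k] k) : V ⊗[k] C →ₗ[k] V :=
  (TensorProduct.rid k V).toLinearMap ∘ₗ f.lTensor V

@[simp]
theorem slice_tmul (f : C →ₗ[k] k) (v : V) (c : C) : slice V f (v ⊗ₜ c) = f c • v := by
  simp [slice]

theorem mem_range_rTensor_of_slice_mem {W : Submodule k V} {x : V ⊗[k] C}
    (h : ∀ f : C →ₗ[k] k, slice V f x ∈ W) : x ∈ LinearMap.range (W.subtype.rTensor C) := by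
  classical
  let b := Module.Basis.ofVectorSpace k C
  obtain ⟨y, rfl⟩ := (TensorProduct.equivFinsuppOfBasisRight (M := V) b).symm.surjective x
  have hy (i) : y i ∈ W := by
    have := TensorProduct.equivFinsuppOfBasisRight_apply b
      ((TensorProduct.equivFinsuppOfBasisRight (M := V) b).symm y) i
    rw [LinearEquiv.apply_symm_apply] at this
    rw [this]
    exact h _
  rw [TensorProduct.equivFinsuppOfBasisRight_symm_apply]
  exact Submodule.sum_mem _ fun i _ => ⟨⟨y i, hy i⟩ ⊗ₜ b i, by simp⟩

theorem slice_mem_of_mem_range_rTensor {W : Submodule k V} {x : V ⊗[k] C}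
    (h : x ∈ LinearMap.range (W.subtype.rTensor C)) (f : C →ₗ[k] k) : slice V f x ∈ W := by
  obtain ⟨y, rfl⟩ := h
  induction y using TensorProduct.induction_on with
  | zero => simp
  | add x y hx hy => simpa using W.add_mem hx hy
  | tmul w c => simpa using W.smul_mem _ w.2

theorem eq_of_slice_eq {x y : V ⊗[k] C} (h : ∀ f : C →ₗ[k] k, slice V f x = slice V f y) :
    x = y := by
  have h' : x - y ∈ LinearMap.range ((⊥ : Submodule k V).subtype.rTensor C) :=
    mem_range_rTensor_of_slice_mem fun f => by simp [h f]
  obtain ⟨z, hz⟩ := h'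
  have : (⊥ : Submodule k V).subtype = 0 := by ext ⟨v, hv⟩; simpa using hv
  rw [this, LinearMap.rTensor_zero, LinearMap.zero_apply] at hz
  exact sub_eq_zero.mp hz.symm

theorem map_slice {W : Type*} [AddCommGroup W] [Module k W] (g : V →ₗ[k] W) (f : C →ₗ[k] k)
    (x : V ⊗[k] C) : g (slice V f x) = slice W f (g.rTensor C x) := by
  induction x using TensorProduct.induction_on with
  | zero => simp
  | add x y hx hy => simp only [map_add, hx, hy]
  | tmul w c => simp

theorem slice_lTensor {D : Type*} [AddCommGroup D] [Module k D] (f : D →ₗ[k] k) (g : C →ₗ[k] D)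
    (x : V ⊗[k] C) : slice V f (g.lTensor V x) = slice V (f ∘ₗ g) x := by
  induction x using TensorProduct.induction_on with
  | zero => simp
  | add x y hx hy => simp only [map_add, hx, hy]
  | tmul w c => simp

theorem rTensor_assoc {W : Type*} [AddCommGroup W] [Module k W] (g : W →ₗ[k] V)
    (x : (W ⊗[k] C) ⊗[k] C) : g.rTensor (C ⊗[k] C) (TensorProduct.assoc k W C C x) =
      TensorProduct.assoc k V C C ((g.rTensor C).rTensor C x) := by
  refine LinearMap.congr_fun (f := g.rTensor (C ⊗[k] C) ∘ₗ
    (TensorProduct.assoc k W C C).toLinearMap) (g := (TensorProduct.assoc k V C C).toLinearMap ∘ₗ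
      (g.rTensor C).rTensor C) ?_ x
  ext
  simp

theorem rTensor_lTensor_comm {W D D' : Type*} [AddCommGroup W] [Module k W] [AddCommGroup D]
    [Module k D] [AddCommGroup D'] [Module k D'] (g : W →ₗ[k] V) (f : D →ₗ[k] D')
    (x : W ⊗[k] D) : g.rTensor D' (f.lTensor W x) = f.lTensor V (g.rTensor D x) := by
  rw [← LinearMap.comp_apply, ← LinearMap.comp_apply, LinearMap.rTensor_comp_lTensor,
    LinearMap.lTensor_comp_rTensor]

end Slice

namespace RightComodule

section Action

variable {k : Type*} [Field k] {C : Type*} [AddCommGroup C] [Module k C] [Coalgebra k C]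
  {V : Type*} [AddCommGroup V] [Module k V] (ρ : RightComodule k C V)

/-- The left action of the convolution algebra `C^*` on a right `C`-comodule. -/
def act : WithConv (C →ₗ[k] k) →ₐ[k] Module.End k V :=
  AlgHom.ofLinearMap
    { toFun := fun f => slice V f.ofConv ∘ₗ ρ.coact
      map_add' := fun f g => by
        ext v
        simp [slice, LinearMap.lTensor_add]
      map_smul' := fun r f => by
        ext v
        simp [slice, LinearMap.lTensor_smul] }
    (by
      ext v
      refine Eq.trans ?_ (ρ.counit v)
      simp only [LinearMap.coe_mk, AddHom.coe_mk, slice, LinearMap.comp_apply]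
      congr 2)
    (fun f g => by
      ext v
      have h1 : ∀ (w : V) (c : C) (s : V ⊗[k] C),
          slice V (LinearMap.mul' k k ∘ₗ TensorProduct.map f.ofConv g.ofConv)
            (TensorProduct.assoc k V C C (s ⊗ₜ c)) = g.ofConv c • slice V f.ofConv s := by
        intro w c s
        induction s using TensorProduct.induction_on with
        | zero => simp
        | add x y hx hy => simp only [TensorProduct.add_tmul, map_add, smul_add, hx, hy]
        | tmul x d => simp [smul_smul, mul_comm]
      have h2 : ∀ t : V ⊗[k] C,
          slice V (LinearMap.mul' k k ∘ₗ TensorProduct.map f.ofConv g.ofConv)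
            (TensorProduct.assoc k V C C (ρ.coact.rTensor C t)) =
          slice V f.ofConv (ρ.coact (slice V g.ofConv t)) := by
        intro t
        induction t using TensorProduct.induction_on with
        | zero => simp
        | add x y hx hy => simp only [map_add, hx, hy]
        | tmul x d => simp [h1 x]
      refine Eq.trans ?_ (h2 (ρ.coact v))
      rw [ρ.coassoc, slice_lTensor]
      rfl)

theorem act_apply (f : WithConv (C →ₗ[k] k)) (v : V) :
    ρ.act f v = slice V f.ofConv (ρ.coact v) := rfl

theorem isSubcomodule_iff {W : Submodule k V} :
    ρ.IsSubcomodule W ↔ ∀ f, ∀ w ∈ W, ρ.act f w ∈ W :=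
  ⟨fun h _ w hw => slice_mem_of_mem_range_rTensor (h w hw) _,
    fun h w hw => mem_range_rTensor_of_slice_mem fun f => h (WithConv.toConv f) w hw⟩

/-- The subspace `C^* v`, the smallest subcomodule containing `v`. -/
def cyclic (v : V) : Submodule k V := LinearMap.range (ρ.act.toLinearMap.flip v)

theorem mem_cyclic_self (v : V) : v ∈ ρ.cyclic v := ⟨1, by simp⟩

theorem isSubcomodule_cyclic (v : V) : ρ.IsSubcomodule (ρ.cyclic v) := by
  rw [isSubcomodule_iff]
  rintro f _ ⟨g, rfl⟩
  exact ⟨f * g, by simp⟩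

instance finiteDimensional_cyclic (v : V) : FiniteDimensional k (ρ.cyclic v) := by
  classical
  obtain ⟨S, hS⟩ := TensorProduct.exists_finset (ρ.coact v)
  have : ρ.cyclic v ≤ Submodule.span k (S.image Prod.fst : Finset V) := by
    rintro _ ⟨g, rfl⟩
    change slice V g.ofConv (ρ.coact v) ∈ _
    rw [hS, map_sum]
    refine Submodule.sum_mem _ fun i hi => ?_
    rw [slice_tmul]
    exact Submodule.smul_mem _ _ (Submodule.subset_span (by
      simpa using ⟨i.2, hi⟩))
  exact Submodule.finiteDimensional_of_le this

theorem finiteDimensional_of_isSimple (h : ρ.IsSimple) : FiniteDimensional k V := by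
  obtain ⟨hV, h⟩ := h
  obtain ⟨v, hv⟩ := exists_ne (0 : V)
  rcases h _ (ρ.isSubcomodule_cyclic v) with h | h
  · exact absurd ((Submodule.eq_bot_iff _).mp h v (ρ.mem_cyclic_self v)) hv
  · have := ρ.finiteDimensional_cyclic v
    rw [h] at this
    exact Module.finite_def.mpr (Module.Finite.iff_fg.mp this)

/-- The coaction on a subcomodule. -/
def restrictCoact {W : Submodule k V} (hW : ρ.IsSubcomodule W) : W →ₗ[k] W ⊗[k] C :=
  (LinearEquiv.ofInjective (W.subtype.rTensor C)
      (Module.Flat.rTensor_preserves_injective_linearMap _ W.injective_subtype)).symm.toLinearMap ∘ₗ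
    (ρ.coact ∘ₗ W.subtype).codRestrict _ (fun w => hW w w.2)

theorem rTensor_restrictCoact {W : Submodule k V} (hW : ρ.IsSubcomodule W) (w : W) :
    W.subtype.rTensor C (ρ.restrictCoact hW w) = ρ.coact w :=
  congrArg Subtype.val ((LinearEquiv.ofInjective (W.subtype.rTensor C)
      (Module.Flat.rTensor_preserves_injective_linearMap _ W.injective_subtype)).apply_symm_apply
    ((ρ.coact ∘ₗ W.subtype).codRestrict _ (fun w => hW w w.2) w))

/-- The comodule structure on a subcomodule. -/
def restrict {W : Submodule k V} (hW : ρ.IsSubcomodule W) : RightComodule k C W where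
  coact := ρ.restrictCoact hW
  coassoc x := by
    refine Module.Flat.rTensor_preserves_injective_linearMap (M := C ⊗[k] C) _
      W.injective_subtype ?_
    have h : W.subtype.rTensor C ∘ₗ ρ.restrictCoact hW = ρ.coact ∘ₗ W.subtype :=
      LinearMap.ext (ρ.rTensor_restrictCoact hW)
    rw [rTensor_assoc, ← LinearMap.rTensor_comp_apply, h, LinearMap.rTensor_comp_apply,
      rTensor_restrictCoact, ρ.coassoc, rTensor_lTensor_comm, rTensor_restrictCoact]
  counit x := by
    refine W.injective_subtype ?_
    refine Eq.trans ?_ (ρ.counit x)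
    rw [← ρ.rTensor_restrictCoact hW]
    exact map_slice W.subtype Coalgebra.counit (ρ.restrictCoact hW x) |>.trans rfl

theorem restrict_act {W : Submodule k V} (hW : ρ.IsSubcomodule W) (f : WithConv (C →ₗ[k] k))
    (w : W) : ((ρ.restrict hW).act f w : V) = ρ.act f w := by
  rw [act_apply, act_apply, ← ρ.rTensor_restrictCoact hW]
  exact map_slice W.subtype _ _

/-- The coaction on the quotient by a subcomodule. -/
def quotientCoact {W : Submodule k V} (hW : ρ.IsSubcomodule W) : V ⧸ W →ₗ[k] (V ⧸ W) ⊗[k] C :=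
  W.liftQ (W.mkQ.rTensor C ∘ₗ ρ.coact) fun w hw => by
    obtain ⟨y, hy⟩ := hW w hw
    rw [LinearMap.mem_ker, LinearMap.comp_apply, ← hy, ← LinearMap.rTensor_comp_apply]
    have : W.mkQ ∘ₗ W.subtype = 0 := by ext; simp
    rw [this, LinearMap.rTensor_zero, LinearMap.zero_apply]

/-- The comodule structure on the quotient by a subcomodule. -/
def quotient {W : Submodule k V} (hW : ρ.IsSubcomodule W) : RightComodule k C (V ⧸ W) where
  coact := ρ.quotientCoact hW
  coassoc x := by
    obtain ⟨v, rfl⟩ := W.mkQ_surjective x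
    have h : ρ.quotientCoact hW ∘ₗ W.mkQ = W.mkQ.rTensor C ∘ₗ ρ.coact := rfl
    have h' : ρ.quotientCoact hW (W.mkQ v) = W.mkQ.rTensor C (ρ.coact v) := rfl
    rw [h', ← LinearMap.rTensor_comp_apply, h, LinearMap.rTensor_comp_apply, ← rTensor_assoc,
      ρ.coassoc, rTensor_lTensor_comm]
  counit x := by
    obtain ⟨v, rfl⟩ := W.mkQ_surjective x
    refine Eq.trans ?_ (congrArg W.mkQ (ρ.counit v))
    exact (map_slice W.mkQ Coalgebra.counit (ρ.coact v)).symm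

theorem quotient_act {W : Submodule k V} (hW : ρ.IsSubcomodule W) (f : WithConv (C →ₗ[k] k))
    (v : V) : (ρ.quotient hW).act f (W.mkQ v) = W.mkQ (ρ.act f v) := by
  rw [act_apply, act_apply]
  exact (map_slice W.mkQ _ _).symm

/-- A nonzero subcomodule of minimal dimension is simple. -/
theorem exists_isSimple_restrict [FiniteDimensional k V] [Nontrivial V] :
    ∃ (W : Submodule k V) (hW : ρ.IsSubcomodule W), (ρ.restrict hW).IsSimple := by
  have hne : {W : Submodule k V | ρ.IsSubcomodule W ∧ W ≠ ⊥}.Nonempty :=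
    ⟨⊤, by simp [isSubcomodule_iff], top_ne_bot⟩
  obtain ⟨W, ⟨hW, hW0⟩, hmin⟩ := wellFounded_lt.has_min _ hne
  refine ⟨W, hW, Submodule.nontrivial_iff_ne_bot.mpr hW0, fun U hU => ?_⟩
  by_cases hU0 : U = ⊥
  · exact Or.inl hU0
  right
  have h1 : ρ.IsSubcomodule (U.map W.subtype) := by
    rw [isSubcomodule_iff] at hU ⊢
    rintro f _ ⟨u, hu, rfl⟩
    exact ⟨_, hU f u hu, ρ.restrict_act hW f u⟩
  have h2 : U.map W.subtype ≠ ⊥ := fun h =>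
    hU0 (Submodule.map_injective_of_injective W.injective_subtype (by rw [h, Submodule.map_bot]))
  have h3 := hmin _ ⟨h1, h2⟩
  have h4 : U.map W.subtype ≤ W := Submodule.map_subtype_le W U
  have h5 : U.map W.subtype = W := eq_of_le_of_not_lt h4 h3
  rw [eq_top_iff]
  intro w _
  obtain ⟨u, hu, huw⟩ := h5.ge w.2
  rwa [← Subtype.ext (a1 := u) (a2 := w) huw]

end Action

section Unit

variable {k : Type*} [Field k] {C : Type*} [Ring C] [Algebra k C] [Coalgebra k C]
  {V : Type*} [AddCommGroup V] [Module k V] (ρ : RightComodule k C V)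

theorem coact_eq_tmul_one {v : V}
    (h1 : Coalgebra.counit (R := k) (1 : C) = 1)
    (h : ∀ f : WithConv (C →ₗ[k] k), f.ofConv 1 = 0 → ρ.act f v = 0) :
    ρ.coact v = v ⊗ₜ 1 := by
  refine eq_of_slice_eq fun f => ?_
  have h2 := h (WithConv.toConv f - f 1 • 1) (by
    simp [LinearMap.convOne_def, h1])
  rw [map_sub, map_smul, map_one ρ.act, LinearMap.sub_apply, sub_eq_zero, act_apply] at h2
  rw [slice_tmul]
  exact h2

theorem isTrivial_of_isSimple (h : ρ.IsSimple) {v : V} (hv : v ≠ 0)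
    (hρ : ρ.coact v = v ⊗ₜ 1) : ρ.IsTrivial := by
  have hsub : ρ.IsSubcomodule (Submodule.span k {v}) := by
    rw [isSubcomodule_iff]
    intro f w hw
    obtain ⟨c, rfl⟩ := Submodule.mem_span_singleton.mp hw
    rw [map_smul, act_apply, hρ, slice_tmul]
    exact Submodule.smul_mem _ _ (Submodule.smul_mem _ _ (Submodule.mem_span_singleton_self v))
  have htop : Submodule.span k {v} = ⊤ :=
    (h.2 _ hsub).resolve_left (by simpa using hv)
  let e : k ≃ₗ[k] V := (LinearEquiv.toSpanNonzeroSingleton k V v hv).trans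
    ((LinearEquiv.ofEq _ _ htop).trans Submodule.topEquiv)
  have he (c : k) : e c = c • v := rfl
  refine ⟨e.symm, fun x => ?_⟩
  obtain ⟨c, rfl⟩ := e.surjective x
  rw [he, map_smul, hρ, map_smul, LinearMap.rTensor_tmul, LinearEquiv.coe_coe, map_smul,
    TensorProduct.smul_tmul']

theorem act_eq_of_isTrivial (h : ρ.IsTrivial) (f : WithConv (C →ₗ[k] k)) (v : V) :
    ρ.act f v = f.ofConv 1 • v := by
  obtain ⟨e, he⟩ := h
  apply e.injective
  have := map_slice e.toLinearMap f.ofConv (ρ.coact v)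
  rw [he v, slice_tmul] at this
  rw [act_apply, map_smul]
  exact this

end Unit

end RightComodule

/-- If a monoid `R` acts on a pointed set so that all products of `m` elements of `K ⊆ R` send
`x` to the base point `z`, then some iterated image of `x` under `K` is different from `z`, but is
sent to `z` by all of `K`. -/
theorem exists_ne_forall_eq_of_list_prod {R M : Type*} [Monoid R] (s : R → M → M)
    (h1 : ∀ x, s 1 x = x) (hmul : ∀ a b x, s (a * b) x = s a (s b x)) (K : Set R) (X : Set M)
    (hX : ∀ f ∈ K, ∀ x ∈ X, s f x ∈ X) (z : M) (m : ℕ) {x : M} (hx : x ∈ X) (hxz : x ≠ z)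
    (hm : ∀ l : List R, m ≤ l.length → (∀ f ∈ l, f ∈ K) → s l.prod x = z) :
    ∃ y ∈ X, y ≠ z ∧ ∀ f ∈ K, s f y = z := by
  induction m generalizing x with
  | zero => exact absurd ((h1 x).symm.trans (hm [] le_rfl (by simp))) hxz
  | succ m ih =>
    by_cases h : ∀ f ∈ K, s f x = z
    · exact ⟨x, hx, hxz, h⟩
    · push Not at h
      obtain ⟨f, hf, hfx⟩ := h
      refine ih (hX f hf x hx) hfx fun l hl hlK => ?_
      rw [← hmul]
      have := hm (l ++ [f]) (by simpa using hl) (by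
        intro g hg
        rcases List.mem_append.mp hg with hg | hg
        · exact hlK g hg
        · rwa [List.mem_singleton.mp hg])
      simpa using this

/-! ### Nilpotency of the augmentation ideal of the dual algebra -/

/-- The dual algebra `C^*` acts nilpotently through its augmentation ideal `{f | f 1 = 0}`:
every element of `C` is annihilated by all sufficiently long products of functionals vanishing
at `1`. -/
def IsConilpotent (k : Type*) [Field k] (C : Type*) [Ring C] [Algebra k C] [Coalgebra k C] :
    Prop :=
  ∀ c : C, ∃ m : ℕ, ∀ l : List (WithConv (C →ₗ[k] k)), m ≤ l.length →
    (∀ f ∈ l, f.ofConv 1 = 0) → l.prod.ofConv c = 0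

namespace IsConilpotent

variable {k : Type u} [Field k] {C : Type v} [Ring C] [Algebra k C] [Coalgebra k C]

theorem exists_act_prod_eq_zero (hC : IsConilpotent k C) {V : Type*} [AddCommGroup V] [Module k V]
    [FiniteDimensional k V] (ρ : RightComodule k C V) :
    ∃ m : ℕ, ∀ l : List (WithConv (C →ₗ[k] k)), m ≤ l.length →
      (∀ f ∈ l, f.ofConv 1 = 0) → ρ.act l.prod = 0 := by
  have h1 : ∀ x : V ⊗[k] C, ∃ m : ℕ, ∀ l : List (WithConv (C →ₗ[k] k)), m ≤ l.length →
      (∀ f ∈ l, f.ofConv 1 = 0) → slice V l.prod.ofConv x = 0 := by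
    intro x
    induction x using TensorProduct.induction_on with
    | zero => exact ⟨0, by simp⟩
    | add x y hx hy =>
      obtain ⟨m, hm⟩ := hx
      obtain ⟨n, hn⟩ := hy
      refine ⟨max m n, fun l hl hf => ?_⟩
      rw [map_add, hm l (le_of_max_le_left hl) hf, hn l (le_of_max_le_right hl) hf, add_zero]
    | tmul x c =>
      obtain ⟨m, hm⟩ := hC c
      exact ⟨m, fun l hl hf => by rw [slice_tmul, hm l hl hf, zero_smul]⟩
  let b := Module.finBasis k V
  choose m hm using fun i => h1 (ρ.coact (b i))
  refine ⟨Finset.univ.sup m, fun l hl hf => b.ext fun i => ?_⟩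
  exact hm i l ((Finset.le_sup (Finset.mem_univ i)).trans hl) hf

theorem isIrreducibleCoalgebra (hC : IsConilpotent k C)
    (h1 : Coalgebra.counit (R := k) (1 : C) = 1) : IsIrreducibleCoalgebra k C := by
  intro V _ _ ρ hρ
  have := ρ.finiteDimensional_of_isSimple hρ
  have := hρ.1
  obtain ⟨m, hm⟩ := hC.exists_act_prod_eq_zero ρ
  obtain ⟨v, hv⟩ := exists_ne (0 : V)
  obtain ⟨w, -, hw, hK⟩ := exists_ne_forall_eq_of_list_prod (fun f v => ρ.act f v) (by simp)
    (by simp) {f | f.ofConv 1 = 0} Set.univ (by simp) 0 m (Set.mem_univ v) hv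
    fun l hl hf => LinearMap.congr_fun (hm l hl hf) v
  exact ρ.isTrivial_of_isSimple hρ hw (ρ.coact_eq_tmul_one h1 hK)

end IsConilpotent

section Irreducible

variable {k : Type u} [Field k] {C : Type v} [Ring C] [Algebra k C] [Coalgebra k C]

theorem IsIrreducibleCoalgebra.exists_act_prod_eq_zero (hC : IsIrreducibleCoalgebra k C) (n : ℕ) :
    ∀ (V : Type v) [AddCommGroup V] [Module k V] [FiniteDimensional k V]
      (ρ : RightComodule k C V), Module.finrank k V = n →
      ∃ m : ℕ, ∀ l : List (WithConv (C →ₗ[k] k)), m ≤ l.length →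
        (∀ f ∈ l, f.ofConv 1 = 0) → ρ.act l.prod = 0 := by
  induction n using Nat.strong_induction_on with
  | _ n ih =>
    intro V _ _ _ ρ hn
    rcases subsingleton_or_nontrivial V with hV | hV
    · exact ⟨0, fun l _ _ => LinearMap.ext fun v => Subsingleton.elim _ _⟩
    obtain ⟨W, hW, hs⟩ := ρ.exists_isSimple_restrict
    have hW0 : W ≠ ⊥ := Submodule.nontrivial_iff_ne_bot.mp hs.1
    have hlt : Module.finrank k (V ⧸ W) < n := by
      have h1 := W.finrank_quotient_add_finrank
      have h2 : 0 < Module.finrank k W := Submodule.one_le_finrank_iff.mpr hW0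
      omega
    obtain ⟨m, hm⟩ := ih _ hlt _ (ρ.quotient hW) rfl
    refine ⟨m + 1, fun l hl hf => ?_⟩
    obtain _ | ⟨f, l⟩ := l
    · simp at hl
    ext v
    have h1 : ρ.act l.prod v ∈ W := by
      have h := LinearMap.congr_fun (hm l (by simpa using hl)
        fun g hg => hf g (List.mem_cons_of_mem _ hg)) (W.mkQ v)
      rw [RightComodule.quotient_act] at h
      simpa using h
    have h2 := (ρ.restrict hW).act_eq_of_isTrivial (hC W _ hs) f ⟨_, h1⟩
    rw [hf f List.mem_cons_self, zero_smul] at h2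
    rw [List.prod_cons, map_mul, Module.End.mul_apply]
    exact (ρ.restrict_act hW f ⟨_, h1⟩).symm.trans (congrArg Subtype.val h2)

/-- A coalgebra, as a right comodule over itself. -/
def RightComodule.regular (k : Type*) [Field k] (C : Type*) [AddCommGroup C] [Module k C]
    [Coalgebra k C] : RightComodule k C C where
  coact := Coalgebra.comul
  coassoc x := Coalgebra.coassoc_apply x
  counit x := by simp

theorem IsIrreducibleCoalgebra.isConilpotent (hC : IsIrreducibleCoalgebra k C) :
    IsConilpotent k C := by
  intro c
  let ρ := RightComodule.regular k C
  obtain ⟨m, hm⟩ := hC.exists_act_prod_eq_zero _ _ (ρ.restrict (ρ.isSubcomodule_cyclic c)) rfl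
  refine ⟨m, fun l hl hf => ?_⟩
  have h := congrArg Subtype.val (LinearMap.congr_fun (hm l hl hf) ⟨c, ρ.mem_cyclic_self c⟩)
  rw [RightComodule.restrict_act] at h
  have h2 := congrArg (Coalgebra.counit (R := k)) h
  rw [RightComodule.act_apply, map_slice] at h2
  have h3 : (Coalgebra.counit (R := k)).rTensor C (ρ.coact c) = 1 ⊗ₜ c :=
    Coalgebra.rTensor_counit_comul c
  simpa [h3] using h2

/-- Conilpotency passes to quotient coalgebras. -/
theorem IsConilpotent.of_surjective {D : Type*} [Ring D] [Algebra k D] [Coalgebra k D]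
    (hC : IsConilpotent k C) (φ : C →ₗc[k] D) (hφ : Function.Surjective φ) (h1 : φ 1 = 1) :
    IsConilpotent k D := by
  intro d
  obtain ⟨c, rfl⟩ := hφ d
  obtain ⟨m, hm⟩ := hC c
  refine ⟨m, fun l hl hf => ?_⟩
  let pull (f : WithConv (D →ₗ[k] k)) : WithConv (C →ₗ[k] k) :=
    WithConv.toConv (f.ofConv ∘ₗ φ.toLinearMap)
  have hpull (l : List (WithConv (D →ₗ[k] k))) : (l.map pull).prod = pull l.prod := by
    induction l with
    | nil => ext x; simp [pull]
    | cons f l ih =>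
      rw [List.map_cons, List.prod_cons, ih, List.prod_cons]
      exact congrArg WithConv.toConv (LinearMap.convMul_comp_coalgHom_distrib f l.prod φ).symm
  have h := hm (l.map pull) (by simpa using hl) (by
    intro f hf'
    obtain ⟨g, hg, rfl⟩ := List.mem_map.mp hf'
    simpa [pull, h1] using hf g hg)
  rw [hpull] at h
  exact h

end Irreducible

/-! ### Powers of the odd ideal -/

namespace SuperCommHopfAlgebra

section OddIdealPowers

variable {k : Type u} [Field k] {A : Type v} [Ring A] [Algebra k A] [Coalgebra k A]
  (𝒜 : ZMod 2 → Submodule k A) [GradedAlgebra 𝒜] [SuperCommHopfAlgebra k 𝒜]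

theorem mul_mem_oddIdeal_pow {m n : ℕ} {a b : A} (ha : a ∈ oddIdeal 𝒜 ^ m)
    (hb : b ∈ oddIdeal 𝒜 ^ n) : a * b ∈ oddIdeal 𝒜 ^ (m + n) := by
  rw [Ideal.IsTwoSided.pow_add]
  exact Ideal.mul_mem_mul ha hb

omit [Coalgebra k A] [GradedAlgebra 𝒜] [SuperCommHopfAlgebra k 𝒜] in
theorem odd_mem_oddIdeal {a : A} (ha : a ∈ 𝒜 1) : a ∈ oddIdeal 𝒜 := Ideal.subset_span ha

theorem parity_mem_oddIdeal_pow {n : ℕ} {a : A} (ha : a ∈ oddIdeal 𝒜 ^ n) :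
    parity 𝒜 a ∈ oddIdeal 𝒜 ^ n := by
  induction n generalizing a with
  | zero => simp [Submodule.pow_zero]
  | succ n ih =>
    rw [Ideal.IsTwoSided.pow_succ] at ha ⊢
    refine Submodule.mul_induction_on ha (fun x hx y hy => ?_) (fun x y hx hy => ?_)
    · rw [map_mul]
      refine Ideal.mul_mem_mul ?_ (ih hy)
      have : parity 𝒜 x - x ∈ oddIdeal 𝒜 := by
        rw [← Ideal.Quotient.mk_eq_mk_iff_sub_mem]
        exact proj_parity 𝒜 x
      simpa using (oddIdeal 𝒜).add_mem this hx
    · rw [map_add]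
      exact Ideal.add_mem _ hx hy

/-- An odd superderivation of `A` (acting from the right, so that the sign is carried by the
second factor). -/
def IsOddSuperderivation (D : A →ₗ[k] A) : Prop :=
  ∀ a b : A, D (a * b) = D a * parity 𝒜 b + a * D b

variable {𝒜}

theorem IsOddSuperderivation.mem_oddIdeal_pow {D : A →ₗ[k] A} (hD : IsOddSuperderivation 𝒜 D)
    {n : ℕ} {a : A} (ha : a ∈ oddIdeal 𝒜 ^ (n + 1)) : D a ∈ oddIdeal 𝒜 ^ n := by
  induction n generalizing a with
  | zero => simp [Submodule.pow_zero]
  | succ n ih =>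
    rw [Ideal.IsTwoSided.pow_succ] at ha
    refine Submodule.mul_induction_on ha (fun x hx y hy => ?_) (fun x y hx hy => ?_)
    · rw [hD]
      refine Ideal.add_mem _ (Ideal.mul_mem_left _ _ (parity_mem_oddIdeal_pow 𝒜 hy)) ?_
      rw [Ideal.IsTwoSided.pow_succ]
      exact Ideal.mul_mem_mul hx (ih hy)
    · rw [map_add]
      exact Ideal.add_mem _ hx hy

variable {ι : Type*} {x : ι → A} {D : ι → A →ₗ[k] A}

theorem list_prod_mem_oddIdeal_pow (hx : ∀ i, x i ∈ 𝒜 1) (l : List ι) :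
    (l.map x).prod ∈ oddIdeal 𝒜 ^ l.length := by
  induction l with
  | nil => simp [Submodule.pow_zero]
  | cons i l ih =>
    rw [List.map_cons, List.prod_cons, List.length_cons, Ideal.IsTwoSided.pow_succ]
    exact Ideal.mul_mem_mul (odd_mem_oddIdeal 𝒜 (hx i)) ih

theorem superderivation_list_prod_mul_mem (hD : ∀ i, IsOddSuperderivation 𝒜 (D i))
    (hx : ∀ i, x i ∈ 𝒜 1) {i : ι} {n : ℕ} {e : A} (he : e ∈ oddIdeal 𝒜 ^ n) (hDe : D i e = 0)
    (hDx : ∀ j, i ≠ j → D i (x j) ∈ oddIdeal 𝒜) (l : List ι) (hl : i ∉ l) :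
    D i ((l.map x).prod * e) ∈ oddIdeal 𝒜 ^ (l.length + n) := by
  induction l with
  | nil => simp [hDe]
  | cons j l ih =>
    rw [List.mem_cons, not_or] at hl
    rw [List.map_cons, List.prod_cons, mul_assoc, hD, List.length_cons, add_right_comm,
      Ideal.IsTwoSided.pow_succ]
    exact Ideal.add_mem _ (Ideal.mul_mem_mul (hDx j hl.1) (parity_mem_oddIdeal_pow 𝒜
      (mul_mem_oddIdeal_pow 𝒜 (list_prod_mem_oddIdeal_pow hx l) he)))
      (Ideal.mul_mem_mul (odd_mem_oddIdeal 𝒜 (hx j)) (ih hl.2))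

/-- The factors of a product `x₁ ⋯ x_m e` can be removed one at a time, by applying the
superderivation `D_i` with `D_i x_i ≡ 1`. -/
theorem mem_of_list_prod_mul_mem (hD : ∀ i, IsOddSuperderivation 𝒜 (D i))
    (hx : ∀ i, x i ∈ 𝒜 1) {n : ℕ} {e : A} (he : e ∈ oddIdeal 𝒜 ^ n) (hDe : ∀ i, D i e = 0)
    (hDx : ∀ i j, i ≠ j → D i (x j) ∈ oddIdeal 𝒜) (hDx1 : ∀ i, D i (x i) - 1 ∈ oddIdeal 𝒜)
    (l : List ι) (hl : l.Nodup)
    (h : (l.map x).prod * e ∈ oddIdeal 𝒜 ^ (l.length + n + 1)) : e ∈ oddIdeal 𝒜 ^ (n + 1) := by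
  induction l with
  | nil => simpa using h
  | cons i l ih =>
    rw [List.nodup_cons] at hl
    apply ih hl.2
    set y := (l.map x).prod * e with hy
    have hyI : y ∈ oddIdeal 𝒜 ^ (l.length + n) :=
      mul_mem_oddIdeal_pow 𝒜 (list_prod_mem_oddIdeal_pow hx l) he
    have h1 : x i * y ∈ oddIdeal 𝒜 ^ (l.length + n + 1 + 1) := by
      have e2 : l.length + n + 1 + 1 = (i :: l).length + n + 1 := by
        rw [List.length_cons]; omega
      rw [e2, hy, ← mul_assoc]
      simpa using h
    have h2 := (hD i).mem_oddIdeal_pow h1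
    rw [hD i] at h2
    have h3 : x i * D i y ∈ oddIdeal 𝒜 ^ (l.length + n + 1) := by
      rw [Ideal.IsTwoSided.pow_succ]
      exact Ideal.mul_mem_mul (odd_mem_oddIdeal 𝒜 (hx i))
        (superderivation_list_prod_mul_mem hD hx he (hDe i) (hDx i) l hl.1)
    have h4 : (D i (x i) - 1) * parity 𝒜 y ∈ oddIdeal 𝒜 ^ (l.length + n + 1) := by
      rw [Ideal.IsTwoSided.pow_succ]
      exact Ideal.mul_mem_mul (hDx1 i) (parity_mem_oddIdeal_pow 𝒜 hyI)
    have h5 : parity 𝒜 y ∈ oddIdeal 𝒜 ^ (l.length + n + 1) := by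
      have := Ideal.sub_mem _ (Ideal.sub_mem _ h2 h3) h4
      rwa [add_sub_cancel_right, sub_mul, one_mul, sub_sub_cancel] at this
    rw [← parity_parity 𝒜 y]
    exact parity_mem_oddIdeal_pow 𝒜 h5

theorem odd_mul_self (h2 : (2 : k) ≠ 0) {y : A} (hy : y ∈ 𝒜 1) : y * y = 0 := by
  have h := odd_mul_odd (k := k) (𝒜 := 𝒜) y hy y hy
  have h' : (2 : k) • (y * y) = 0 := by
    rw [two_smul]
    nth_rewrite 1 [h]
    exact neg_add_cancel _
  exact (smul_eq_zero.mp h').resolve_left h2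

theorem list_prod_mul_mul_eq_zero (h2 : (2 : k) ≠ 0) (hx : ∀ i, x i ∈ 𝒜 1) {j : ι} (l : List ι)
    (hj : j ∈ l) (a : A) : (l.map x).prod * (a * x j) = 0 := by
  induction l generalizing a with
  | nil => simp at hj
  | cons i l ih =>
    rw [List.map_cons, List.prod_cons]
    by_cases hij : j = i
    · subst hij
      rw [mul_assoc, ← mul_assoc (List.map x l).prod, ← odd_mul_parity (k := k) 𝒜 (hx j),
        ← mul_assoc, odd_mul_self h2 (hx j), zero_mul]
    · rw [mul_assoc, ih (List.mem_of_ne_of_mem hij hj), mul_zero]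

/-- Suppose that odd elements `x_i` generate the ideal `I = (A_1)` modulo `I²` and that odd
superderivations `D_i` are dual to them modulo `I`. Then an element of `I` killed by all the
`D_i` lies in all powers of `I`. -/
theorem mem_oddIdeal_pow_of_superderivation_eq_zero [Fintype ι] [DecidableEq ι]
    (h2 : (2 : k) ≠ 0) (hD : ∀ i, IsOddSuperderivation 𝒜 (D i)) (hx : ∀ i, x i ∈ 𝒜 1)
    (hDx : ∀ i j, D i (x j) - (if i = j then 1 else 0) ∈ oddIdeal 𝒜)
    (hgen : oddIdeal 𝒜 ≤ Ideal.span (Set.range x) ⊔ oddIdeal 𝒜 ^ 2)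
    {e : A} (he : e ∈ oddIdeal 𝒜) (hDe : ∀ i, D i e = 0) (n : ℕ) : e ∈ oddIdeal 𝒜 ^ (n + 1) := by
  induction n with
  | zero => simpa [Submodule.pow_one] using he
  | succ n ih =>
    refine mem_of_list_prod_mul_mem hD hx ih hDe (fun i j hij => by simpa [hij] using hDx i j)
      (fun i => by simpa using hDx i i) Finset.univ.toList (Finset.nodup_toList _) ?_
    set l : List ι := Finset.univ.toList
    -- the product of all `x_i` annihilates the ideal generated by the `x_i`, so that it multiplies
    -- `I` into a power of `I` that is higher by one than expected
    have hspan : ∀ s ∈ Ideal.span (Set.range x), ∀ a, (l.map x).prod * (a * s) = 0 := by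
      intro s hs
      induction hs using Submodule.span_induction with
      | mem s hs =>
        obtain ⟨j, rfl⟩ := hs
        exact list_prod_mul_mul_eq_zero h2 hx (j := j) l (by simp [l])
      | zero => simp
      | add s t _ _ hs ht => intro a; rw [mul_add, mul_add, hs, ht, add_zero]
      | smul b s _ hs => intro a; rw [smul_eq_mul, ← mul_assoc a, hs]
    have hI : ∀ s ∈ oddIdeal 𝒜, (l.map x).prod * s ∈ oddIdeal 𝒜 ^ (l.length + 2) := by
      intro s hs
      obtain ⟨r, hr, t, ht, rfl⟩ := Submodule.mem_sup.mp (hgen hs)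
      rw [mul_add, ← one_mul r, hspan r hr, zero_add]
      exact mul_mem_oddIdeal_pow 𝒜 (list_prod_mem_oddIdeal_pow hx l) ht
    rw [Ideal.IsTwoSided.pow_succ] at ih
    refine Submodule.mul_induction_on ih (fun s hs t ht => ?_) (fun s t hs ht => ?_)
    · rw [← mul_assoc]
      have h := mul_mem_oddIdeal_pow 𝒜 (hI s hs) ht
      have e2 : l.length + 2 + n = l.length + (n + 1) + 1 := by omega
      rwa [e2] at h
    · rw [mul_add]
      exact Ideal.add_mem _ hs ht

end OddIdealPowers

end SuperCommHopfAlgebra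

/-! ### Odd tangent vectors and invariant superderivations -/

namespace SuperCommHopfAlgebra

section Derivation

variable {k : Type u} [Field k] {A : Type v} [Ring A] [Algebra k A] [Coalgebra k A]
  (𝒜 : ZMod 2 → Submodule k A) [GradedAlgebra 𝒜] [SuperCommHopfAlgebra k 𝒜]
  {M : Type*} [AddCommGroup M] [Module k M]

/-- An odd derivation of `A` at the counit, with values in a vector space. For `M = k` these are
the odd tangent vectors at the unit element of the super affine group of `A`. -/
structure IsOddDerivation (δ : A →ₗ[k] M) : Prop where
  map_parity : ∀ a, δ (parity 𝒜 a) = -δ a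
  leibniz : ∀ a b, δ (a * b) =
    Coalgebra.counit (R := k) b • δ a + Coalgebra.counit (R := k) a • δ b

variable {𝒜}

omit [SuperCommHopfAlgebra k 𝒜] in
theorem IsOddDerivation.comp {N : Type*} [AddCommGroup N] [Module k N] {δ : A →ₗ[k] M}
    (h : IsOddDerivation 𝒜 δ) (g : M →ₗ[k] N) : IsOddDerivation 𝒜 (g ∘ₗ δ) where
  map_parity a := by simp [h.map_parity]
  leibniz a b := by simp [h.leibniz]

omit [SuperCommHopfAlgebra k 𝒜] in
theorem IsOddDerivation.map_even {δ : A →ₗ[k] M} (h : IsOddDerivation 𝒜 δ) (h2 : (2 : k) ≠ 0)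
    {a : A} (ha : a ∈ 𝒜 0) : δ a = 0 := by
  have h1 := h.map_parity a
  rw [parity_of_even ha, eq_neg_iff_add_eq_zero, ← two_smul k] at h1
  exact (smul_eq_zero.mp h1).resolve_left h2

omit [SuperCommHopfAlgebra k 𝒜] in
theorem IsOddDerivation.map_oddPart {δ : A →ₗ[k] M} (h : IsOddDerivation 𝒜 δ) (h2 : (2 : k) ≠ 0)
    (a : A) : δ (oddPart 𝒜 a) = δ a := by
  conv_rhs => rw [← evenPart_add_oddPart 𝒜 a]
  rw [map_add, h.map_even h2 (evenPart_mem 𝒜 a), zero_add]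

theorem IsOddDerivation.map_one {δ : A →ₗ[k] M} (hδ : IsOddDerivation 𝒜 δ) : δ 1 = 0 := by
  have h := hδ.leibniz 1 1
  rw [mul_one, counit_one (k := k) (𝒜 := 𝒜), one_smul] at h
  exact left_eq_add.mp h

/-- A left inverse for the convolution product can be cancelled. -/
theorem convMul_cancel_left {R : Type*} [Ring R] [Algebra k R] {f g : WithConv (A →ₗ[k] R)}
    (h : WithConv (A →ₗ[k] R)) (hfg : f * g = 1) : f * (g * h) = h := by
  rw [← mul_assoc, hfg, one_mul]

variable (𝒜)

/-- The coproduct of a product, applied to a bilinear expression. -/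
theorem apply_comul_mul {N : Type*} [AddCommGroup N] [Module k N] (g : A ⊗[k] A →ₗ[k] N)
    (a b : A) (F : A ⊗[k] A →ₗ[k] A ⊗[k] A →ₗ[k] N)
    (hF : ∀ a a' b b' : A, g ((a * evenPart 𝒜 b) ⊗ₜ (a' * b') +
      (a * oddPart 𝒜 b) ⊗ₜ (parity 𝒜 a' * b')) = F (a ⊗ₜ a') (b ⊗ₜ b')) :
    g (Coalgebra.comul (R := k) (a * b)) =
      F (Coalgebra.comul (R := k) a) (Coalgebra.comul (R := k) b) := by
  have key : ∀ t s : A ⊗[k] A, g ((GradedTensorProduct.of k 𝒜 𝒜).symm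
      (GradedTensorProduct.of k 𝒜 𝒜 t * GradedTensorProduct.of k 𝒜 𝒜 s)) = F t s := by
    intro t s
    induction t using TensorProduct.induction_on with
    | zero => simp
    | add x y hx hy => simp only [map_add, add_mul, hx, hy, LinearMap.add_apply]
    | tmul a a' =>
      induction s using TensorProduct.induction_on with
      | zero => simp
      | add x y hx hy => simp only [map_add, mul_add, hx, hy]
      | tmul b b' => rw [of_tmul_mul_of_tmul, GradedTensorProduct.of_symm_of, hF]
  rw [← key, ← comul_mul, GradedTensorProduct.of_symm_of]

/-- The left-invariant vector field `a ↦ Σ a₁ δ(a₂)` of a linear form `δ`. -/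
def invariantField (δ : A →ₗ[k] k) : A →ₗ[k] A := slice A δ ∘ₗ Coalgebra.comul

theorem slice_counit_comul (a : A) :
    slice A (Coalgebra.counit (R := k)) (Coalgebra.comul (R := k) a) = a := by
  simp [slice]

theorem IsOddDerivation.isOddSuperderivation {δ : A →ₗ[k] k} (h : IsOddDerivation 𝒜 δ) :
    IsOddSuperderivation 𝒜 (invariantField δ) := by
  intro a b
  let ε : A →ₗ[k] k := Coalgebra.counit
  refine (apply_comul_mul 𝒜 (slice A δ) a b
    ((LinearMap.mul k A).compl₁₂ (slice A δ) ((parity 𝒜).toLinearMap ∘ₗ slice A ε) +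
      (LinearMap.mul k A).compl₁₂ (slice A ε) (slice A δ)) (fun a a' b b' => ?_)).trans ?_
  · change _ = slice A δ (a ⊗ₜ a') * SuperCommHopfAlgebra.parity 𝒜 (slice A ε (b ⊗ₜ b')) +
      slice A ε (a ⊗ₜ a') * slice A δ (b ⊗ₜ b')
    simp only [map_add, slice_tmul, h.leibniz, h.map_parity, counit_parity, map_smul, ε]
    obtain ⟨x, hx, y, hy, rfl⟩ := exists_even_add_odd 𝒜 b
    simp only [map_add, evenPart_of_even hx, evenPart_of_odd hy, oddPart_of_even hx,
      oddPart_of_odd hy, parity_of_even hx, parity_of_odd hy, add_zero, zero_add, smul_eq_mul,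
      mul_add, smul_mul_assoc, mul_smul_comm, smul_add, smul_smul, add_smul, smul_neg, mul_neg,
      neg_smul, mul_comm (δ b')]
    abel
  · change slice A δ _ * SuperCommHopfAlgebra.parity 𝒜 (slice A ε _) +
      slice A ε _ * slice A δ _ = _
    rw [slice_counit_comul, slice_counit_comul]
    rfl

/-- The map `(π ⊗ id) ∘ Δ : A → Ā ⊗ A`, as an algebra map (for the usual product on `Ā ⊗ A`). -/
def leftCoact : A →ₐ[k] Bar 𝒜 ⊗[k] A :=
  AlgHom.ofLinearMap ((proj 𝒜).toLinearMap.rTensor A ∘ₗ Coalgebra.comul)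
    (by simp [comul_one (k := k) (𝒜 := 𝒜), Algebra.TensorProduct.one_def])
    (fun a b => by
      refine (apply_comul_mul 𝒜 ((proj 𝒜).toLinearMap.rTensor A) a b
        ((LinearMap.mul k (Bar 𝒜 ⊗[k] A)).compl₁₂ ((proj 𝒜).toLinearMap.rTensor A)
          ((proj 𝒜).toLinearMap.rTensor A)) (fun a a' b b' => ?_)).trans rfl
      simp only [map_add, LinearMap.rTensor_tmul, AlgHom.toLinearMap_apply, map_mul,
        proj_evenPart, proj_odd 𝒜 (oddPart_mem 𝒜 b), mul_zero, TensorProduct.zero_tmul, add_zero,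
        LinearMap.compl₁₂_apply, LinearMap.mul_apply', Algebra.TensorProduct.tmul_mul_tmul])

/-- The antipode of `Ā` as an algebra map. -/
def barAntipodeAlg : Bar 𝒜 →ₐ[k] Bar 𝒜 := HopfAlgebra.antipodeAlgHom k (Bar 𝒜)

theorem barAntipodeAlg_proj (a : A) : barAntipodeAlg 𝒜 (proj 𝒜 a) = antipodeAux 𝒜 a := rfl

/-- The algebra map `A → Ā ⊗ A`, `a ↦ Σ S(π(a₁)) ⊗ a₂`. -/
def antipodeCoact : A →ₐ[k] Bar 𝒜 ⊗[k] A :=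
  (Algebra.TensorProduct.map (barAntipodeAlg 𝒜) (AlgHom.id k A)).comp (leftCoact 𝒜)

/-- `a ↦ π(a) ⊗ 1`. -/
def inclProj : A →ₗ[k] Bar 𝒜 ⊗[k] A :=
  (Algebra.TensorProduct.includeLeft (S := k) (B := A)).toLinearMap ∘ₗ (proj 𝒜).toLinearMap

/-- `a ↦ S(π(a)) ⊗ 1`. -/
def inclAntipode : A →ₗ[k] Bar 𝒜 ⊗[k] A :=
  (Algebra.TensorProduct.includeLeft (S := k) (B := A)).toLinearMap ∘ₗ antipodeAux 𝒜

/-- `a ↦ 1 ⊗ a`. -/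
def inclRight : A →ₗ[k] Bar 𝒜 ⊗[k] A :=
  (Algebra.TensorProduct.includeRight (A := Bar 𝒜)).toLinearMap

open WithConv in
theorem toConv_leftCoact : toConv (leftCoact 𝒜).toLinearMap =
    toConv (inclProj 𝒜) * toConv (inclRight 𝒜) := by
  have h : ∀ t : A ⊗[k] A, (proj 𝒜).toLinearMap.rTensor A t =
      LinearMap.mul' k _ (TensorProduct.map (inclProj 𝒜) (inclRight 𝒜) t) := by
    intro t
    induction t using TensorProduct.induction_on with
    | zero => simp
    | add x y hx hy => simp only [map_add, hx, hy]
    | tmul p q => simp [inclProj, inclRight]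
  ext a
  exact h _

open WithConv in
theorem toConv_antipodeCoact : toConv (antipodeCoact 𝒜).toLinearMap =
    toConv (inclAntipode 𝒜) * toConv (inclRight 𝒜) := by
  have h : ∀ t : A ⊗[k] A, Algebra.TensorProduct.map (barAntipodeAlg 𝒜) (AlgHom.id k A)
      ((proj 𝒜).toLinearMap.rTensor A t) =
      LinearMap.mul' k _ (TensorProduct.map (inclAntipode 𝒜) (inclRight 𝒜) t) := by
    intro t
    induction t using TensorProduct.induction_on with
    | zero => simp
    | add x y hx hy => simp only [map_add, hx, hy]
    | tmul p q =>
      simp only [LinearMap.rTensor_tmul, AlgHom.toLinearMap_apply,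
        Algebra.TensorProduct.map_tmul, barAntipodeAlg_proj]
      simp [inclAntipode, inclRight]
  ext a
  exact h _

open WithConv in
theorem inclAntipode_mul_inclProj :
    toConv (inclAntipode (k := k) 𝒜) * toConv (inclProj 𝒜) = 1 := by
  have h := LinearMap.algHom_comp_convMul_distrib
    (Algebra.TensorProduct.includeLeft (R := k) (S := k) (A := Bar 𝒜) (B := A))
    (toConv (antipodeAux (k := k) 𝒜)) (toConv (proj 𝒜).toLinearMap)
  ext a
  refine (LinearMap.congr_fun h a).symm.trans ?_
  refine (congrArg (Algebra.TensorProduct.includeLeft (R := k) (S := k) (A := Bar 𝒜) (B := A))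
    (mul'_map_antipodeAux_proj 𝒜 a)).trans ?_
  simp

open WithConv in
theorem inclProj_mul_inclAntipode :
    toConv (inclProj (k := k) 𝒜) * toConv (inclAntipode 𝒜) = 1 := by
  have h := LinearMap.algHom_comp_convMul_distrib
    (Algebra.TensorProduct.includeLeft (R := k) (S := k) (A := Bar 𝒜) (B := A))
    (toConv (proj 𝒜).toLinearMap) (toConv (antipodeAux (k := k) 𝒜))
  ext a
  refine (LinearMap.congr_fun h a).symm.trans ?_
  refine (congrArg (Algebra.TensorProduct.includeLeft (R := k) (S := k) (A := Bar 𝒜) (B := A))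
    (mul'_map_proj_antipodeAux 𝒜 a)).trans ?_
  simp

/-- `Σ (S(π(a₁)) ⊗ 1) · λ(a₂) = 1 ⊗ a` for the left coaction `λ`. -/
theorem mul'_map_inclAntipode_leftCoact (a : A) : LinearMap.mul' k (Bar 𝒜 ⊗[k] A)
    (TensorProduct.map (inclAntipode 𝒜) (leftCoact 𝒜).toLinearMap (Coalgebra.comul a)) =
      1 ⊗ₜ a := by
  have h : WithConv.toConv (inclAntipode 𝒜) * WithConv.toConv (leftCoact 𝒜).toLinearMap =
      WithConv.toConv (inclRight 𝒜) := by
    rw [toConv_leftCoact]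
    exact convMul_cancel_left _ (inclAntipode_mul_inclProj 𝒜)
  exact LinearMap.congr_fun (congrArg WithConv.ofConv h) a

theorem mul'_map_inclProj_antipodeCoact (a : A) : LinearMap.mul' k (Bar 𝒜 ⊗[k] A)
    (TensorProduct.map (inclProj 𝒜) (antipodeCoact 𝒜).toLinearMap (Coalgebra.comul a)) =
      1 ⊗ₜ a := by
  have h : WithConv.toConv (inclProj 𝒜) * WithConv.toConv (antipodeCoact 𝒜).toLinearMap =
      WithConv.toConv (inclRight 𝒜) := by
    rw [toConv_antipodeCoact]
    exact convMul_cancel_left _ (inclProj_mul_inclAntipode 𝒜)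
  exact LinearMap.congr_fun (congrArg WithConv.ofConv h) a

end Derivation

end SuperCommHopfAlgebra

/-! ### The odd cotangent space and dual frames -/

namespace SuperCommHopfAlgebra

section Frame

variable {k : Type u} [Field k] {A : Type v} [Ring A] [Algebra k A] [Coalgebra k A]
  (𝒜 : ZMod 2 → Submodule k A) [GradedAlgebra 𝒜] [SuperCommHopfAlgebra k 𝒜]

/-- The projection `A → A / I²` for the odd ideal `I`. -/
abbrev sqProj : A →ₐ[k] A ⧸ oddIdeal 𝒜 ^ 2 := Ideal.Quotient.mkₐ k (oddIdeal 𝒜 ^ 2)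

theorem sqProj_eq_zero_iff {a : A} : sqProj (k := k) 𝒜 a = 0 ↔ a ∈ oddIdeal 𝒜 ^ 2 :=
  Ideal.Quotient.eq_zero_iff_mem

/-- The linear map `Ā ⊗ A → A / I²`, `π(a) ⊗ b ↦ a b₁`, where `b₁` is the odd part of `b`. -/
def oddClass : Bar 𝒜 ⊗[k] A →ₗ[k] A ⧸ oddIdeal 𝒜 ^ 2 :=
  TensorProduct.lift (((oddIdeal 𝒜).restrictScalars k).liftQ
    (((LinearMap.mul k A).compr₂ (sqProj 𝒜).toLinearMap).compl₂ (oddPart 𝒜)) (by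
      intro a ha
      rw [LinearMap.mem_ker]
      ext b
      refine (sqProj_eq_zero_iff 𝒜).mpr ?_
      have h := mul_mem_oddIdeal_pow (k := k) 𝒜 (m := 1) (n := 1) (a := a) (b := oddPart 𝒜 b)
        (by rwa [Submodule.pow_one])
        (by rw [Submodule.pow_one]; exact odd_mem_oddIdeal 𝒜 (oddPart_mem 𝒜 b))
      exact h))

theorem oddClass_tmul (a b : A) :
    oddClass 𝒜 (proj 𝒜 a ⊗ₜ b) = sqProj (k := k) 𝒜 (a * oddPart 𝒜 b) := rfl

theorem sqProj_mul_oddClass (a : A) (w : Bar 𝒜 ⊗[k] A) :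
    sqProj 𝒜 a * oddClass 𝒜 w = oddClass 𝒜 ((proj 𝒜 a ⊗ₜ 1) * w) := by
  induction w using TensorProduct.induction_on with
  | zero => simp
  | add x y hx hy => simp only [mul_add, map_add, hx, hy]
  | tmul c d =>
    obtain ⟨c, rfl⟩ := proj_surjective 𝒜 c
    rw [Algebra.TensorProduct.tmul_mul_tmul, ← map_mul, one_mul, oddClass_tmul, oddClass_tmul,
      ← map_mul, mul_assoc]

theorem oddClass_lTensor_parity (w : Bar 𝒜 ⊗[k] A) :
    oddClass 𝒜 ((parity 𝒜).toLinearMap.lTensor (Bar 𝒜) w) = -oddClass 𝒜 w := by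
  induction w using TensorProduct.induction_on with
  | zero => simp
  | add x y hx hy => simp only [map_add, hx, hy, neg_add]
  | tmul c d =>
    obtain ⟨c, rfl⟩ := proj_surjective 𝒜 c
    rw [LinearMap.lTensor_tmul, AlgHom.toLinearMap_apply, oddClass_tmul, oddClass_tmul,
      oddPart_parity, mul_neg, map_neg]

/-- The algebra map `Ā ⊗ A → Ā`, `a ⊗ b ↦ a π(b)`. -/
def barMul : Bar 𝒜 ⊗[k] A →ₐ[k] Bar 𝒜 :=
  Algebra.TensorProduct.lift (AlgHom.id k _) (proj 𝒜) (fun _ _ => Commute.all _ _)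

theorem barMul_tmul (a : Bar 𝒜) (b : A) : barMul 𝒜 (a ⊗ₜ[k] b) = a * proj 𝒜 b := by
  simp [barMul]

/-- `oddClass` is a derivation over `barMul`. -/
theorem oddClass_mul (u w : Bar 𝒜 ⊗[k] A) : oddClass 𝒜 (u * w) =
    oddClass 𝒜 ((barMul 𝒜 w ⊗ₜ 1) * u) + oddClass 𝒜 ((barMul 𝒜 u ⊗ₜ 1) * w) := by
  induction u using TensorProduct.induction_on with
  | zero => simp
  | add x y hx hy =>
    simp only [add_mul, mul_add, map_add, hx, hy, TensorProduct.add_tmul]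
    abel
  | tmul a b =>
    induction w using TensorProduct.induction_on with
    | zero => simp
    | add x y hx hy =>
      simp only [add_mul, mul_add, map_add, hx, hy, TensorProduct.add_tmul]
      abel
    | tmul c d =>
      obtain ⟨a, rfl⟩ := proj_surjective 𝒜 a
      obtain ⟨c, rfl⟩ := proj_surjective 𝒜 c
      have h1 : proj 𝒜 c * proj 𝒜 d * proj 𝒜 a = proj 𝒜 (a * c * evenPart 𝒜 d) := by
        rw [map_mul, map_mul, proj_evenPart]; ring
      have h2 : proj 𝒜 a * proj 𝒜 b * proj 𝒜 c = proj 𝒜 (a * c * evenPart 𝒜 b) := by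
        rw [map_mul, map_mul, proj_evenPart]; ring
      simp only [barMul_tmul, Algebra.TensorProduct.tmul_mul_tmul, one_mul]
      rw [h1, h2, ← map_mul, oddClass_tmul, oddClass_tmul, oddClass_tmul, oddPart_mul,
        mul_add, map_add, add_comm, ← even_mul_comm (k := k) (𝒜 := 𝒜) _ (evenPart_mem 𝒜 d)]
      simp only [mul_assoc]

theorem barMul_antipodeCoact (a : A) :
    barMul 𝒜 (antipodeCoact 𝒜 a) = algebraMap k _ (Coalgebra.counit (R := k) a) := by
  rw [← mul'_map_antipodeAux_proj]
  have h : ∀ t : A ⊗[k] A, barMul 𝒜 (Algebra.TensorProduct.map (barAntipodeAlg 𝒜)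
      (AlgHom.id k A) ((proj 𝒜).toLinearMap.rTensor A t)) =
      LinearMap.mul' k (Bar 𝒜) (TensorProduct.map (antipodeAux 𝒜) (proj 𝒜).toLinearMap t) := by
    intro t
    induction t using TensorProduct.induction_on with
    | zero => simp
    | add x y hx hy => simp only [map_add, hx, hy]
    | tmul p q =>
      simp only [LinearMap.rTensor_tmul, AlgHom.toLinearMap_apply,
        Algebra.TensorProduct.map_tmul, barAntipodeAlg_proj, barMul_tmul, AlgHom.coe_id, id,
        TensorProduct.map_tmul, LinearMap.mul'_apply]
  exact h _

theorem leftCoact_parity (a : A) : leftCoact 𝒜 (parity 𝒜 a) =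
    (parity (k := k) 𝒜).toLinearMap.lTensor (Bar 𝒜) (leftCoact 𝒜 a) := by
  change (proj 𝒜).toLinearMap.rTensor A (Coalgebra.comul (parity 𝒜 a)) =
    (parity 𝒜).toLinearMap.lTensor (Bar 𝒜) ((proj 𝒜).toLinearMap.rTensor A (Coalgebra.comul a))
  rw [comul_parity]
  generalize Coalgebra.comul (R := k) a = t
  induction t using TensorProduct.induction_on with
  | zero => simp
  | add x y hx hy => simp only [map_add, hx, hy]
  | tmul p q =>
    simp only [TensorProduct.map_tmul, LinearMap.rTensor_tmul, LinearMap.lTensor_tmul,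
      AlgHom.toLinearMap_apply, proj_parity]

theorem antipodeCoact_parity (a : A) : antipodeCoact 𝒜 (parity 𝒜 a) =
    (parity (k := k) 𝒜).toLinearMap.lTensor (Bar 𝒜) (antipodeCoact 𝒜 a) := by
  change Algebra.TensorProduct.map (barAntipodeAlg 𝒜) (AlgHom.id k A)
    (leftCoact 𝒜 (parity 𝒜 a)) = (parity (k := k) 𝒜).toLinearMap.lTensor (Bar 𝒜)
      (Algebra.TensorProduct.map (barAntipodeAlg 𝒜) (AlgHom.id k A) (leftCoact 𝒜 a))
  rw [leftCoact_parity]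
  generalize leftCoact (k := k) 𝒜 a = t
  induction t using TensorProduct.induction_on with
  | zero => simp
  | add x y hx hy => simp only [map_add, hx, hy]
  | tmul p q => simp

/-- The map `a ↦ Σ S(a₁) (a₂)_odd` from `A` to `I / I²`. Its values are the left coinvariants, which
make up the odd cotangent space at the unit element. -/
def cotangentProj : A →ₗ[k] A ⧸ oddIdeal 𝒜 ^ 2 := oddClass 𝒜 ∘ₗ (antipodeCoact 𝒜).toLinearMap

theorem isOddDerivation_cotangentProj : IsOddDerivation 𝒜 (cotangentProj (k := k) 𝒜) where
  map_parity a := by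
    change oddClass 𝒜 (antipodeCoact 𝒜 (parity 𝒜 a)) = -oddClass 𝒜 (antipodeCoact 𝒜 a)
    rw [antipodeCoact_parity, oddClass_lTensor_parity]
  leibniz a b := by
    change oddClass 𝒜 (antipodeCoact 𝒜 (a * b)) = _ • oddClass 𝒜 (antipodeCoact 𝒜 a) +
      _ • oddClass 𝒜 (antipodeCoact 𝒜 b)
    have h (c : k) (w : Bar 𝒜 ⊗[k] A) :
        oddClass 𝒜 ((algebraMap k (Bar 𝒜) c ⊗ₜ 1) * w) = c • oddClass 𝒜 w := by
      rw [Algebra.algebraMap_eq_smul_one, ← TensorProduct.smul_tmul', smul_mul_assoc,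
        ← Algebra.TensorProduct.one_def, one_mul, map_smul]
    rw [map_mul, oddClass_mul, barMul_antipodeCoact, barMul_antipodeCoact, h, h]

/-- A lift of `cotangentProj` to `A` with odd values. -/
def cotangentLift : A →ₗ[k] A :=
  LinearMap.mul' k A ∘ₗ TensorProduct.map (evenPart 𝒜 ∘ₗ antipode 𝒜) (oddPart 𝒜) ∘ₗ
    Coalgebra.comul

theorem cotangentLift_mem (a : A) : cotangentLift (k := k) 𝒜 a ∈ 𝒜 1 := by
  change LinearMap.mul' k A (TensorProduct.map (evenPart 𝒜 ∘ₗ antipode 𝒜) (oddPart 𝒜)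
    (Coalgebra.comul (R := k) a)) ∈ 𝒜 1
  generalize Coalgebra.comul (R := k) a = t
  induction t using TensorProduct.induction_on with
  | zero => simp
  | add x y hx hy => simpa only [map_add] using (𝒜 1).add_mem hx hy
  | tmul p q => simpa using even_mul_odd 𝒜 (evenPart_mem 𝒜 _) (oddPart_mem 𝒜 q)

theorem sqProj_cotangentLift (a : A) :
    sqProj (k := k) 𝒜 (cotangentLift 𝒜 a) = cotangentProj 𝒜 a := by
  have h : ∀ t : A ⊗[k] A, sqProj (k := k) 𝒜 (LinearMap.mul' k A (TensorProduct.map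
      (evenPart 𝒜 ∘ₗ antipode 𝒜) (oddPart 𝒜) t)) =
      oddClass 𝒜 (Algebra.TensorProduct.map (barAntipodeAlg 𝒜)
      (AlgHom.id k A) ((proj 𝒜).toLinearMap.rTensor A t)) := by
    intro t
    induction t using TensorProduct.induction_on with
    | zero => simp
    | add x y hx hy => simp only [map_add, hx, hy]
    | tmul p q =>
      simp only [LinearMap.rTensor_tmul, AlgHom.toLinearMap_apply, LinearMap.comp_apply,
        Algebra.TensorProduct.map_tmul, barAntipodeAlg_proj, AlgHom.coe_id, id,
        TensorProduct.map_tmul, LinearMap.mul'_apply]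
      rw [← oddClass_tmul, proj_evenPart]
      rfl
  exact h _

/-- Every odd element is congruent modulo `I²` to a combination of values of
`cotangentLift`. -/
theorem sqProj_oddPart_eq (a : A) : sqProj (k := k) 𝒜 (oddPart 𝒜 a) =
    sqProj 𝒜 (LinearMap.mul' k A (TensorProduct.map LinearMap.id (cotangentLift 𝒜)
      (Coalgebra.comul (R := k) a))) := by
  have h : ∀ t : A ⊗[k] A, sqProj 𝒜 (LinearMap.mul' k A (TensorProduct.map LinearMap.id
      (cotangentLift 𝒜) t)) = oddClass 𝒜 (LinearMap.mul' k (Bar 𝒜 ⊗[k] A)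
        (TensorProduct.map (inclProj 𝒜) (antipodeCoact 𝒜).toLinearMap t)) := by
    intro t
    induction t using TensorProduct.induction_on with
    | zero => simp
    | add x y hx hy => simp only [map_add, hx, hy]
    | tmul p q =>
      simp only [TensorProduct.map_tmul, LinearMap.mul'_apply, LinearMap.id_apply, map_mul,
        sqProj_cotangentLift]
      exact sqProj_mul_oddClass 𝒜 p _
  rw [h, mul'_map_inclProj_antipodeCoact]
  have h1 := oddClass_tmul (k := k) 𝒜 1 a
  rw [one_mul, map_one] at h1
  exact h1.symm

/-- The map `a ↦ Σ π(a₁) ⊗ P(a₂)`, where `P` is `cotangentProj`. -/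
def cotangentCoact : A →ₗ[k] Bar 𝒜 ⊗[k] (A ⧸ oddIdeal 𝒜 ^ 2) :=
  (cotangentProj 𝒜).lTensor (Bar 𝒜) ∘ₗ (leftCoact 𝒜).toLinearMap

theorem slice_counit_leftCoact (a : A) :
    slice (Bar 𝒜) (Coalgebra.counit (R := k)) (leftCoact 𝒜 a) = proj 𝒜 a := by
  have h := map_slice (proj (k := k) 𝒜).toLinearMap (Coalgebra.counit (R := k))
    (Coalgebra.comul (R := k) a)
  rw [slice_counit_comul] at h
  exact h.symm

omit [SuperCommHopfAlgebra k 𝒜] in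
theorem smul_lTensor_mul {R : Type*} [CommRing R] [Algebra k R] {M : Type*} [AddCommGroup M]
    [Module k M] {δ : A →ₗ[k] M} (hδ : IsOddDerivation 𝒜 δ) (u w : R ⊗[k] A) :
    δ.lTensor R (u * w) = slice R (Coalgebra.counit (R := k)) w • δ.lTensor R u +
      slice R (Coalgebra.counit (R := k)) u • δ.lTensor R w := by
  induction u using TensorProduct.induction_on with
  | zero => simp
  | add x y hx hy =>
    simp only [add_mul, map_add, hx, hy, smul_add, add_smul]
    abel
  | tmul a b =>
    induction w using TensorProduct.induction_on with
    | zero => simp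
    | add x y hx hy =>
      simp only [mul_add, map_add, hx, hy, smul_add, add_smul]
      abel
    | tmul c d =>
      simp only [Algebra.TensorProduct.tmul_mul_tmul, LinearMap.lTensor_tmul, hδ.leibniz,
        slice_tmul, TensorProduct.tmul_add, TensorProduct.tmul_smul, TensorProduct.smul_tmul',
        smul_eq_mul, smul_mul_assoc, mul_comm c a]

theorem cotangentCoact_mul (a b : A) : cotangentCoact (k := k) 𝒜 (a * b) =
    proj 𝒜 b • cotangentCoact 𝒜 a + proj 𝒜 a • cotangentCoact 𝒜 b := by
  change (cotangentProj 𝒜).lTensor (Bar 𝒜) (leftCoact 𝒜 (a * b)) = _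
  rw [map_mul]
  refine (smul_lTensor_mul 𝒜 (isOddDerivation_cotangentProj 𝒜) _ _).trans ?_
  rw [slice_counit_leftCoact, slice_counit_leftCoact]
  rfl

theorem cotangentCoact_oddPart (h2 : (2 : k) ≠ 0) (a : A) :
    cotangentCoact (k := k) 𝒜 (oddPart 𝒜 a) = cotangentCoact 𝒜 a := by
  have h1 : ∀ a, cotangentCoact (k := k) 𝒜 (parity 𝒜 a) = -cotangentCoact 𝒜 a := by
    intro a
    change (cotangentProj 𝒜).lTensor (Bar 𝒜) (leftCoact 𝒜 (parity 𝒜 a)) =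
      -(cotangentProj 𝒜).lTensor (Bar 𝒜) (leftCoact 𝒜 a)
    rw [leftCoact_parity, ← LinearMap.lTensor_comp_apply, ← LinearMap.neg_apply,
      ← LinearMap.lTensor_neg]
    congr 2
    ext a
    exact (isOddDerivation_cotangentProj 𝒜).map_parity a
  have h3 : cotangentCoact (k := k) 𝒜 (evenPart 𝒜 a) = 0 := by
    have h := h1 (evenPart 𝒜 a)
    rw [parity_of_even (evenPart_mem 𝒜 a), eq_neg_iff_add_eq_zero, ← two_smul k] at h
    exact (smul_eq_zero.mp h).resolve_left h2
  conv_rhs => rw [← evenPart_add_oddPart 𝒜 a]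
  rw [map_add, h3, zero_add]

/-- The values of `cotangentProj` are left coinvariant. -/
theorem cotangentCoact_cotangentLift (h2 : (2 : k) ≠ 0) (a : A) :
    cotangentCoact (k := k) 𝒜 (cotangentLift 𝒜 a) = 1 ⊗ₜ cotangentProj 𝒜 a := by
  have h : ∀ t : A ⊗[k] A, cotangentCoact (k := k) 𝒜 (LinearMap.mul' k A (TensorProduct.map
      (evenPart 𝒜 ∘ₗ antipode 𝒜) (oddPart 𝒜) t)) =
      (cotangentProj 𝒜).lTensor (Bar 𝒜) (LinearMap.mul' k (Bar 𝒜 ⊗[k] A)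
        (TensorProduct.map (inclAntipode 𝒜) (leftCoact 𝒜).toLinearMap t)) := by
    intro t
    induction t using TensorProduct.induction_on with
    | zero => simp
    | add x y hx hy => simp only [map_add, hx, hy]
    | tmul p q =>
      simp only [TensorProduct.map_tmul, LinearMap.mul'_apply, LinearMap.comp_apply]
      rw [cotangentCoact_mul, proj_odd 𝒜 (oddPart_mem 𝒜 q), zero_smul, zero_add, proj_evenPart,
        cotangentCoact_oddPart 𝒜 h2]
      have h3 : ∀ (x : Bar 𝒜) (w : Bar 𝒜 ⊗[k] A), x • (cotangentProj 𝒜).lTensor (Bar 𝒜) w =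
          (cotangentProj 𝒜).lTensor (Bar 𝒜) ((x ⊗ₜ 1) * w) := by
        intro x w
        induction w using TensorProduct.induction_on with
        | zero => simp
        | add y z hy hz => simp only [map_add, mul_add, smul_add, hy, hz]
        | tmul c d =>
          simp [Algebra.TensorProduct.tmul_mul_tmul, TensorProduct.smul_tmul']
      exact h3 _ _
  refine (h _).trans ?_
  rw [mul'_map_inclAntipode_leftCoact, LinearMap.lTensor_tmul]

/-- If the cotangent space is finite-dimensional, then there are odd elements generating the odd
ideal `I` modulo `I²`, together with left-invariant superderivations dual to them modulo `I`. -/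
theorem exists_frame (h2 : (2 : k) ≠ 0)
    [FiniteDimensional k (LinearMap.range (cotangentProj (k := k) 𝒜))] :
    ∃ (m : ℕ) (x : Fin m → A) (δ : Fin m → A →ₗ[k] k), (∀ i, x i ∈ 𝒜 1) ∧
      (∀ i, IsOddDerivation 𝒜 (δ i)) ∧
      (∀ i j, invariantField (δ i) (x j) - (if i = j then 1 else 0) ∈ oddIdeal 𝒜) ∧
      oddIdeal 𝒜 ≤ Ideal.span (Set.range x) ⊔ oddIdeal 𝒜 ^ 2 := by
  let b := Module.finBasis k (LinearMap.range (cotangentProj (k := k) 𝒜))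
  choose c hc using fun i => (b i).2
  choose ξ hξ using fun i => LinearMap.exists_extend (b.coord i)
  have hξ' (i j) : ξ i (cotangentProj 𝒜 (c j)) = if i = j then 1 else 0 := by
    rw [hc]
    refine (LinearMap.congr_fun (hξ i) (b j)).trans ?_
    rw [Module.Basis.coord_apply, Module.Basis.repr_self, Finsupp.single_apply]
    simp only [eq_comm]
  refine ⟨_, fun i => cotangentLift (k := k) 𝒜 (c i), fun i => ξ i ∘ₗ cotangentProj 𝒜,
    fun i => cotangentLift_mem 𝒜 _, fun i => (isOddDerivation_cotangentProj 𝒜).comp _,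
    fun i j => ?_, ?_⟩
  · rw [← Ideal.Quotient.eq_zero_iff_mem]
    change proj (k := k) 𝒜 _ = 0
    have h3 : proj 𝒜 (invariantField (ξ i ∘ₗ cotangentProj 𝒜) (cotangentLift (k := k) 𝒜 (c j))) =
        slice (Bar 𝒜) (ξ i) (cotangentCoact 𝒜 (cotangentLift (k := k) 𝒜 (c j))) := by
      refine (map_slice (proj 𝒜).toLinearMap _ _).trans ?_
      exact (slice_lTensor (ξ i) (cotangentProj 𝒜) _).symm
    rw [map_sub, h3, cotangentCoact_cotangentLift 𝒜 h2, slice_tmul, hξ']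
    split_ifs <;> simp
  · refine Ideal.span_le.mpr fun y hy => ?_
    set N := Ideal.span (Set.range fun i => cotangentLift (k := k) 𝒜 (c i)) ⊔ oddIdeal 𝒜 ^ 2
      with hN
    have hP : ∀ a, cotangentLift (k := k) 𝒜 a ∈ N := by
      intro a
      have h3 := congrArg Subtype.val (b.sum_repr ⟨cotangentProj 𝒜 a, a, rfl⟩)
      rw [Submodule.coe_sum] at h3
      have h4 : cotangentLift (k := k) 𝒜 a -
          ∑ i, algebraMap k A (b.repr ⟨cotangentProj 𝒜 a, a, rfl⟩ i) *
            cotangentLift (k := k) 𝒜 (c i) ∈ oddIdeal 𝒜 ^ 2 := by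
        rw [← sqProj_eq_zero_iff (k := k), map_sub, sqProj_cotangentLift, sub_eq_zero, map_sum]
        refine h3.symm.trans ?_
        refine Finset.sum_congr rfl fun i _ => ?_
        rw [← Algebra.smul_def, map_smul, sqProj_cotangentLift, hc]
        rfl
      rw [← sub_add_cancel (cotangentLift (k := k) 𝒜 a)]
      refine N.add_mem (Submodule.mem_sup_right h4) (Submodule.mem_sup_left ?_)
      exact Ideal.sum_mem _ fun i _ => Ideal.mul_mem_left _ _
        (Ideal.subset_span ⟨i, rfl⟩)
    have hP' : ∀ t : A ⊗[k] A, LinearMap.mul' k A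
        (TensorProduct.map LinearMap.id (cotangentLift 𝒜) t) ∈ N := by
      intro t
      induction t using TensorProduct.induction_on with
      | zero => simp
      | add x y hx hy => simpa only [map_add] using N.add_mem hx hy
      | tmul p q => exact N.mul_mem_left p (hP q)
    have h5 := sqProj_oddPart_eq (k := k) 𝒜 y
    rw [oddPart_of_odd hy, ← sub_eq_zero, ← map_sub, sqProj_eq_zero_iff] at h5
    have h6 := N.add_mem (Submodule.mem_sup_right h5) (hP' (Coalgebra.comul (R := k) y))
    rwa [sub_add_cancel] at h6

/-- Odd tangent vectors separate the points of the odd ideal `I`, up to the intersection of its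
powers. -/
theorem mem_oddIdeal_pow_of_invariantField_eq_zero (h2 : (2 : k) ≠ 0)
    [FiniteDimensional k (LinearMap.range (cotangentProj (k := k) 𝒜))] {e : A}
    (he : e ∈ oddIdeal 𝒜)
    (hδ : ∀ δ : A →ₗ[k] k, IsOddDerivation 𝒜 δ → invariantField δ e = 0) (n : ℕ) :
    e ∈ oddIdeal 𝒜 ^ n := by
  obtain ⟨m, x, δ, hx, hd, hdual, hgen⟩ := exists_frame (k := k) 𝒜 h2
  have h := mem_oddIdeal_pow_of_superderivation_eq_zero h2
    (fun i => (hd i).isOddSuperderivation 𝒜) hx hdual hgen he (fun i => hδ _ (hd i)) n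
  exact Ideal.pow_le_pow_right (Nat.le_succ n) h

end Frame

end SuperCommHopfAlgebra

/-! ### Invariant vectors -/

namespace SuperCommHopfAlgebra

section Adjoint

variable {k : Type u} [Field k] {A : Type v} [Ring A] [Algebra k A] [Coalgebra k A]
  (𝒜 : ZMod 2 → Submodule k A) [GradedAlgebra 𝒜] [SuperCommHopfAlgebra k 𝒜]

theorem leftCoact_commute (a : A) (x : Bar 𝒜) : Commute (leftCoact (k := k) 𝒜 a)
    ((Algebra.TensorProduct.includeLeft (S := k) (B := A)).comp (barAntipodeAlg 𝒜) x) := by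
  change leftCoact 𝒜 a * (barAntipodeAlg 𝒜 x ⊗ₜ 1) = (barAntipodeAlg 𝒜 x ⊗ₜ 1) * leftCoact 𝒜 a
  generalize leftCoact 𝒜 a = t
  induction t using TensorProduct.induction_on with
  | zero => simp
  | add x y hx hy => simp only [add_mul, mul_add, hx, hy]
  | tmul p q => simp [Algebra.TensorProduct.tmul_mul_tmul, mul_comm]

/-- The map `a ↦ Σ π(a₁) S(π(a₃)) ⊗ a₂`, as an algebra map `A → Ā ⊗ A`. It is the coadjoint
coaction of `Ā`. -/
def adjointCoact : A →ₐ[k] Bar 𝒜 ⊗[k] A :=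
  (Algebra.TensorProduct.lift (leftCoact 𝒜)
    ((Algebra.TensorProduct.includeLeft (S := k) (B := A)).comp (barAntipodeAlg 𝒜))
    (leftCoact_commute 𝒜)).comp (coactAlg 𝒜)

theorem adjointCoact_apply (a : A) : adjointCoact (k := k) 𝒜 a =
    LinearMap.mul' k (Bar 𝒜 ⊗[k] A) (TensorProduct.map (leftCoact 𝒜).toLinearMap
      (inclAntipode 𝒜) (Coalgebra.comul a)) := by
  have h : ∀ t : A ⊗[k] A, Algebra.TensorProduct.lift (leftCoact 𝒜)
    ((Algebra.TensorProduct.includeLeft (S := k) (B := A)).comp (barAntipodeAlg 𝒜))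
    (leftCoact_commute 𝒜)
      ((proj 𝒜).toLinearMap.lTensor A t) =
    LinearMap.mul' k (Bar 𝒜 ⊗[k] A) (TensorProduct.map (leftCoact 𝒜).toLinearMap
      (inclAntipode 𝒜) t) := by
    intro t
    induction t using TensorProduct.induction_on with
    | zero => simp
    | add x y hx hy => simp only [map_add, hx, hy]
    | tmul p q =>
      simp only [LinearMap.lTensor_tmul, AlgHom.toLinearMap_apply,
        Algebra.TensorProduct.lift_tmul, AlgHom.comp_apply, barAntipodeAlg_proj,
        TensorProduct.map_tmul, LinearMap.mul'_apply]
      rfl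
  exact h _

/-- A right inverse in a monoid can be cancelled. -/
theorem mul_cancel_right {R : Type*} [Monoid R] (f : R) {g h : R} (hgh : g * h = 1) :
    f * g * h = f := by
  rw [mul_assoc, hgh, mul_one]

/-- `Σ χ(a₁) (π(a₂) ⊗ 1) = λ(a)` for the coadjoint coaction `χ` and the left coaction `λ`. -/
theorem mul'_map_adjointCoact_inclProj (a : A) : LinearMap.mul' k (Bar 𝒜 ⊗[k] A)
    (TensorProduct.map (adjointCoact 𝒜).toLinearMap (inclProj 𝒜) (Coalgebra.comul a)) =
      leftCoact 𝒜 a := by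
  have h1 : WithConv.toConv (adjointCoact 𝒜).toLinearMap =
      WithConv.toConv (leftCoact 𝒜).toLinearMap * WithConv.toConv (inclAntipode 𝒜) := by
    ext a
    exact adjointCoact_apply 𝒜 a
  have h : WithConv.toConv (adjointCoact 𝒜).toLinearMap * WithConv.toConv (inclProj 𝒜) =
      WithConv.toConv (leftCoact 𝒜).toLinearMap := by
    rw [h1]
    exact mul_cancel_right _ (inclAntipode_mul_inclProj 𝒜)
  exact LinearMap.congr_fun (congrArg WithConv.ofConv h) a

omit [Coalgebra k A] [SuperCommHopfAlgebra k 𝒜] in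
theorem lTensor_parity_mul {R : Type*} [CommRing R] [Algebra k R] (u w : R ⊗[k] A) :
    (parity 𝒜).toLinearMap.lTensor R (u * w) =
      (parity 𝒜).toLinearMap.lTensor R u * (parity 𝒜).toLinearMap.lTensor R w :=
  map_mul (Algebra.TensorProduct.map (AlgHom.id k R) (parity 𝒜)) u w

theorem adjointCoact_parity (a : A) : adjointCoact 𝒜 (parity 𝒜 a) =
    (parity (k := k) 𝒜).toLinearMap.lTensor (Bar 𝒜) (adjointCoact 𝒜 a) := by
  rw [adjointCoact_apply, adjointCoact_apply, comul_parity]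
  generalize Coalgebra.comul (R := k) a = t
  induction t using TensorProduct.induction_on with
  | zero => simp
  | add x y hx hy => simp only [map_add, hx, hy]
  | tmul p q =>
    simp only [TensorProduct.map_tmul, LinearMap.mul'_apply, AlgHom.toLinearMap_apply,
      leftCoact_parity]
    refine Eq.trans ?_ (lTensor_parity_mul 𝒜 _ _).symm
    have h : inclAntipode (k := k) 𝒜 (parity 𝒜 q) =
        (parity (k := k) 𝒜).toLinearMap.lTensor (Bar 𝒜) (inclAntipode 𝒜 q) := by
      change (antipodeAux 𝒜 (parity 𝒜 q)) ⊗ₜ[k] (1 : A) =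
        (parity (k := k) 𝒜).toLinearMap.lTensor (Bar 𝒜) (antipodeAux 𝒜 q ⊗ₜ 1)
      rw [LinearMap.lTensor_tmul, AlgHom.toLinearMap_apply, map_one]
      congr 1
      change proj 𝒜 (antipode 𝒜 (parity 𝒜 q)) = proj 𝒜 (antipode 𝒜 q)
      rw [antipode_parity, proj_parity]
    rw [h]

omit [SuperCommHopfAlgebra k 𝒜] in
theorem slice_mul {R : Type*} [CommRing R] [Algebra k R] {δ : A →ₗ[k] k}
    (hδ : IsOddDerivation 𝒜 δ) (u w : R ⊗[k] A) :
    slice R δ (u * w) = slice R (Coalgebra.counit (R := k)) w * slice R δ u +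
      slice R (Coalgebra.counit (R := k)) u * slice R δ w := by
  induction u using TensorProduct.induction_on with
  | zero => simp
  | add x y hx hy =>
    simp only [add_mul, mul_add, map_add, hx, hy]
    abel
  | tmul a b =>
    induction w using TensorProduct.induction_on with
    | zero => simp
    | add x y hx hy =>
      simp only [mul_add, add_mul, map_add, hx, hy]
      abel
    | tmul c d =>
      simp only [Algebra.TensorProduct.tmul_mul_tmul, hδ.leibniz, slice_tmul, smul_eq_mul,
        smul_mul_smul_comm, mul_comm c a, add_smul]

omit [GradedAlgebra 𝒜] [SuperCommHopfAlgebra k 𝒜] in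
theorem slice_counit_mul (hε : ∀ a b : A, Coalgebra.counit (R := k) (a * b) =
      Coalgebra.counit (R := k) a * Coalgebra.counit (R := k) b)
    {R : Type*} [CommRing R] [Algebra k R] (u w : R ⊗[k] A) :
    slice R (Coalgebra.counit (R := k)) (u * w) =
      slice R (Coalgebra.counit (R := k)) u * slice R (Coalgebra.counit (R := k)) w := by
  induction u using TensorProduct.induction_on with
  | zero => simp
  | add x y hx hy => simp only [add_mul, map_add, hx, hy]
  | tmul a b =>
    induction w using TensorProduct.induction_on with
    | zero => simp
    | add x y hx hy => simp only [mul_add, map_add, hx, hy]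
    | tmul c d =>
      simp only [Algebra.TensorProduct.tmul_mul_tmul, hε, slice_tmul,
        smul_mul_smul_comm]

theorem slice_counit_adjointCoact (a : A) :
    slice (Bar 𝒜) (Coalgebra.counit (R := k)) (adjointCoact 𝒜 a) =
      algebraMap k (Bar 𝒜) (Coalgebra.counit (R := k) a) := by
  rw [adjointCoact_apply, ← mul'_map_proj_antipodeAux]
  generalize Coalgebra.comul (R := k) a = t
  induction t using TensorProduct.induction_on with
  | zero => simp
  | add x y hx hy => simp only [map_add, hx, hy]
  | tmul p q =>
    simp only [TensorProduct.map_tmul, LinearMap.mul'_apply, AlgHom.toLinearMap_apply]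
    refine (slice_counit_mul (counit_mul (𝒜 := 𝒜)) _ _).trans ?_
    rw [slice_counit_leftCoact]
    congr 1
    change slice (Bar 𝒜) _ (antipodeAux 𝒜 q ⊗ₜ[k] (1 : A)) = _
    rw [slice_tmul, counit_one (k := k) (𝒜 := 𝒜), one_smul]

/-- The adjoint action `f ▷ δ = (f ⊗ δ) ∘ χ` of a linear form `f` on `Ā` on odd tangent vectors
`δ`, where `χ` is the coadjoint coaction. -/
def adjointAct (f : Bar 𝒜 →ₗ[k] k) (δ : A →ₗ[k] k) : A →ₗ[k] k :=
  f ∘ₗ slice (Bar 𝒜) δ ∘ₗ (adjointCoact 𝒜).toLinearMap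

variable {𝒜} in
theorem IsOddDerivation.adjointAct (f : Bar 𝒜 →ₗ[k] k) {δ : A →ₗ[k] k}
    (hδ : IsOddDerivation 𝒜 δ) : IsOddDerivation 𝒜 (adjointAct 𝒜 f δ) where
  map_parity a := by
    change f (slice (Bar 𝒜) δ (adjointCoact 𝒜 (parity 𝒜 a))) =
      -f (slice (Bar 𝒜) δ (adjointCoact 𝒜 a))
    rw [adjointCoact_parity, slice_lTensor, ← map_neg]
    congr 1
    generalize adjointCoact 𝒜 a = t
    induction t using TensorProduct.induction_on with
    | zero => simp
    | add x y hx hy => simp only [map_add, hx, hy, neg_add]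
    | tmul p q => simp [hδ.map_parity]
  leibniz a b := by
    change f (slice (Bar 𝒜) δ (adjointCoact 𝒜 (a * b))) =
      _ • f (slice (Bar 𝒜) δ (adjointCoact 𝒜 a)) + _ • f (slice (Bar 𝒜) δ (adjointCoact 𝒜 b))
    rw [map_mul]
    refine (congrArg f (slice_mul 𝒜 hδ _ _)).trans ?_
    rw [slice_counit_adjointCoact, slice_counit_adjointCoact, ← Algebra.smul_def,
      ← Algebra.smul_def, map_add, map_smul, map_smul]

variable {V : Type*} [AddCommGroup V] [Module k V] (ρ : RightComodule k A V)

/-- On vectors which are invariant under `Ā`, the operator `f δ` is the operator `f ▷ δ`. -/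
theorem act_mul_eq_act_adjointAct (f : Bar 𝒜 →ₗ[k] k) (δ : A →ₗ[k] k) {v : V}
    (hv : (proj 𝒜).toLinearMap.lTensor V (ρ.coact v) = v ⊗ₜ 1) :
    ρ.act (WithConv.toConv (f ∘ₗ (proj 𝒜).toLinearMap) * WithConv.toConv δ) v =
      ρ.act (WithConv.toConv (adjointAct 𝒜 f δ)) v := by
  -- the linear form `a ↦ (f ⊗ δ)(χ(a) (c ⊗ 1))`, depending linearly on `c`
  let G : Bar 𝒜 →ₗ[k] A →ₗ[k] k := LinearMap.mk₂ k
    (fun c a => f (slice (Bar 𝒜) δ (adjointCoact 𝒜 a * (c ⊗ₜ 1))))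
    (fun c d a => by simp only [TensorProduct.add_tmul, mul_add, map_add])
    (fun r c a => by simp only [← TensorProduct.smul_tmul', mul_smul_comm, map_smul])
    (fun c a b => by simp only [add_mul, map_add])
    (fun r c a => by simp only [smul_mul_assoc, map_smul])
  let θ : A ⊗[k] A →ₗ[k] k := f ∘ₗ slice (Bar 𝒜) δ ∘ₗ LinearMap.mul' k (Bar 𝒜 ⊗[k] A) ∘ₗ
    TensorProduct.map (adjointCoact 𝒜).toLinearMap (inclProj 𝒜)
  let Ψ : V ⊗[k] Bar 𝒜 →ₗ[k] V := TensorProduct.lift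
    ((ρ.act.toLinearMap ∘ₗ (WithConv.linearEquiv k (A →ₗ[k] k)).symm.toLinearMap ∘ₗ G).flip)
  have hθ : (WithConv.toConv (f ∘ₗ (proj 𝒜).toLinearMap) * WithConv.toConv δ).ofConv =
      θ ∘ₗ Coalgebra.comul := by
    ext a
    refine Eq.trans ?_ (congrArg (fun w => f (slice (Bar 𝒜) δ w))
      (mul'_map_adjointCoact_inclProj 𝒜 a).symm)
    change LinearMap.mul' k k (TensorProduct.map (f ∘ₗ (proj 𝒜).toLinearMap) δ
      (Coalgebra.comul a)) = f (slice (Bar 𝒜) δ ((proj 𝒜).toLinearMap.rTensor A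
        (Coalgebra.comul a)))
    generalize Coalgebra.comul (R := k) a = t
    induction t using TensorProduct.induction_on with
    | zero => simp
    | add x y hx hy => simp only [map_add, hx, hy]
    | tmul p q => simp [mul_comm]
  have h1 : ∀ (b : A) (s : V ⊗[k] A), slice V θ (TensorProduct.assoc k V A A (s ⊗ₜ b)) =
      slice V (G (proj 𝒜 b)) s := by
    intro b s
    induction s using TensorProduct.induction_on with
    | zero => simp
    | add x y hx hy => simp only [TensorProduct.add_tmul, map_add, hx, hy]
    | tmul x a =>
      rw [TensorProduct.assoc_tmul, slice_tmul, slice_tmul]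
      rfl
  have h2 : ∀ t : V ⊗[k] A, slice V θ (TensorProduct.assoc k V A A (ρ.coact.rTensor A t)) =
      Ψ ((proj 𝒜).toLinearMap.lTensor V t) := by
    intro t
    induction t using TensorProduct.induction_on with
    | zero => simp
    | add x y hx hy => simp only [map_add, hx, hy]
    | tmul x b =>
      rw [LinearMap.rTensor_tmul, h1]
      rfl
  rw [RightComodule.act_apply, hθ, ← slice_lTensor, ← ρ.coassoc, h2, hv]
  have h3 : G 1 = adjointAct 𝒜 f δ := by
    ext a
    change f (slice (Bar 𝒜) δ (adjointCoact 𝒜 a * (1 ⊗ₜ 1))) =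
      f (slice (Bar 𝒜) δ (adjointCoact 𝒜 a))
    rw [← Algebra.TensorProduct.one_def, mul_one]
  change ρ.act (WithConv.toConv (G 1)) v = _
  rw [h3]

end Adjoint

section Bracket

variable {k : Type u} [Field k] {A : Type v} [Ring A] [Algebra k A] [Coalgebra k A]
  (𝒜 : ZMod 2 → Submodule k A) [GradedAlgebra 𝒜] [SuperCommHopfAlgebra k 𝒜]

/-- The linear forms on `A` which vanish on the odd ideal and at `1`, that is, the augmentation
ideal of the dual algebra of `Ā`. -/
def evenAugmentation : Set (WithConv (A →ₗ[k] k)) :=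
  {f | f.ofConv 1 = 0 ∧ ∀ a ∈ oddIdeal 𝒜, f.ofConv a = 0}

variable {𝒜} {δ δ' : A →ₗ[k] k}

/-- The convolution product of two odd tangent vectors is a second-order differential operator at
the counit. Its mixed terms are skew-symmetric in the two tangent vectors. -/
theorem convMul_mul (hδ : IsOddDerivation 𝒜 δ) (hδ' : IsOddDerivation 𝒜 δ') (h2 : (2 : k) ≠ 0)
    (a b : A) : (WithConv.toConv δ * WithConv.toConv δ').ofConv (a * b) =
      (WithConv.toConv δ * WithConv.toConv δ').ofConv a * Coalgebra.counit (R := k) b +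
        δ a * δ' b - δ' a * δ b +
        Coalgebra.counit (R := k) a * (WithConv.toConv δ * WithConv.toConv δ').ofConv b := by
  let ε : A →ₗ[k] k := Coalgebra.counit
  let T (f g : A →ₗ[k] k) : A ⊗[k] A →ₗ[k] k := LinearMap.mul' k k ∘ₗ TensorProduct.map f g
  have hl (f : A →ₗ[k] k) (a : A) : T f ε (Coalgebra.comul a) = f a :=
    LinearMap.congr_fun (congrArg WithConv.ofConv
      (mul_one (WithConv.toConv f : WithConv (A →ₗ[k] k)))) a
  have hr (f : A →ₗ[k] k) (a : A) : T ε f (Coalgebra.comul a) = f a :=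
    LinearMap.congr_fun (congrArg WithConv.ofConv
      (one_mul (WithConv.toConv f : WithConv (A →ₗ[k] k)))) a
  let m := LinearMap.mul k k
  refine (apply_comul_mul 𝒜 (T δ δ') a b (m.compl₁₂ (T δ δ') (T ε ε) +
    m.compl₁₂ (T δ ε) (T ε δ') - m.compl₁₂ (T ε δ') (T δ ε) + m.compl₁₂ (T ε ε) (T δ δ'))
    (fun a a' b b' => ?_)).trans ?_
  · change _ = (δ a * δ' a') * (ε b * ε b') + (δ a * ε a') * (ε b * δ' b') -
      (ε a * δ' a') * (δ b * ε b') + (ε a * ε a') * (δ b * δ' b')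
    have h0 : δ (evenPart 𝒜 b) = 0 := hδ.map_even h2 (evenPart_mem 𝒜 b)
    have h1 : ε (oddPart 𝒜 b) = 0 := counit_odd (𝒜 := 𝒜) _ (oddPart_mem 𝒜 b)
    have h3 : ε (evenPart 𝒜 b) = ε b := counit_evenPart 𝒜 b
    have h4 : ε (parity 𝒜 a') = ε a' := counit_parity 𝒜 a'
    simp only [ε] at h1 h3 h4 ⊢
    simp only [T, map_add, LinearMap.comp_apply, TensorProduct.map_tmul, LinearMap.mul'_apply,
      hδ.leibniz, hδ'.leibniz, h0, h1, h3, h4, hδ'.map_parity, hδ.map_oddPart h2, smul_eq_mul]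
    ring
  · change T δ δ' (Coalgebra.comul a) * T ε ε (Coalgebra.comul b) +
      T δ ε (Coalgebra.comul a) * T ε δ' (Coalgebra.comul b) -
      T ε δ' (Coalgebra.comul a) * T δ ε (Coalgebra.comul b) +
      T ε ε (Coalgebra.comul a) * T δ δ' (Coalgebra.comul b) = _
    rw [hl, hl, hl, hl, hr, hr]
    rfl

/-- The bracket of two odd tangent vectors is tangent to the even subgroup. -/
theorem bracket_mem_evenAugmentation (hδ : IsOddDerivation 𝒜 δ) (hδ' : IsOddDerivation 𝒜 δ')
    (h2 : (2 : k) ≠ 0) : WithConv.toConv δ * WithConv.toConv δ' +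
      WithConv.toConv δ' * WithConv.toConv δ ∈ evenAugmentation 𝒜 := by
  have hodd {δ δ' : A →ₗ[k] k} (hδ : IsOddDerivation 𝒜 δ) (hδ' : IsOddDerivation 𝒜 δ') {y : A}
      (hy : y ∈ 𝒜 1) : (WithConv.toConv δ * WithConv.toConv δ').ofConv y = 0 := by
    have h : ∀ t : A ⊗[k] A, LinearMap.mul' k k (TensorProduct.map δ δ' (TensorProduct.map
        (parity 𝒜).toLinearMap (parity 𝒜).toLinearMap t)) =
        LinearMap.mul' k k (TensorProduct.map δ δ' t) := by
      intro t
      induction t using TensorProduct.induction_on with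
      | zero => simp
      | add x y hx hy => simp only [map_add, hx, hy]
      | tmul p q => simp [hδ.map_parity, hδ'.map_parity]
    have h3 := h (Coalgebra.comul y)
    rw [← comul_parity, parity_of_odd hy, map_neg, map_neg, map_neg] at h3
    have h4 := eq_neg_iff_add_eq_zero.mp h3.symm
    rw [← two_mul] at h4
    exact (mul_eq_zero.mp h4).resolve_left h2
  have hε : ∀ x ∈ oddIdeal 𝒜, Coalgebra.counit (R := k) x = 0 := counitAlg_oddIdeal 𝒜
  refine ⟨?_, fun a ha => ?_⟩
  · rw [WithConv.ofConv_add, LinearMap.add_apply]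
    have h (δ δ' : A →ₗ[k] k) (hδ : IsOddDerivation 𝒜 δ) :
        (WithConv.toConv δ * WithConv.toConv δ').ofConv 1 = 0 := by
      change LinearMap.mul' k k (TensorProduct.map δ δ' (Coalgebra.comul (R := k) (1 : A))) = 0
      rw [comul_one (k := k) (𝒜 := 𝒜)]
      simp [hδ.map_one]
    rw [h δ δ' hδ, h δ' δ hδ', add_zero]
  · induction ha using Submodule.span_induction with
    | mem y hy =>
      rw [WithConv.ofConv_add, LinearMap.add_apply, hodd hδ hδ' hy, hodd hδ' hδ hy, add_zero]
    | zero => simp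
    | add x y _ _ hx hy => rw [map_add, hx, hy, add_zero]
    | smul a y hy h0 =>
      rw [WithConv.ofConv_add, LinearMap.add_apply] at h0 ⊢
      rw [smul_eq_mul, convMul_mul hδ hδ' h2, convMul_mul hδ' hδ h2, hε y hy]
      linear_combination (Coalgebra.counit (R := k) a) * h0

end Bracket

section Invariants

variable {k : Type u} [Field k] {A : Type v} [Ring A] [Algebra k A] [Coalgebra k A]
  (𝒜 : ZMod 2 → Submodule k A) [GradedAlgebra 𝒜] [SuperCommHopfAlgebra k 𝒜]
  {V : Type*} [AddCommGroup V] [Module k V] (ρ : RightComodule k A V)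

/-- The vectors which are invariant under `Ā`, that is, annihilated by the augmentation ideal of
its dual algebra. -/
def evenInvariants : Submodule k V where
  carrier := {v | ∀ f ∈ evenAugmentation 𝒜, ρ.act f v = 0}
  add_mem' hx hy f hf := by rw [map_add, hx f hf, hy f hf, add_zero]
  zero_mem' f _ := map_zero _
  smul_mem' c x hx f hf := by rw [map_smul, hx f hf, smul_zero]

theorem lTensor_proj_coact {v : V} (hv : v ∈ evenInvariants 𝒜 ρ) :
    (proj 𝒜).toLinearMap.lTensor V (ρ.coact v) = v ⊗ₜ 1 := by
  refine eq_of_slice_eq fun f => ?_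
  have hK : WithConv.toConv (f ∘ₗ (proj 𝒜).toLinearMap) - f 1 • 1 ∈ evenAugmentation 𝒜 := by
    refine ⟨?_, fun a ha => ?_⟩
    · simp [LinearMap.convOne_def, counit_one (k := k) (𝒜 := 𝒜)]
    · have h1 : proj (k := k) 𝒜 a = 0 := Ideal.Quotient.eq_zero_iff_mem.mpr ha
      have h2 : Coalgebra.counit (R := k) a = 0 := counitAlg_oddIdeal 𝒜 a ha
      have h3 : f (proj (k := k) 𝒜 a) = 0 := by rw [h1, map_zero]
      change f (proj (k := k) 𝒜 a) - f 1 * algebraMap k k (Coalgebra.counit (R := k) a) = 0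
      rw [h3, h2, map_zero, mul_zero, sub_zero]
  have h := hv _ hK
  rw [map_sub, map_smul, map_one ρ.act, LinearMap.sub_apply, sub_eq_zero,
    RightComodule.act_apply] at h
  rw [slice_lTensor, slice_tmul]
  exact h

/-- A version of Engel's theorem: if the augmentation ideal of the dual of `Ā` acts nilpotently,
then some nonzero vector is invariant under `Ā` and annihilated by all odd tangent vectors. -/
theorem exists_forall_act_eq_zero (h2 : (2 : k) ≠ 0) [FiniteDimensional k V] [Nontrivial V]
    (m : ℕ) (hm : ∀ l : List (WithConv (A →ₗ[k] k)), m ≤ l.length →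
      (∀ f ∈ l, f ∈ evenAugmentation 𝒜) → ρ.act l.prod = 0) :
    ∃ v ∈ evenInvariants 𝒜 ρ, v ≠ 0 ∧
      ∀ δ : A →ₗ[k] k, IsOddDerivation 𝒜 δ → ρ.act (WithConv.toConv δ) v = 0 := by
  let sub (G : Set (A →ₗ[k] k)) : Submodule k V :=
    evenInvariants 𝒜 ρ ⊓ ⨅ δ ∈ G, LinearMap.ker (ρ.act (WithConv.toConv δ))
  have hmem (G : Set (A →ₗ[k] k)) (v : V) : v ∈ sub G ↔
      v ∈ evenInvariants 𝒜 ρ ∧ ∀ δ ∈ G, ρ.act (WithConv.toConv δ) v = 0 := by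
    simp [sub]
  let P : Set (Submodule k V) :=
    {U | U ≠ ⊥ ∧ ∃ G : Set (A →ₗ[k] k), (∀ δ ∈ G, IsOddDerivation 𝒜 δ) ∧ U = sub G}
  have hP : P.Nonempty := by
    obtain ⟨v, hv⟩ := exists_ne (0 : V)
    obtain ⟨w, -, hw, hK⟩ := exists_ne_forall_eq_of_list_prod (fun f v => ρ.act f v) (by simp)
      (by simp) (evenAugmentation 𝒜) Set.univ (by simp) 0 m (Set.mem_univ v) hv
      fun l hl hf => LinearMap.congr_fun (hm l hl hf) v
    refine ⟨sub ∅, fun h => hw ?_, ∅, by simp, rfl⟩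
    rw [← Submodule.mem_bot k, ← h, hmem]
    exact ⟨hK, by simp⟩
  -- a nonzero space of common invariants of minimal dimension is annihilated by everything
  obtain ⟨U, ⟨hU0, G, hG, rfl⟩, hmin⟩ := wellFounded_lt.has_min P hP
  obtain ⟨u, hu, hu0⟩ := Submodule.exists_mem_ne_zero_of_ne_bot hU0
  by_contra! hcon
  obtain ⟨δ₀, hδ₀, hne⟩ := hcon u ((hmem G u).mp hu).1 hu0
  -- among the restrictions of odd tangent vectors to `U`, there is a nonzero one whose image
  -- consists of invariants of `Ā`
  obtain ⟨T, ⟨δ, hδ, hT⟩, hT0, hKT⟩ := exists_ne_forall_eq_of_list_prod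
    (fun f (T : sub G →ₗ[k] V) => ρ.act f ∘ₗ T) (fun T => by ext; simp)
    (fun f g T => by ext; simp) (evenAugmentation 𝒜)
    {T | ∃ δ : A →ₗ[k] k, IsOddDerivation 𝒜 δ ∧ ∀ u, T u = ρ.act (WithConv.toConv δ) u}
    (by
      rintro f hf T ⟨δ, hδ, hT⟩
      let f' : Bar 𝒜 →ₗ[k] k := ((oddIdeal 𝒜).restrictScalars k).liftQ f.ofConv hf.2
      refine ⟨adjointAct 𝒜 f' δ, hδ.adjointAct f', fun u => ?_⟩
      rw [← act_mul_eq_act_adjointAct 𝒜 ρ f' δ (lTensor_proj_coact 𝒜 ρ ((hmem G u).mp u.2).1),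
        map_mul, Module.End.mul_apply, ← hT]
      rfl)
    0 m (x := ρ.act (WithConv.toConv δ₀) ∘ₗ (sub G).subtype) ⟨δ₀, hδ₀, fun _ => rfl⟩
    (fun h => hne (LinearMap.congr_fun h ⟨u, hu⟩))
    (fun l hl hf => by rw [hm l hl hf, LinearMap.zero_comp])
  obtain ⟨w, hw⟩ : ∃ w, T w ≠ 0 := by
    by_contra! h
    exact hT0 (LinearMap.ext h)
  have hw' := (hmem G w).mp w.2
  -- the bracket of two odd tangent vectors annihilates the invariants of `Ā`
  have hsq {δ' : A →ₗ[k] k} (hδ' : IsOddDerivation 𝒜 δ') :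
      ρ.act (WithConv.toConv δ') (ρ.act (WithConv.toConv δ) w) +
        ρ.act (WithConv.toConv δ) (ρ.act (WithConv.toConv δ') w) = 0 := by
    have h := hw'.1 _ (bracket_mem_evenAugmentation hδ' hδ h2)
    rwa [map_add, map_mul, map_mul] at h
  have hTw : T w ∈ sub (insert δ G) := by
    rw [hmem]
    refine ⟨fun f hf => LinearMap.congr_fun (hKT f hf) w, fun δ' hδ' => ?_⟩
    rw [hT]
    rcases Set.mem_insert_iff.mp hδ' with rfl | hδ'
    · have h := hsq hδ
      rw [← two_smul k] at h
      exact (smul_eq_zero.mp h).resolve_left h2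
    · have h := hsq (hG δ' hδ')
      rwa [hw'.2 δ' hδ', map_zero, add_zero] at h
  refine hmin (sub (insert δ G)) ⟨fun h => hw ?_, insert δ G, ?_, rfl⟩ ?_
  · rwa [h, Submodule.mem_bot] at hTw
  · intro δ' hδ'
    rcases Set.mem_insert_iff.mp hδ' with rfl | hδ'
    · exact hδ
    · exact hG δ' hδ'
  · refine lt_of_le_of_ne (fun v hv => ?_) fun h => hw ?_
    · rw [hmem] at hv ⊢
      exact ⟨hv.1, fun δ' hδ' => hv.2 δ' (Set.mem_insert_of_mem _ hδ')⟩
    · have hw2 : (w : V) ∈ sub (insert δ G) := by rw [h]; exact w.2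
      rw [hT]
      exact ((hmem _ _).mp hw2).2 δ (Set.mem_insert _ _)

/-- The matrix coefficient `Σ φ(v₀) v₁`. -/
def matrixCoeff (φ : V →ₗ[k] k) (v : V) : A := TensorProduct.lid k A (φ.rTensor A (ρ.coact v))

theorem apply_matrixCoeff (φ : V →ₗ[k] k) (v : V) (f : WithConv (A →ₗ[k] k)) :
    f.ofConv (matrixCoeff ρ φ v) = φ (ρ.act f v) := by
  rw [matrixCoeff, RightComodule.act_apply]
  generalize ρ.coact v = t
  induction t using TensorProduct.induction_on with
  | zero => simp
  | add x y hx hy => simp only [map_add, hx, hy]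
  | tmul p q => simp [mul_comm]

theorem invariantField_matrixCoeff (φ : V →ₗ[k] k) (v : V) (δ : A →ₗ[k] k) :
    invariantField δ (matrixCoeff ρ φ v) =
      matrixCoeff ρ φ (ρ.act (WithConv.toConv δ) v) := by
  let L : V ⊗[k] (A ⊗[k] A) →ₗ[k] A :=
    (TensorProduct.lid k A).toLinearMap ∘ₗ TensorProduct.map φ (slice A δ)
  have h1 : ∀ t : V ⊗[k] A, invariantField δ (TensorProduct.lid k A (φ.rTensor A t)) =
      L ((Coalgebra.comul (R := k)).lTensor V t) := by
    intro t
    induction t using TensorProduct.induction_on with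
    | zero => simp
    | add x y hx hy => simp only [map_add, hx, hy]
    | tmul p q => simp [L, invariantField]
  have h2 : ∀ (b : A) (s : V ⊗[k] A), L (TensorProduct.assoc k V A A (s ⊗ₜ b)) =
      δ b • TensorProduct.lid k A (φ.rTensor A s) := by
    intro b s
    induction s using TensorProduct.induction_on with
    | zero => simp
    | add x y hx hy => simp only [TensorProduct.add_tmul, map_add, smul_add, hx, hy]
    | tmul p q => simp [L, smul_smul]
  have h3 : ∀ t : V ⊗[k] A, L (TensorProduct.assoc k V A A (ρ.coact.rTensor A t)) =
      TensorProduct.lid k A (φ.rTensor A (ρ.coact (slice V δ t))) := by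
    intro t
    induction t using TensorProduct.induction_on with
    | zero => simp
    | add x y hx hy => simp only [map_add, hx, hy]
    | tmul p q => rw [LinearMap.rTensor_tmul, h2, slice_tmul, map_smul, map_smul, map_smul]
  rw [matrixCoeff, h1, ← ρ.coassoc, h3]
  rfl

/-- If the odd ideal is nilpotent and the cotangent space is finite-dimensional, then a comodule
which is unipotent over `Ā` has a nonzero invariant vector. -/
theorem exists_coact_eq_tmul_one (h2 : (2 : k) ≠ 0)
    [FiniteDimensional k (LinearMap.range (cotangentProj (k := k) 𝒜))]
    {N : ℕ} (hN : oddIdeal 𝒜 ^ N = ⊥) [FiniteDimensional k V] [Nontrivial V]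
    (m : ℕ) (hm : ∀ l : List (WithConv (A →ₗ[k] k)), m ≤ l.length →
      (∀ f ∈ l, f ∈ evenAugmentation 𝒜) → ρ.act l.prod = 0) :
    ∃ v : V, v ≠ 0 ∧ ρ.coact v = v ⊗ₜ 1 := by
  obtain ⟨v, hv, hv0, hδ⟩ := exists_forall_act_eq_zero 𝒜 ρ h2 m hm
  refine ⟨v, hv0, ρ.coact_eq_tmul_one (counit_one (𝒜 := 𝒜)) fun f hf => ?_⟩
  rw [← Module.forall_dual_apply_eq_zero_iff k]
  intro φ
  -- the coefficients of the orbit of `v` are constant on `Ā` and are killed by all odd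
  -- left-invariant superderivations
  have he : matrixCoeff ρ φ v - algebraMap k A (φ v) = 0 := by
    have hI : matrixCoeff ρ φ v - algebraMap k A (φ v) ∈ oddIdeal 𝒜 := by
      rw [← Ideal.Quotient.eq_zero_iff_mem]
      change proj (k := k) 𝒜 _ = 0
      have h3 : ∀ t : V ⊗[k] A, proj 𝒜 (TensorProduct.lid k A (φ.rTensor A t)) =
          TensorProduct.lid k (Bar 𝒜) (φ.rTensor (Bar 𝒜)
            ((proj 𝒜).toLinearMap.lTensor V t)) := by
        intro t
        induction t using TensorProduct.induction_on with
        | zero => simp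
        | add x y hx hy => simp only [map_add, hx, hy]
        | tmul p q => simp
      rw [map_sub, matrixCoeff, h3, lTensor_proj_coact 𝒜 ρ hv, AlgHom.commutes,
        Algebra.algebraMap_eq_smul_one]
      simp
    have h4 := mem_oddIdeal_pow_of_invariantField_eq_zero 𝒜 h2 hI (fun δ hd => by
      rw [map_sub, invariantField_matrixCoeff, hδ δ hd, matrixCoeff, map_zero, map_zero, map_zero,
        Algebra.algebraMap_eq_smul_one, map_smul, invariantField, LinearMap.comp_apply,
        comul_one (k := k) (𝒜 := 𝒜), slice_tmul, hd.map_one, zero_smul, smul_zero, sub_zero]) N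
    rwa [hN] at h4
  have h5 := apply_matrixCoeff ρ φ v f
  rw [sub_eq_zero.mp he, Algebra.algebraMap_eq_smul_one, map_smul, hf, smul_zero] at h5
  exact h5.symm

end Invariants

end SuperCommHopfAlgebra

/-! ### Finitely generated super-commutative Hopf algebras -/

namespace SuperCommHopfAlgebra

section FinitelyGenerated

variable {k : Type u} [Field k] {A : Type v} [Ring A] [Algebra k A] [Coalgebra k A]
  (𝒜 : ZMod 2 → Submodule k A) [GradedAlgebra 𝒜] [SuperCommHopfAlgebra k 𝒜]

/-- The odd ideal is generated by the odd parts of a generating set. -/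
theorem oddIdeal_le_of_adjoin_eq_top {E : Submodule k A} (hE : Algebra.adjoin k (E : Set A) = ⊤)
    {J : Ideal A} (hJ : ∀ e ∈ E, oddPart 𝒜 e ∈ J) : oddIdeal 𝒜 ≤ J := by
  have h (a : A) : oddPart 𝒜 a ∈ J := by
    have ha : a ∈ Algebra.adjoin k (E : Set A) := hE ▸ Algebra.mem_top
    induction ha using Algebra.adjoin_induction with
    | mem x hx => exact hJ x hx
    | algebraMap r =>
      rw [Algebra.algebraMap_eq_smul_one, map_smul, oddPart_of_even (one_mem_even 𝒜), smul_zero]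
      exact J.zero_mem
    | add x y _ _ hx hy => rw [map_add]; exact J.add_mem hx hy
    | mul x y _ _ hx hy =>
      rw [oddPart_mul, ← even_mul_comm (k := k) (𝒜 := 𝒜) _ (evenPart_mem 𝒜 y)]
      exact J.add_mem (J.mul_mem_left _ hy) (J.mul_mem_left _ hx)
  refine Ideal.span_le.mpr fun a ha => ?_
  rw [SetLike.mem_coe, ← oddPart_of_odd ha]
  exact h a

omit [Coalgebra k A] [GradedAlgebra 𝒜] [SuperCommHopfAlgebra k 𝒜] in
/-- Powers of an ideal are contained in the powers of the underlying subspace. -/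
theorem mem_restrictScalars_pow {I : Ideal A} [I.IsTwoSided] {n : ℕ} {a : A}
    (ha : a ∈ I ^ (n + 1)) : a ∈ (I.restrictScalars k) ^ (n + 1) := by
  induction n generalizing a with
  | zero => simpa [Submodule.pow_one] using ha
  | succ n ih =>
    rw [Ideal.IsTwoSided.pow_succ] at ha
    rw [pow_succ']
    refine Submodule.mul_induction_on ha (fun x hx y hy => ?_) (fun x y hx hy => ?_)
    · exact Submodule.mul_mem_mul hx (ih hy)
    · exact Submodule.add_mem _ hx hy

/-- In a finitely generated super-commutative Hopf algebra the odd ideal is nilpotent, being a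
finite sum of commuting ideals `A y` with `y² = 0`. -/
theorem exists_oddIdeal_pow_eq_bot (h2 : (2 : k) ≠ 0) {E : Submodule k A} [FiniteDimensional k E]
    (hE : Algebra.adjoin k (E : Set A) = ⊤) : ∃ N : ℕ, oddIdeal 𝒜 ^ N = ⊥ := by
  obtain ⟨Y, hY⟩ := (Module.Finite.iff_fg.mp ‹FiniteDimensional k E›).map (oddPart 𝒜)
  have hodd : ∀ y ∈ Y, y ∈ 𝒜 1 := by
    intro y hy
    obtain ⟨e, -, rfl⟩ := hY.le (Submodule.subset_span hy)
    exact oddPart_mem 𝒜 e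
  have hTT : (⊤ : Submodule k A) * ⊤ = ⊤ := by
    refine top_le_iff.mp fun a _ => ?_
    rw [← mul_one a]
    exact Submodule.mul_mem_mul Submodule.mem_top Submodule.mem_top
  have hT : ∀ y ∈ Y, Commute (⊤ : Submodule k A) (Submodule.span k {y}) := by
    intro y hy
    refine le_antisymm (Submodule.mul_le.mpr fun a _ z hz => ?_)
      (Submodule.mul_le.mpr fun z hz a _ => ?_)
    · obtain ⟨c, rfl⟩ := Submodule.mem_span_singleton.mp hz
      rw [mul_smul_comm, ← odd_mul_parity 𝒜 (hodd y hy), ← smul_mul_assoc]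
      exact Submodule.mul_mem_mul hz Submodule.mem_top
    · obtain ⟨c, rfl⟩ := Submodule.mem_span_singleton.mp hz
      rw [smul_mul_assoc, ← parity_parity 𝒜 a, odd_mul_parity 𝒜 (hodd y hy), ← mul_smul_comm]
      exact Submodule.mul_mem_mul Submodule.mem_top hz
  have hYY : ∀ y ∈ Y, ∀ z ∈ Y, Commute (Submodule.span k {y}) (Submodule.span k {z}) := by
    intro y hy z hz
    rw [commute_iff_eq, Submodule.span_mul_span, Submodule.span_mul_span,
      Set.singleton_mul_singleton, Set.singleton_mul_singleton,
      odd_mul_odd (k := k) (𝒜 := 𝒜) y (hodd y hy) z (hodd z hz), ← Set.neg_singleton,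
      Submodule.span_neg]
  have hnil : IsNilpotent (∑ y ∈ Y, ⊤ * Submodule.span k {y}) := by
    refine Commute.isNilpotent_sum (fun y hy => ⟨2, ?_⟩) fun y z hy hz => ?_
    · rw [(hT y hy).mul_pow, pow_two (Submodule.span k {y}), Submodule.span_mul_span,
        Set.singleton_mul_singleton, odd_mul_self h2 (hodd y hy), Submodule.span_zero_singleton]
      simp
    · exact ((Commute.refl _).mul_left (hT y hy).symm).mul_right
        ((hT z hz).mul_left (hYY y hy z hz))
  obtain ⟨N, hN⟩ := hnil
  have hle : (oddIdeal 𝒜).restrictScalars k ≤ ∑ y ∈ Y, ⊤ * Submodule.span k {y} := by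
    have h1 : oddIdeal 𝒜 ≤ Ideal.span (Y : Set A) := by
      refine oddIdeal_le_of_adjoin_eq_top 𝒜 hE fun e he => ?_
      have h : oddPart 𝒜 e ∈ Submodule.span k (Y : Set A) := hY.ge ⟨e, he, rfl⟩
      exact Submodule.span_le_restrictScalars k A (Y : Set A) h
    have hstab : ⊤ * ∑ y ∈ Y, ⊤ * Submodule.span k {y} = ∑ y ∈ Y, ⊤ * Submodule.span k {y} := by
      rw [Finset.mul_sum]
      exact Finset.sum_congr rfl fun y _ => by rw [← mul_assoc, hTT]
    intro a ha
    have h3 := h1 ha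
    clear ha
    induction h3 using Submodule.span_induction with
    | mem y hy =>
      have h4 : ⊤ * Submodule.span k {y} ≤ ∑ y ∈ Y, ⊤ * Submodule.span k {y} :=
        Finset.single_le_sum_of_canonicallyOrdered (f := fun y => ⊤ * Submodule.span k {y}) hy
      have h5 : (1 : A) * y ∈ ⊤ * Submodule.span k {y} :=
        Submodule.mul_mem_mul Submodule.mem_top (Submodule.mem_span_singleton_self y)
      rw [one_mul] at h5
      exact h4 h5
    | zero => exact Submodule.zero_mem _
    | add x y _ _ hx hy => exact Submodule.add_mem _ hx hy
    | smul c x _ hx =>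
      rw [← hstab]
      exact Submodule.mul_mem_mul Submodule.mem_top hx
  refine ⟨N + 1, (Submodule.eq_bot_iff _).mpr fun a ha => ?_⟩
  have h := pow_le_pow_left' hle (N + 1) (mem_restrictScalars_pow (k := k) ha)
  rw [pow_succ, hN] at h
  simpa using h

/-- An odd derivation at the counit is determined by its values on generators. -/
theorem finiteDimensional_range_of_isOddDerivation {M : Type*} [AddCommGroup M] [Module k M]
    {δ : A →ₗ[k] M} (hδ : IsOddDerivation 𝒜 δ) {E : Submodule k A} [FiniteDimensional k E]
    (hE : Algebra.adjoin k (E : Set A) = ⊤) : FiniteDimensional k (LinearMap.range δ) := by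
  have : LinearMap.range δ ≤ E.map δ := by
    rintro _ ⟨a, rfl⟩
    have ha : a ∈ Algebra.adjoin k (E : Set A) := hE ▸ Algebra.mem_top
    induction ha using Algebra.adjoin_induction with
    | mem x hx => exact ⟨x, hx, rfl⟩
    | algebraMap r =>
      rw [Algebra.algebraMap_eq_smul_one, map_smul, hδ.map_one, smul_zero]
      exact Submodule.zero_mem _
    | add x y _ _ hx hy => rw [map_add]; exact Submodule.add_mem _ hx hy
    | mul x y _ _ hx hy =>
      rw [hδ.leibniz]
      exact Submodule.add_mem _ (Submodule.smul_mem _ _ hx) (Submodule.smul_mem _ _ hy)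
  exact Submodule.finiteDimensional_of_le this

end FinitelyGenerated

end SuperCommHopfAlgebra

/-! ### Hopf subalgebras -/

namespace SuperCommHopfAlgebra

section TensorSquare

variable {k : Type u} [Field k] {A : Type v} [Ring A] [Algebra k A]
  (𝒜 : ZMod 2 → Submodule k A) [GradedAlgebra 𝒜]

/-- The projection of `A ⊗ A` onto its component of total degree `i`. -/
def tensorSqProj (i : ZMod 2) : A ⊗[k] A →ₗ[k] A ⊗[k] A :=
  ∑ j, TensorProduct.map (GradedAlgebra.proj 𝒜 j) (GradedAlgebra.proj 𝒜 (i - j))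

theorem tensorSqProj_mem (i : ZMod 2) (t : A ⊗[k] A) : tensorSqProj 𝒜 i t ∈ superTensorSq 𝒜 i := by
  rw [tensorSqProj, LinearMap.sum_apply]
  refine Submodule.sum_mem _ fun j _ => Submodule.mem_iSup_of_mem j ?_
  induction t using TensorProduct.induction_on with
  | zero => simp
  | add x y hx hy => rw [map_add]; exact Submodule.add_mem _ hx hy
  | tmul a b =>
    exact ⟨(DirectSum.decompose 𝒜 a j) ⊗ₜ (DirectSum.decompose 𝒜 b (i - j)), rfl⟩

theorem tensorSqProj_eq {i : ZMod 2} {t : A ⊗[k] A} (ht : t ∈ superTensorSq 𝒜 i) :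
    tensorSqProj 𝒜 i t = t := by
  have h : superTensorSq 𝒜 i ≤ LinearMap.ker (tensorSqProj 𝒜 i - LinearMap.id) := by
    refine iSup_le fun j => ?_
    rw [LinearMap.range_le_ker_iff]
    ext ⟨p, hp⟩ ⟨q, hq⟩
    have h1 : tensorSqProj 𝒜 i (p ⊗ₜ q) = p ⊗ₜ q := by
      rw [tensorSqProj, LinearMap.sum_apply, Finset.sum_eq_single j]
      · rw [TensorProduct.map_tmul, GradedAlgebra.proj_apply, GradedAlgebra.proj_apply,
          DirectSum.decompose_of_mem_same 𝒜 hp, DirectSum.decompose_of_mem_same 𝒜 hq]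
      · intro l _ hl
        rw [TensorProduct.map_tmul, GradedAlgebra.proj_apply,
          DirectSum.decompose_of_mem_ne 𝒜 hp hl.symm, TensorProduct.zero_tmul]
      · simp
    simpa [sub_eq_zero] using h1
  simpa [sub_eq_zero] using h ht

end TensorSquare

variable {k : Type u} [Field k] {A : Type v} [Ring A] [Algebra k A] [Coalgebra k A]
  (𝒜 : ZMod 2 → Submodule k A) [GradedAlgebra 𝒜] [SuperCommHopfAlgebra k 𝒜]

/-- A subalgebra of a super-commutative Hopf algebra which is stable under all structure maps. -/
structure HopfSubalgebra extends Subalgebra k A where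
  evenPart_mem' : ∀ b ∈ toSubalgebra, evenPart 𝒜 b ∈ toSubalgebra
  antipode_mem' : ∀ b ∈ toSubalgebra, antipode (k := k) 𝒜 b ∈ toSubalgebra
  comul_mem' : ∀ b ∈ toSubalgebra, Coalgebra.comul (R := k) b ∈
    LinearMap.range (TensorProduct.map toSubalgebra.val.toLinearMap toSubalgebra.val.toLinearMap)

namespace HopfSubalgebra

variable {𝒜} (B : HopfSubalgebra 𝒜)

/-- The inclusion `B → A`. -/
abbrev incl : B.toSubalgebra →ₗ[k] A := B.toSubalgebra.val.toLinearMap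

theorem incl_injective : Function.Injective B.incl := Subtype.val_injective

/-- The inclusion `B ⊗ B → A ⊗ A`. -/
abbrev inclSq : B.toSubalgebra ⊗[k] B.toSubalgebra →ₗ[k] A ⊗[k] A :=
  TensorProduct.map B.incl B.incl

theorem inclSq_injective : Function.Injective B.inclSq :=
  TensorProduct.map_injective_of_flat_flat _ _ B.incl_injective B.incl_injective

/-- The coproduct of `B`. -/
protected def comul : B.toSubalgebra →ₗ[k] B.toSubalgebra ⊗[k] B.toSubalgebra :=
  (LinearEquiv.ofInjective B.inclSq B.inclSq_injective).symm.toLinearMap ∘ₗ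
    (Coalgebra.comul ∘ₗ B.incl).codRestrict _ fun b => B.comul_mem' b b.2

theorem inclSq_comul (b : B.toSubalgebra) :
    B.inclSq (B.comul b) = Coalgebra.comul (R := k) (b : A) :=
  congrArg Subtype.val ((LinearEquiv.ofInjective B.inclSq B.inclSq_injective).apply_symm_apply
    ((Coalgebra.comul ∘ₗ B.incl).codRestrict _ (fun b => B.comul_mem' b b.2) b))

theorem inclSq_comp_comul : B.inclSq ∘ₗ B.comul = Coalgebra.comul ∘ₗ B.incl :=
  LinearMap.ext B.inclSq_comul

instance : Coalgebra k B.toSubalgebra where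
  comul := B.comul
  counit := Coalgebra.counit ∘ₗ B.incl
  coassoc := by
    ext b
    refine TensorProduct.map_injective_of_flat_flat B.incl B.inclSq B.incl_injective
      B.inclSq_injective ?_
    have h1 : ∀ t, TensorProduct.map B.incl B.inclSq (TensorProduct.assoc k _ _ _ t) =
        TensorProduct.assoc k A A A (TensorProduct.map B.inclSq B.incl t) := by
      intro t
      refine LinearMap.congr_fun (f := TensorProduct.map B.incl B.inclSq ∘ₗ
        (TensorProduct.assoc k _ _ _).toLinearMap)
        (g := (TensorProduct.assoc k A A A).toLinearMap ∘ₗ TensorProduct.map B.inclSq B.incl) ?_ t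
      ext
      rfl
    have h2 : TensorProduct.map B.inclSq B.incl ∘ₗ B.comul.rTensor B.toSubalgebra =
        (Coalgebra.comul (R := k)).rTensor A ∘ₗ B.inclSq := by
      rw [LinearMap.map_comp_rTensor, LinearMap.rTensor_comp_map, inclSq_comp_comul]
    have h3 : TensorProduct.map B.incl B.inclSq ∘ₗ B.comul.lTensor B.toSubalgebra =
        (Coalgebra.comul (R := k)).lTensor A ∘ₗ B.inclSq := by
      rw [LinearMap.map_comp_lTensor, LinearMap.lTensor_comp_map, inclSq_comp_comul]
    refine (h1 _).trans ?_
    refine (congrArg _ (LinearMap.congr_fun h2 (B.comul b))).trans ?_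
    refine Eq.trans ?_ (LinearMap.congr_fun h3 (B.comul b)).symm
    rw [LinearMap.comp_apply, LinearMap.comp_apply, inclSq_comul]
    exact Coalgebra.coassoc_apply _
  rTensor_counit_comp_comul := by
    ext b
    refine TensorProduct.map_injective_of_flat_flat LinearMap.id B.incl Function.injective_id
      B.incl_injective ?_
    have h : TensorProduct.map LinearMap.id B.incl ∘ₗ
        (Coalgebra.counit ∘ₗ B.incl).rTensor B.toSubalgebra =
        (Coalgebra.counit (R := k)).rTensor A ∘ₗ B.inclSq := by
      rw [LinearMap.map_comp_rTensor, LinearMap.rTensor_comp_map, LinearMap.id_comp]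
    refine (LinearMap.congr_fun h (B.comul b)).trans ?_
    rw [LinearMap.comp_apply, inclSq_comul]
    exact Coalgebra.rTensor_counit_comul _
  lTensor_counit_comp_comul := by
    ext b
    refine TensorProduct.map_injective_of_flat_flat B.incl LinearMap.id B.incl_injective
      Function.injective_id ?_
    have h : TensorProduct.map B.incl LinearMap.id ∘ₗ
        (Coalgebra.counit ∘ₗ B.incl).lTensor B.toSubalgebra =
        (Coalgebra.counit (R := k)).lTensor A ∘ₗ B.inclSq := by
      rw [LinearMap.map_comp_lTensor, LinearMap.lTensor_comp_map, LinearMap.id_comp]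
    refine (LinearMap.congr_fun h (B.comul b)).trans ?_
    rw [LinearMap.comp_apply, inclSq_comul]
    exact Coalgebra.lTensor_counit_comul _

theorem inclSq_coalgebra_comul (b : B.toSubalgebra) :
    B.inclSq (Coalgebra.comul (R := k) b) = Coalgebra.comul (R := k) (b : A) := B.inclSq_comul b

/-- The grading of `B`. -/
def gr (i : ZMod 2) : Submodule k B.toSubalgebra := (𝒜 i).comap B.incl

theorem mem_gr {i : ZMod 2} {b : B.toSubalgebra} : b ∈ B.gr i ↔ (b : A) ∈ 𝒜 i := Iff.rfl

theorem oddPart_mem' {b : A} (hb : b ∈ B.toSubalgebra) : oddPart 𝒜 b ∈ B.toSubalgebra := by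
  have h := evenPart_add_oddPart 𝒜 b
  rw [← eq_sub_iff_add_eq'] at h
  rw [h]
  exact sub_mem hb (B.evenPart_mem' b hb)

/-- The projection of `B` onto its even part. -/
def evenProj : B.toSubalgebra →ₗ[k] B.gr 0 :=
  ((evenPart 𝒜 ∘ₗ B.incl).codRestrict (Subalgebra.toSubmodule B.toSubalgebra)
    fun b => B.evenPart_mem' b b.2).codRestrict (B.gr 0) fun b => evenPart_mem 𝒜 (b : A)

/-- The projection of `B` onto its odd part. -/
def oddProj : B.toSubalgebra →ₗ[k] B.gr 1 :=
  ((oddPart 𝒜 ∘ₗ B.incl).codRestrict (Subalgebra.toSubmodule B.toSubalgebra)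
    fun b => B.oddPart_mem' b.2).codRestrict (B.gr 1) fun b => oddPart_mem 𝒜 (b : A)

instance : SetLike.GradedMonoid B.gr where
  one_mem := one_mem_even 𝒜
  mul_mem _ _ _ _ ha hb := SetLike.mul_mem_graded (A := 𝒜) ha hb

instance : DirectSum.Decomposition B.gr :=
  DirectSum.Decomposition.ofLinearMap B.gr
    (DirectSum.lof k _ (fun i => B.gr i) 0 ∘ₗ B.evenProj +
      DirectSum.lof k _ (fun i => B.gr i) 1 ∘ₗ B.oddProj)
    (by
      ext b
      have h : ((B.evenProj b : B.toSubalgebra) : A) + ((B.oddProj b : B.toSubalgebra) : A) = b :=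
        evenPart_add_oddPart 𝒜 (b : A)
      simpa using h)
    (by
      ext i ⟨b, hb⟩ : 2
      obtain rfl | rfl : i = 0 ∨ i = 1 := by clear * -; revert i; decide
      · have h0 : B.evenProj b = ⟨b, hb⟩ := Subtype.ext (Subtype.ext (evenPart_of_even hb))
        have h1 : B.oddProj b = 0 := Subtype.ext (Subtype.ext (oddPart_of_even hb))
        simp [h0, h1]
      · have h0 : B.evenProj b = 0 := Subtype.ext (Subtype.ext (evenPart_of_odd hb))
        have h1 : B.oddProj b = ⟨b, hb⟩ := Subtype.ext (Subtype.ext (oddPart_of_odd hb))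
        simp [h0, h1])

instance : GradedAlgebra B.gr where

theorem coe_evenPart (b : B.toSubalgebra) : (evenPart B.gr b : A) = evenPart 𝒜 (b : A) := by
  obtain ⟨x, hx, y, hy, rfl⟩ := exists_even_add_odd B.gr b
  rw [map_add, evenPart_of_even hx, evenPart_of_odd hy, Subalgebra.coe_add, Subalgebra.coe_add,
    map_add, evenPart_of_even (B.mem_gr.mp hx), evenPart_of_odd (B.mem_gr.mp hy),
    Subalgebra.coe_zero]

theorem coe_oddPart (b : B.toSubalgebra) : (oddPart B.gr b : A) = oddPart 𝒜 (b : A) := by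
  obtain ⟨x, hx, y, hy, rfl⟩ := exists_even_add_odd B.gr b
  rw [map_add, oddPart_of_even hx, oddPart_of_odd hy, Subalgebra.coe_add, Subalgebra.coe_add,
    map_add, oddPart_of_even (B.mem_gr.mp hx), oddPart_of_odd (B.mem_gr.mp hy), Subalgebra.coe_zero]

theorem coe_parity (b : B.toSubalgebra) : (parity B.gr b : A) = parity 𝒜 (b : A) := by
  rw [parity_apply, parity_apply, Subalgebra.coe_sub, coe_evenPart, coe_oddPart]

theorem inclSq_of_symm_mul (t s : B.toSubalgebra ⊗[k] B.toSubalgebra) :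
    B.inclSq ((GradedTensorProduct.of k B.gr B.gr).symm
      (GradedTensorProduct.of k B.gr B.gr t * GradedTensorProduct.of k B.gr B.gr s)) =
    (GradedTensorProduct.of k 𝒜 𝒜).symm
      (GradedTensorProduct.of k 𝒜 𝒜 (B.inclSq t) * GradedTensorProduct.of k 𝒜 𝒜 (B.inclSq s)) := by
  induction t using TensorProduct.induction_on with
  | zero => simp
  | add x y hx hy => simp only [map_add, add_mul, hx, hy]
  | tmul a b =>
    induction s using TensorProduct.induction_on with
    | zero => simp
    | add x y hx hy => simp only [map_add, mul_add, hx, hy]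
    | tmul c d =>
      rw [of_tmul_mul_of_tmul, TensorProduct.map_tmul, TensorProduct.map_tmul, of_tmul_mul_of_tmul,
        GradedTensorProduct.of_symm_of, GradedTensorProduct.of_symm_of]
      simp [coe_evenPart, coe_oddPart, coe_parity]

theorem inclSq_tensorSqProj (i : ZMod 2) (t : B.toSubalgebra ⊗[k] B.toSubalgebra) :
    B.inclSq (tensorSqProj B.gr i t) = tensorSqProj 𝒜 i (B.inclSq t) := by
  have h (j : ZMod 2) (b : B.toSubalgebra) :
      (GradedAlgebra.proj B.gr j b : A) = GradedAlgebra.proj 𝒜 j (b : A) := by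
    obtain rfl | rfl : j = 0 ∨ j = 1 := by clear * -; revert j; decide
    · exact B.coe_evenPart b
    · exact B.coe_oddPart b
  induction t using TensorProduct.induction_on with
  | zero => simp
  | add x y hx hy => simp only [map_add, hx, hy]
  | tmul a b =>
    simp only [tensorSqProj, LinearMap.sum_apply, map_sum, TensorProduct.map_tmul,
      AlgHom.toLinearMap_apply, Subalgebra.coe_val, h]

/-- The antipode of `B`. -/
protected def antipode : B.toSubalgebra →ₗ[k] B.toSubalgebra :=
  (SuperCommHopfAlgebra.antipode 𝒜 ∘ₗ B.incl).codRestrict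
    (Subalgebra.toSubmodule B.toSubalgebra) fun b => B.antipode_mem' b b.2

theorem coe_antipode (b : B.toSubalgebra) :
    (B.antipode b : A) = SuperCommHopfAlgebra.antipode (k := k) 𝒜 (b : A) := rfl

instance : SuperCommHopfAlgebra k B.gr where
  even_mul_comm a ha b := Subtype.ext (even_mul_comm (k := k) (𝒜 := 𝒜) (a : A) ha b)
  odd_mul_odd a ha b hb := Subtype.ext (odd_mul_odd (k := k) (𝒜 := 𝒜) (a : A) ha b hb)
  counit_one := SuperCommHopfAlgebra.counit_one (k := k) (A := A) (𝒜 := 𝒜)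
  counit_mul a b := counit_mul (k := k) (𝒜 := 𝒜) (a : A) b
  counit_odd a ha := counit_odd (k := k) (𝒜 := 𝒜) (a : A) ha
  comul_one := B.inclSq_injective <| by
    rw [inclSq_coalgebra_comul]
    exact comul_one (k := k) (𝒜 := 𝒜)
  comul_mul a b := by
    apply (GradedTensorProduct.of k B.gr B.gr).symm.injective
    rw [GradedTensorProduct.of_symm_of]
    apply B.inclSq_injective
    rw [inclSq_of_symm_mul, inclSq_coalgebra_comul, inclSq_coalgebra_comul,
      inclSq_coalgebra_comul, ← comul_mul (k := k) (𝒜 := 𝒜) (a : A) b,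
      GradedTensorProduct.of_symm_of]
    rfl
  comul_graded i a ha := by
    have h : tensorSqProj B.gr i (Coalgebra.comul (R := k) a) = Coalgebra.comul (R := k) a := by
      apply B.inclSq_injective
      rw [inclSq_tensorSqProj, inclSq_coalgebra_comul]
      exact tensorSqProj_eq 𝒜 (comul_graded (k := k) (𝒜 := 𝒜) i (a : A) ha)
    rw [← h]
    exact tensorSqProj_mem B.gr i _
  antipode := B.antipode
  antipode_graded i a ha := antipode_graded (k := k) (𝒜 := 𝒜) i (a : A) ha
  mul_antipode_rTensor_comul a := by
    refine Subtype.ext ?_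
    refine Eq.trans ?_ (mul_antipode_rTensor_comul (k := k) (𝒜 := 𝒜) (a : A))
    rw [← inclSq_coalgebra_comul]
    generalize Coalgebra.comul (R := k) a = t
    induction t using TensorProduct.induction_on with
    | zero => simp
    | add x y hx hy => simp only [map_add, Subalgebra.coe_add, hx, hy]
    | tmul x y => simp [coe_antipode]
  mul_antipode_lTensor_comul a := by
    refine Subtype.ext ?_
    refine Eq.trans ?_ (mul_antipode_lTensor_comul (k := k) (𝒜 := 𝒜) (a : A))
    rw [← inclSq_coalgebra_comul]
    generalize Coalgebra.comul (R := k) a = t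
    induction t using TensorProduct.induction_on with
    | zero => simp
    | add x y hx hy => simp only [map_add, Subalgebra.coe_add, hx, hy]
    | tmul x y => simp [coe_antipode]

end HopfSubalgebra

end SuperCommHopfAlgebra

/-! ### Local finiteness -/

section Subcoalgebra

/-- The subspace `D ⊗ D` of `C ⊗ C`. -/
def tensorSq {k C : Type*} [Field k] [AddCommGroup C] [Module k C] (D : Submodule k C) :
    Submodule k (C ⊗[k] C) :=
  LinearMap.range (TensorProduct.map D.subtype D.subtype)

variable {k : Type*} [Field k] {C : Type*} [AddCommGroup C] [Module k C]

theorem tmul_mem_tensorSq {D : Submodule k C} {a b : C} (ha : a ∈ D) (hb : b ∈ D) :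
    a ⊗ₜ[k] b ∈ tensorSq D := ⟨⟨a, ha⟩ ⊗ₜ ⟨b, hb⟩, rfl⟩

theorem tensorSq_le {D : Submodule k C} {P : Submodule k (C ⊗[k] C)}
    (h : ∀ a ∈ D, ∀ b ∈ D, a ⊗ₜ[k] b ∈ P) : tensorSq D ≤ P := by
  rintro _ ⟨t, rfl⟩
  induction t using TensorProduct.induction_on with
  | zero => simp
  | add x y hx hy => rw [map_add]; exact P.add_mem hx hy
  | tmul a b => exact h a a.2 b b.2

theorem tensorSq_mono {D D' : Submodule k C} (h : D ≤ D') : tensorSq D ≤ tensorSq D' :=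
  tensorSq_le fun _ ha _ hb => tmul_mem_tensorSq (h ha) (h hb)

/-- `D` is a subcoalgebra: `Δ(D) ⊆ D ⊗ D`. -/
def IsSubcoalgebra [Coalgebra k C] (D : Submodule k C) : Prop :=
  ∀ d ∈ D, Coalgebra.comul (R := k) d ∈ tensorSq D

variable [Coalgebra k C]

theorem IsSubcoalgebra.sup {D D' : Submodule k C} (h : IsSubcoalgebra D) (h' : IsSubcoalgebra D') :
    IsSubcoalgebra (D ⊔ D') := by
  intro d hd
  obtain ⟨x, hx, y, hy, rfl⟩ := Submodule.mem_sup.mp hd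
  rw [map_add]
  exact Submodule.add_mem _ (tensorSq_mono le_sup_left (h x hx))
    (tensorSq_mono le_sup_right (h' y hy))

/-- The matrix coefficients of a finite-dimensional comodule span a subcoalgebra. -/
theorem RightComodule.exists_isSubcoalgebra {V : Type*} [AddCommGroup V] [Module k V]
    [FiniteDimensional k V] (ρ : RightComodule k C V) :
    ∃ D : Submodule k C, FiniteDimensional k D ∧ IsSubcoalgebra D ∧
      ∀ v, ρ.coact v ∈ LinearMap.range (D.subtype.lTensor V) := by
  let b := Module.finBasis k V
  have hb : ∀ t : V ⊗[k] C, t = ∑ i, b i ⊗ₜ TensorProduct.lid k C ((b.coord i).rTensor C t) := by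
    intro t
    induction t using TensorProduct.induction_on with
    | zero => simp
    | add x y hx hy =>
      conv_lhs => rw [hx, hy]
      simp only [map_add, TensorProduct.tmul_add, Finset.sum_add_distrib]
    | tmul v c =>
      conv_lhs => rw [← b.sum_repr v, TensorProduct.sum_tmul]
      simp [TensorProduct.tmul_smul, TensorProduct.smul_tmul']
  let c (i j : Fin (Module.finrank k V)) : C :=
    TensorProduct.lid k C ((b.coord i).rTensor C (ρ.coact (b j)))
  have hc (j) : ρ.coact (b j) = ∑ i, b i ⊗ₜ c i j := hb _
  have hΔ (i j) : Coalgebra.comul (R := k) (c i j) = ∑ l, c i l ⊗ₜ[k] c l j := by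
    have h1 : ∀ t : V ⊗[k] C,
        Coalgebra.comul (R := k) (TensorProduct.lid k C ((b.coord i).rTensor C t)) =
        TensorProduct.lid k (C ⊗[k] C) ((b.coord i).rTensor (C ⊗[k] C)
          ((Coalgebra.comul (R := k)).lTensor V t)) := by
      intro t
      induction t using TensorProduct.induction_on with
      | zero => simp
      | add x y hx hy => simp only [map_add, hx, hy]
      | tmul v c => simp
    have h2 : ∀ (t : V ⊗[k] C) (d : C), TensorProduct.lid k (C ⊗[k] C)
        ((b.coord i).rTensor (C ⊗[k] C) (TensorProduct.assoc k V C C (t ⊗ₜ d))) =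
        TensorProduct.lid k C ((b.coord i).rTensor C t) ⊗ₜ d := by
      intro t d
      induction t using TensorProduct.induction_on with
      | zero => simp
      | add x y hx hy => simp only [map_add, TensorProduct.add_tmul, hx, hy]
      | tmul v c => simp [TensorProduct.smul_tmul']
    rw [h1, ← ρ.coassoc, hc, map_sum, map_sum, map_sum, map_sum]
    exact Finset.sum_congr rfl fun l _ => by rw [LinearMap.rTensor_tmul, h2]
  have hcD (i j) : c i j ∈ Submodule.span k (Set.range fun p : _ × _ => c p.1 p.2) :=
    Submodule.subset_span ⟨(i, j), rfl⟩
  refine ⟨Submodule.span k (Set.range fun p : _ × _ => c p.1 p.2),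
    FiniteDimensional.span_of_finite k (Set.finite_range _), ?_, fun v => ?_⟩
  · intro d hd
    induction hd using Submodule.span_induction with
    | mem x hx =>
      obtain ⟨⟨i, j⟩, rfl⟩ := hx
      rw [hΔ]
      exact Submodule.sum_mem _ fun l _ => tmul_mem_tensorSq (hcD i l) (hcD l j)
    | zero => simp
    | add x y _ _ hx hy => rw [map_add]; exact Submodule.add_mem _ hx hy
    | smul r x _ hx => rw [map_smul]; exact Submodule.smul_mem _ _ hx
  · rw [← b.sum_repr v, map_sum]
    refine Submodule.sum_mem _ fun j _ => ?_
    rw [map_smul, hc]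
    exact Submodule.smul_mem _ _ (Submodule.sum_mem _ fun i _ => ⟨b i ⊗ₜ ⟨c i j, hcD i j⟩, rfl⟩)

/-- The fundamental theorem of coalgebras. -/
theorem exists_isSubcoalgebra_mem (c : C) :
    ∃ D : Submodule k C, FiniteDimensional k D ∧ IsSubcoalgebra D ∧ c ∈ D := by
  let ρ := RightComodule.regular k C
  have hW := ρ.isSubcomodule_cyclic c
  obtain ⟨D, hD, hD', hρ⟩ := (ρ.restrict hW).exists_isSubcoalgebra
  refine ⟨D, hD, hD', ?_⟩
  obtain ⟨t, ht⟩ := hρ ⟨c, ρ.mem_cyclic_self c⟩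
  have h1 : (ρ.cyclic c).subtype.rTensor C (D.subtype.lTensor _ t) =
      Coalgebra.comul (R := k) c := by
    rw [ht]
    exact ρ.rTensor_restrictCoact hW _
  have h2 : c = TensorProduct.lid k C ((Coalgebra.counit (R := k)).rTensor C
      ((ρ.cyclic c).subtype.rTensor C (D.subtype.lTensor _ t))) := by
    rw [h1, Coalgebra.rTensor_counit_comul]
    simp
  rw [h2]
  clear ht h1 h2
  induction t using TensorProduct.induction_on with
  | zero => simp
  | add x y hx hy => simp only [map_add]; exact D.add_mem hx hy
  | tmul w d => simpa using D.smul_mem _ d.2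

theorem exists_isSubcoalgebra_subset (F : Finset C) :
    ∃ D : Submodule k C, FiniteDimensional k D ∧ IsSubcoalgebra D ∧ (F : Set C) ⊆ D := by
  classical
  induction F using Finset.induction_on with
  | empty => exact ⟨⊥, inferInstance, by simp [IsSubcoalgebra], by simp⟩
  | insert c F _ ih =>
    obtain ⟨D, _, hD, hF⟩ := ih
    obtain ⟨D', _, hD', hc⟩ := exists_isSubcoalgebra_mem (k := k) c
    refine ⟨D' ⊔ D, inferInstance, hD'.sup hD, ?_⟩
    rw [Finset.coe_insert, Set.insert_subset_iff]
    exact ⟨Submodule.mem_sup_left hc, hF.trans (le_sup_right (a := D'))⟩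

end Subcoalgebra

namespace SuperCommHopfAlgebra

variable {k : Type u} [Field k] {A : Type v} [Ring A] [Algebra k A] [Coalgebra k A]
  (𝒜 : ZMod 2 → Submodule k A) [GradedAlgebra 𝒜] [SuperCommHopfAlgebra k 𝒜]

omit [Coalgebra k A] [SuperCommHopfAlgebra k 𝒜] in
theorem evenPart_mem_of_parity_mem (h2 : (2 : k) ≠ 0) {W : Submodule k A} {a : A} (ha : a ∈ W)
    (ha' : parity 𝒜 a ∈ W) : evenPart 𝒜 a ∈ W := by
  have h : evenPart 𝒜 a = (2 : k)⁻¹ • (a + parity 𝒜 a) := by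
    rw [parity_apply]
    conv_rhs => rw [← evenPart_add_oddPart 𝒜 a]
    simp only [map_add, evenPart_of_even (evenPart_mem 𝒜 a), evenPart_of_odd (oddPart_mem 𝒜 a),
      oddPart_of_odd (oddPart_mem 𝒜 a), oddPart_of_even (evenPart_mem 𝒜 a)]
    rw [eq_inv_smul_iff₀ h2, two_smul]
    abel
  rw [h]
  exact W.smul_mem _ (W.add_mem ha ha')

theorem isSubcoalgebra_map_parity {D : Submodule k A} (hD : IsSubcoalgebra D) :
    IsSubcoalgebra (D.map (parity 𝒜).toLinearMap) := by
  rintro _ ⟨d, hd, rfl⟩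
  rw [AlgHom.toLinearMap_apply, comul_parity]
  have h : tensorSq D ≤ (tensorSq (D.map (parity 𝒜).toLinearMap)).comap
      (TensorProduct.map (parity 𝒜).toLinearMap (parity 𝒜).toLinearMap) :=
    tensorSq_le fun a ha b hb => tmul_mem_tensorSq ⟨a, ha, rfl⟩ ⟨b, hb, rfl⟩
  exact h (hD d hd)

theorem isSubcoalgebra_map_antipode {D : Submodule k A} (hD : IsSubcoalgebra D)
    (h2 : (2 : k) ≠ 0) (hσ : ∀ d ∈ D, parity 𝒜 d ∈ D) :
    IsSubcoalgebra (D.map (antipode 𝒜)) := by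
  have he (d) (hd : d ∈ D) : evenPart 𝒜 d ∈ D := evenPart_mem_of_parity_mem 𝒜 h2 hd (hσ d hd)
  have ho (d) (hd : d ∈ D) : oddPart 𝒜 d ∈ D := by
    rw [← sub_eq_of_eq_add' (evenPart_add_oddPart 𝒜 d).symm]
    exact D.sub_mem hd (he d hd)
  rintro _ ⟨d, hd, rfl⟩
  rw [comul_antipode]
  have h : tensorSq D ≤ (tensorSq (D.map (antipode 𝒜))).comap (antipodeSwap 𝒜) := by
    refine tensorSq_le fun a ha b hb => ?_
    have h1 : antipodeSwap (k := k) 𝒜 (a ⊗ₜ b) =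
        antipode 𝒜 (evenPart 𝒜 b) ⊗ₜ antipode 𝒜 a +
          antipode 𝒜 (oddPart 𝒜 b) ⊗ₜ antipode 𝒜 (parity 𝒜 a) := by
      simp [antipodeSwap, antipode_evenPart, antipode_oddPart, antipode_parity]
    rw [Submodule.mem_comap, h1]
    exact Submodule.add_mem _
      (tmul_mem_tensorSq ⟨_, he b hb, rfl⟩ ⟨a, ha, rfl⟩)
      (tmul_mem_tensorSq ⟨_, ho b hb, rfl⟩ ⟨_, hσ a ha, rfl⟩)
  exact h (hD d hd)

/-- The subalgebra generated by a subcoalgebra which is stable under the parity automorphism and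
the antipode. -/
def HopfSubalgebra.adjoin (h2 : (2 : k) ≠ 0) {E : Submodule k A} (hE : IsSubcoalgebra E)
    (hσ : ∀ e ∈ E, parity 𝒜 e ∈ E) (hS : ∀ e ∈ E, antipode (k := k) 𝒜 e ∈ E) :
    HopfSubalgebra 𝒜 :=
  have hσ' : Algebra.adjoin k (E : Set A) ≤ (Algebra.adjoin k (E : Set A)).comap (parity 𝒜) :=
    Algebra.adjoin_le fun e he => Algebra.subset_adjoin (hσ e he)
  have hS' : Algebra.adjoin k (E : Set A) ≤ (Algebra.adjoin k (E : Set A)).comap (antipodeAlg 𝒜) :=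
    Algebra.adjoin_le fun e he => Algebra.subset_adjoin (hS e he)
  have he (b : A) (hb : b ∈ Algebra.adjoin k (E : Set A)) :
      evenPart 𝒜 b ∈ Algebra.adjoin k (E : Set A) :=
    evenPart_mem_of_parity_mem 𝒜 h2 (W := Subalgebra.toSubmodule _) hb (hσ' hb)
  have ho (b : A) (hb : b ∈ Algebra.adjoin k (E : Set A)) :
      oddPart 𝒜 b ∈ Algebra.adjoin k (E : Set A) := by
    rw [← sub_eq_of_eq_add' (evenPart_add_oddPart 𝒜 b).symm]
    exact sub_mem hb (he b hb)
  { Algebra.adjoin k (E : Set A) with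
    evenPart_mem' := he
    antipode_mem' := fun _ hb => hS' hb
    comul_mem' := by
      intro b hb
      change _ ∈ tensorSq (Subalgebra.toSubmodule (Algebra.adjoin k (E : Set A)))
      induction hb using Algebra.adjoin_induction with
      | mem x hx => exact tensorSq_mono (Algebra.subset_adjoin (R := k)) (hE x hx)
      | algebraMap r =>
        rw [Algebra.algebraMap_eq_smul_one, map_smul, comul_one (k := k) (𝒜 := 𝒜)]
        exact Submodule.smul_mem _ _ (tmul_mem_tensorSq (one_mem (Algebra.adjoin k (E : Set A)))
          (one_mem (Algebra.adjoin k (E : Set A))))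
      | add x y _ _ hx hy => rw [map_add]; exact Submodule.add_mem _ hx hy
      | mul x y _ _ hx hy =>
        rw [← (GradedTensorProduct.of k 𝒜 𝒜).symm_apply_apply (Coalgebra.comul (R := k) (x * y)),
          comul_mul (k := k) (𝒜 := 𝒜)]
        generalize Coalgebra.comul (R := k) x = t at hx ⊢
        generalize Coalgebra.comul (R := k) y = s at hy ⊢
        obtain ⟨t, rfl⟩ := hx
        obtain ⟨s, rfl⟩ := hy
        induction t using TensorProduct.induction_on with
        | zero => simp
        | add x y hx hy => simp only [map_add, add_mul]; exact Submodule.add_mem _ hx hy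
        | tmul a b =>
          induction s using TensorProduct.induction_on with
          | zero => simp
          | add x y hx hy => simp only [map_add, mul_add]; exact Submodule.add_mem _ hx hy
          | tmul c d =>
            rw [TensorProduct.map_tmul, TensorProduct.map_tmul, of_tmul_mul_of_tmul,
              GradedTensorProduct.of_symm_of]
            exact Submodule.add_mem _
              (tmul_mem_tensorSq (Subalgebra.mul_mem _ a.2 (he _ c.2))
                (Subalgebra.mul_mem _ b.2 d.2))
              (tmul_mem_tensorSq (Subalgebra.mul_mem _ a.2 (ho _ c.2))
                (Subalgebra.mul_mem _ (hσ' b.2) d.2)) }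

/-- Every finite subset is contained in a finitely generated Hopf subalgebra. -/
theorem exists_hopfSubalgebra (h2 : (2 : k) ≠ 0) (F : Finset A) :
    ∃ B : HopfSubalgebra 𝒜, (F : Set A) ⊆ B.toSubalgebra ∧
      ∃ E : Submodule k B.toSubalgebra, FiniteDimensional k E ∧
        Algebra.adjoin k (E : Set B.toSubalgebra) = ⊤ := by
  obtain ⟨D, _, hD, hF⟩ := exists_isSubcoalgebra_subset (k := k) F
  let D' := D ⊔ D.map (parity 𝒜).toLinearMap
  have hD' : IsSubcoalgebra D' := hD.sup (isSubcoalgebra_map_parity 𝒜 hD)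
  have hσD : ∀ d ∈ D', parity 𝒜 d ∈ D' := by
    intro d hd
    obtain ⟨x, hx, _, ⟨y, hy, rfl⟩, rfl⟩ := Submodule.mem_sup.mp hd
    rw [AlgHom.toLinearMap_apply, map_add, parity_parity]
    exact D'.add_mem (Submodule.mem_sup_right ⟨x, hx, rfl⟩) (Submodule.mem_sup_left hy)
  let E := D' ⊔ D'.map (antipode 𝒜)
  have hE : IsSubcoalgebra E := hD'.sup (isSubcoalgebra_map_antipode 𝒜 hD' h2 hσD)
  have hσ : ∀ e ∈ E, parity 𝒜 e ∈ E := by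
    intro e he
    obtain ⟨x, hx, _, ⟨y, hy, rfl⟩, rfl⟩ := Submodule.mem_sup.mp he
    rw [map_add, ← antipode_parity]
    exact E.add_mem (Submodule.mem_sup_left (hσD x hx))
      (Submodule.mem_sup_right ⟨_, hσD y hy, rfl⟩)
  have hS : ∀ e ∈ E, antipode (k := k) 𝒜 e ∈ E := by
    intro e he
    obtain ⟨x, hx, _, ⟨y, hy, rfl⟩, rfl⟩ := Submodule.mem_sup.mp he
    rw [map_add, antipode_antipode]
    exact E.add_mem (Submodule.mem_sup_right ⟨x, hx, rfl⟩) (Submodule.mem_sup_left hy)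
  refine ⟨HopfSubalgebra.adjoin 𝒜 h2 hE hσ hS, ?_,
    E.comap (Algebra.adjoin k (E : Set A)).val.toLinearMap, ?_, ?_⟩
  · exact fun a ha => Algebra.subset_adjoin
      (Submodule.mem_sup_left (Submodule.mem_sup_left (hF ha)))
  · refine Module.Finite.of_injective
      ((Algebra.adjoin k (E : Set A)).val.toLinearMap.restrict (q := E) fun x hx => hx) ?_
    rintro ⟨⟨x, _⟩, _⟩ ⟨⟨y, _⟩, _⟩ h
    obtain rfl : x = y := congrArg Subtype.val h
    rfl
  · exact Algebra.adjoin_adjoin_coe_preimage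

end SuperCommHopfAlgebra

/-! ### Unipotency of `A` and of `Ā` -/

namespace RightComodule

variable {k : Type*} [Field k] {C : Type*} [AddCommGroup C] [Module k C] [Coalgebra k C]
  {D : Type*} [AddCommGroup D] [Module k D] [Coalgebra k D]
  {V : Type*} [AddCommGroup V] [Module k V]

omit [Coalgebra k C] [Coalgebra k D] in
theorem assoc_rTensor_lTensor (φ : C →ₗ[k] D) {r : V →ₗ[k] V ⊗[k] C} {s : V →ₗ[k] V ⊗[k] D}
    (h : φ.lTensor V ∘ₗ r = s) (t : V ⊗[k] C) :
    TensorProduct.assoc k V D D (s.rTensor D (φ.lTensor V t)) =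
      (TensorProduct.map φ φ).lTensor V (TensorProduct.assoc k V C C (r.rTensor C t)) := by
  subst h
  induction t using TensorProduct.induction_on with
  | zero => simp
  | add x y hx hy => simp only [map_add, hx, hy]
  | tmul v c =>
    simp only [LinearMap.lTensor_tmul, LinearMap.rTensor_tmul, LinearMap.comp_apply]
    generalize r v = s
    induction s using TensorProduct.induction_on with
    | zero => simp
    | add x y hx hy => simp only [map_add, TensorProduct.add_tmul, hx, hy]
    | tmul w d => simp

/-- The `D`-comodule obtained from a `C`-comodule along a coalgebra map `C → D`. -/
def map (φ : C →ₗc[k] D) (ρ : RightComodule k C V) : RightComodule k D V where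
  coact := φ.toLinearMap.lTensor V ∘ₗ ρ.coact
  coassoc x := by
    rw [LinearMap.comp_apply, assoc_rTensor_lTensor φ.toLinearMap rfl, ρ.coassoc,
      ← LinearMap.lTensor_comp_apply, ← LinearMap.lTensor_comp_apply]
    congr 2
    exact φ.map_comp_comul
  counit x := by
    refine Eq.trans ?_ (ρ.counit x)
    rw [LinearMap.comp_apply, ← LinearMap.lTensor_comp_apply]
    congr 3
    exact φ.counit_comp

theorem map_act (φ : C →ₗc[k] D) (ρ : RightComodule k C V) (f : WithConv (D →ₗ[k] k)) :
    (ρ.map φ).act f = ρ.act (WithConv.toConv (f.ofConv ∘ₗ φ.toLinearMap)) := by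
  ext v
  rw [act_apply, act_apply]
  exact slice_lTensor _ _ _

theorem coact_mem_of_le (ρ : RightComodule k C V) {D D' : Submodule k C} (h : D ≤ D') {v : V}
    (hv : ρ.coact v ∈ LinearMap.range (D.subtype.lTensor V)) :
    ρ.coact v ∈ LinearMap.range (D'.subtype.lTensor V) := by
  obtain ⟨t, ht⟩ := hv
  refine ⟨(Submodule.inclusion h).lTensor V t, ?_⟩
  rw [← LinearMap.lTensor_comp_apply, Submodule.subtype_comp_inclusion, ht]

/-- The action of a linear form depends only on its values on the matrix coefficients. -/
theorem act_congr (ρ : RightComodule k C V) {D : Submodule k C}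
    (hD : ∀ v, ρ.coact v ∈ LinearMap.range (D.subtype.lTensor V)) {f g : WithConv (C →ₗ[k] k)}
    (h : ∀ d ∈ D, f.ofConv d = g.ofConv d) : ρ.act f = ρ.act g := by
  ext v
  obtain ⟨t, ht⟩ := hD v
  rw [act_apply, act_apply, ← ht, slice_lTensor, slice_lTensor]
  congr 2
  ext d
  exact h d d.2

end RightComodule

namespace SuperCommHopfAlgebra

variable {k : Type u} [Field k] {A : Type v} [Ring A] [Algebra k A] [Coalgebra k A]
  (𝒜 : ZMod 2 → Submodule k A) [GradedAlgebra 𝒜] [SuperCommHopfAlgebra k 𝒜]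

/-- The projection `A → Ā` as a map of coalgebras. -/
def projCoalgHom : A →ₗc[k] Bar 𝒜 where
  __ := (proj 𝒜).toLinearMap
  counit_comp := barCounit_comp 𝒜
  map_comp_comul := (barComul_comp 𝒜).symm

namespace HopfSubalgebra

variable {𝒜} (B : HopfSubalgebra 𝒜)

variable {V : Type*} [AddCommGroup V] [Module k V]

theorem lTensor_incl_injective : Function.Injective (B.incl.lTensor V) :=
  Module.Flat.lTensor_preserves_injective_linearMap _ B.incl_injective

/-- The coaction of `A` on a comodule whose matrix coefficients lie in `B`, as a coaction of
`B`. -/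
def corestrictCoact (ρ : RightComodule k A V)
    (hρ : ∀ v, ρ.coact v ∈ LinearMap.range (B.incl.lTensor V)) :
    V →ₗ[k] V ⊗[k] B.toSubalgebra :=
  (LinearEquiv.ofInjective _ B.lTensor_incl_injective).symm.toLinearMap ∘ₗ
    ρ.coact.codRestrict _ hρ

theorem lTensor_corestrictCoact (ρ : RightComodule k A V)
    (hρ : ∀ v, ρ.coact v ∈ LinearMap.range (B.incl.lTensor V)) (v : V) :
    B.incl.lTensor V (B.corestrictCoact ρ hρ v) = ρ.coact v :=
  congrArg Subtype.val ((LinearEquiv.ofInjective _ B.lTensor_incl_injective).apply_symm_apply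
    (ρ.coact.codRestrict _ hρ v))

/-- A comodule over `A` whose matrix coefficients lie in `B`, as a comodule over `B`. -/
def corestrict (ρ : RightComodule k A V)
    (hρ : ∀ v, ρ.coact v ∈ LinearMap.range (B.incl.lTensor V)) :
    RightComodule k B.toSubalgebra V where
  coact := B.corestrictCoact ρ hρ
  coassoc x := by
    refine Module.Flat.lTensor_preserves_injective_linearMap (M := V) _ B.inclSq_injective ?_
    rw [← RightComodule.assoc_rTensor_lTensor B.incl
      (LinearMap.ext (B.lTensor_corestrictCoact ρ hρ)), lTensor_corestrictCoact, ρ.coassoc,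
      ← B.lTensor_corestrictCoact ρ hρ, ← LinearMap.lTensor_comp_apply,
      ← LinearMap.lTensor_comp_apply]
    congr 2
    exact B.inclSq_comp_comul.symm
  counit x := by
    refine Eq.trans ?_ (ρ.counit x)
    rw [← B.lTensor_corestrictCoact ρ hρ, ← LinearMap.lTensor_comp_apply]
    rfl

theorem corestrict_act (ρ : RightComodule k A V)
    (hρ : ∀ v, ρ.coact v ∈ LinearMap.range (B.incl.lTensor V)) (f : A →ₗ[k] k) :
    (B.corestrict ρ hρ).act (WithConv.toConv (f ∘ₗ B.incl)) = ρ.act (WithConv.toConv f) := by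
  ext v
  rw [RightComodule.act_apply, RightComodule.act_apply, ← B.lTensor_corestrictCoact ρ hρ,
    slice_lTensor]
  rfl

end HopfSubalgebra

theorem exists_finset_mem_oddIdeal {x : A} (hx : x ∈ oddIdeal 𝒜) :
    ∃ F : Finset A, ∀ B : HopfSubalgebra 𝒜, (F : Set A) ⊆ B.toSubalgebra →
      ∃ h : x ∈ B.toSubalgebra, ⟨x, h⟩ ∈ oddIdeal B.gr := by
  classical
  induction hx using Submodule.span_induction with
  | mem y hy =>
    exact ⟨{y}, fun B hB => ⟨hB (by simp), Ideal.subset_span hy⟩⟩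
  | zero => exact ⟨∅, fun B _ => ⟨zero_mem _, Ideal.zero_mem _⟩⟩
  | add x y _ _ hx hy =>
    obtain ⟨F, hF⟩ := hx
    obtain ⟨G, hG⟩ := hy
    refine ⟨F ∪ G, fun B hB => ?_⟩
    rw [Finset.coe_union, Set.union_subset_iff] at hB
    obtain ⟨h1, h1'⟩ := hF B hB.1
    obtain ⟨h2, h2'⟩ := hG B hB.2
    exact ⟨add_mem h1 h2, Ideal.add_mem _ h1' h2'⟩
  | smul a x _ hx =>
    obtain ⟨F, hF⟩ := hx
    refine ⟨insert a F, fun B hB => ?_⟩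
    rw [Finset.coe_insert, Set.insert_subset_iff] at hB
    obtain ⟨h1, h1'⟩ := hF B hB.2
    exact ⟨mul_mem hB.1 h1, Ideal.mul_mem_left _ ⟨a, hB.1⟩ h1'⟩

/-- A finite-dimensional subspace of the odd ideal of `A` is contained in the odd ideal of all
sufficiently large Hopf subalgebras. -/
theorem exists_finset_forall_mem_oddIdeal {W : Submodule k A} [FiniteDimensional k W]
    (hW : ∀ x ∈ W, x ∈ oddIdeal 𝒜) :
    ∃ F : Finset A, ∀ B : HopfSubalgebra 𝒜, (F : Set A) ⊆ B.toSubalgebra →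
      ∀ x ∈ W, ∃ h : x ∈ B.toSubalgebra, ⟨x, h⟩ ∈ oddIdeal B.gr := by
  classical
  obtain ⟨Z, hZ⟩ := Module.Finite.iff_fg.mp ‹FiniteDimensional k W›
  choose! F hF using fun z hz => exists_finset_mem_oddIdeal 𝒜
    (hW z (hZ.le (Submodule.subset_span (Finset.mem_coe.mpr hz))))
  refine ⟨Z.biUnion F, fun B hB x hx => ?_⟩
  rw [← hZ] at hx
  induction hx using Submodule.span_induction with
  | mem z hz =>
    exact hF z hz B fun a ha => hB (Finset.mem_coe.mpr (Finset.mem_biUnion.mpr ⟨z, hz, ha⟩))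
  | zero => exact ⟨zero_mem _, Ideal.zero_mem _⟩
  | add x y _ _ hx hy =>
    obtain ⟨h1, h1'⟩ := hx
    obtain ⟨h2, h2'⟩ := hy
    exact ⟨add_mem h1 h2, Ideal.add_mem _ h1' h2'⟩
  | smul c x _ hx =>
    obtain ⟨h1, h1'⟩ := hx
    exact ⟨Subalgebra.smul_mem _ h1 c, Submodule.smul_of_tower_mem _ c h1'⟩

/-- If `Ā` is irreducible as a coalgebra, then so is `A`. The matrix coefficients of a simple
comodule `V` lie in a finitely generated Hopf subalgebra `B`. It can be chosen so large that on
these coefficients the linear forms on `B̄` agree with linear forms on `Ā`, so that `V` is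
unipotent over `B̄`. -/
theorem isIrreducibleCoalgebra_of_bar (h2 : (2 : k) ≠ 0) (hA : IsConilpotent k (Bar 𝒜)) :
    IsIrreducibleCoalgebra k A := by
  classical
  intro V _ _ ρ hρ
  have := ρ.finiteDimensional_of_isSimple hρ
  have := hρ.1
  obtain ⟨D₀, _, -, hD₀⟩ := ρ.exists_isSubcoalgebra
  let D : Submodule k A := D₀ ⊔ Submodule.span k {1}
  have h1D : (1 : A) ∈ D := Submodule.mem_sup_right (Submodule.mem_span_singleton_self 1)
  have hD (v) := ρ.coact_mem_of_le (le_sup_left : D₀ ≤ D) (hD₀ v)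
  let W : Submodule k A := D ⊓ (oddIdeal 𝒜).restrictScalars k
  obtain ⟨F, hF⟩ := exists_finset_forall_mem_oddIdeal 𝒜 (W := W) fun x hx => hx.2
  obtain ⟨Z, hZ⟩ := Module.Finite.iff_fg.mp (inferInstance : FiniteDimensional k D)
  obtain ⟨B, hB, E, _, hE⟩ := exists_hopfSubalgebra 𝒜 h2 (F ∪ Z)
  rw [Finset.coe_union, Set.union_subset_iff] at hB
  have hDB : D ≤ Subalgebra.toSubmodule B.toSubalgebra := by
    rw [← hZ]
    exact Submodule.span_le.mpr hB.2
  have hρB (v) : ρ.coact v ∈ LinearMap.range (B.incl.lTensor V) := ρ.coact_mem_of_le hDB (hD v)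
  obtain ⟨N, hN⟩ := exists_oddIdeal_pow_eq_bot B.gr h2 hE
  have := finiteDimensional_range_of_isOddDerivation B.gr
    (isOddDerivation_cotangentProj (k := k) B.gr) hE
  obtain ⟨m, hm⟩ := hA.exists_act_prod_eq_zero (ρ.map (projCoalgHom 𝒜))
  -- on `V`, the augmentation ideal of the dual of `B̄` acts through the one of the dual of `Ā`
  have key (f : WithConv (B.toSubalgebra →ₗ[k] k)) (hf : f ∈ evenAugmentation B.gr) :
      ∃ g : WithConv (Bar 𝒜 →ₗ[k] k), g.ofConv 1 = 0 ∧
        (B.corestrict ρ hρB).act f = (ρ.map (projCoalgHom 𝒜)).act g := by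
    obtain ⟨r, hr⟩ := LinearMap.exists_leftInverse_of_injective B.incl
      (LinearMap.ker_eq_bot.mpr B.incl_injective)
    have hfr : f = WithConv.toConv ((f.ofConv ∘ₗ r) ∘ₗ B.incl) := by
      rw [LinearMap.comp_assoc, hr, LinearMap.comp_id]
    have hfr' (b : B.toSubalgebra) : f.ofConv (r b) = f.ofConv b :=
      congrArg f.ofConv (LinearMap.congr_fun hr b)
    have hker : (f.ofConv ∘ₗ r) ∘ₗ D.subtype ∈
        (LinearMap.ker ((proj (k := k) 𝒜).toLinearMap ∘ₗ D.subtype)).dualAnnihilator := by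
      rw [Submodule.mem_dualAnnihilator]
      intro x hx
      obtain ⟨h, h'⟩ := hF B hB.1 x ⟨x.2, Ideal.Quotient.eq_zero_iff_mem.mp hx⟩
      exact (hfr' ⟨x, h⟩).trans (hf.2 _ h')
    rw [← LinearMap.range_dualMap_eq_dualAnnihilator_ker] at hker
    obtain ⟨g, hg⟩ := hker
    have hg' (d) (hd : d ∈ D) : g (proj 𝒜 d) = f.ofConv (r d) :=
      LinearMap.congr_fun hg ⟨d, hd⟩
    refine ⟨WithConv.toConv g, ?_, ?_⟩
    · have h := hg' 1 h1D
      rw [map_one] at h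
      exact h.trans ((hfr' 1).trans hf.1)
    · rw [RightComodule.map_act, hfr, B.corestrict_act]
      exact ρ.act_congr hD fun d hd => (hg' d hd).symm
  have hprod (l : List (WithConv (B.toSubalgebra →ₗ[k] k))) :
      (∀ f ∈ l, f ∈ evenAugmentation B.gr) → ∃ l' : List (WithConv (Bar 𝒜 →ₗ[k] k)),
        l'.length = l.length ∧ (∀ g ∈ l', g.ofConv 1 = 0) ∧
          (B.corestrict ρ hρB).act l.prod = (ρ.map (projCoalgHom 𝒜)).act l'.prod := by
    induction l with
    | nil => exact fun _ => ⟨[], rfl, by simp, by simp⟩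
    | cons f l ih =>
      intro hl
      obtain ⟨l', h1, h2, h3⟩ := ih fun g hg => hl g (List.mem_cons_of_mem _ hg)
      obtain ⟨g, hg, hfg⟩ := key f (hl f List.mem_cons_self)
      refine ⟨g :: l', by simp [h1], ?_, ?_⟩
      · rintro g' hg'
        rcases List.mem_cons.mp hg' with rfl | hg'
        · exact hg
        · exact h2 _ hg'
      · rw [List.prod_cons, List.prod_cons, map_mul, map_mul, hfg, h3]
  obtain ⟨v, hv, hv'⟩ := exists_coact_eq_tmul_one B.gr (B.corestrict ρ hρB) h2 hN m
    fun l hl hf => by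
      obtain ⟨l', h1, h2, h3⟩ := hprod l hf
      rw [h3]
      exact hm l' (h1 ▸ hl) h2
  refine ρ.isTrivial_of_isSimple hρ hv ?_
  rw [← B.lTensor_corestrictCoact ρ hρB]
  refine (congrArg _ hv').trans ?_
  rw [LinearMap.lTensor_tmul]
  rfl

/-- If `A` is irreducible as a coalgebra, then so is its quotient `Ā`. -/
theorem isIrreducibleCoalgebra_bar (hA : IsIrreducibleCoalgebra k A) :
    IsIrreducibleCoalgebra k (Bar 𝒜) :=
  (hA.isConilpotent.of_surjective (projCoalgHom 𝒜) (proj_surjective 𝒜)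
    (map_one (proj 𝒜))).isIrreducibleCoalgebra (map_one (barCounit 𝒜))

end SuperCommHopfAlgebra

end

theorem theorem9p4 {k : Type u} [Field k] (hchar : ringChar k ≠ 2)
    (G : SuperAffineGroup.{u, v} k) :
    G.IsUnipotent ↔ G.ev.IsUnipotent := by
  refine ⟨fun h => SuperCommHopfAlgebra.isIrreducibleCoalgebra_bar G.gr h, fun h => ?_⟩
  exact SuperCommHopfAlgebra.isIrreducibleCoalgebra_of_bar G.gr (Ring.two_ne_zero hchar)
    (IsIrreducibleCoalgebra.isConilpotent h)
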